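/- All graphs are finite and simple. An $r$-partite graph comes with a partition of its vertex set into $r$ independent sets, its parts; for an integer $m\ge 0$, an $m$-IT of it is an independent set of exactly $m$ vertices containing at most one vertex of each part. For integers $r, D\ge 1$ and $\Delta\ge 0$, let $n(r,D,\Delta)$ denote the largest integer $n\ge 0$ for which there is an $r$-partite graph with at least $n$ vertices in each part, with maximum degree $\Delta$, and without an $(r-D+1)$-IT. Theorem 1.4. Let $r,d,q,k,\Delta\ge 0$ be integers such that $r=q(d+1)+k$ and $0\le k\le d$, and suppose that $q\ge 3$ is odd. Then the largest integer defining $n(r,d+1,\Delta)$ exists, and \[ n(r,d+1,\Delta)\le\max\left\{2\Delta\left(1-\frac{6d+7}{6r}\right),\ 2\Delta\left(1-\frac{1}{q-1}\right)\right\}. \] -/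

import Mathlib

/-- `T` is an independent `m`-transversal (an `m`-IT) of the graph `G` with respect to the
`r`-partition given by the colour classes of `c`: an independent set of `m` vertices
with at most one vertex in each part. -/
structure IsIndepTransversal {V : Type*} {r : ℕ} (G : SimpleGraph V) (c : G.Coloring (Fin r))
    (m : ℕ) (T : Finset V) : Prop where
  indep : G.IsIndepSet (T : Set V)
  injOn : Set.InjOn c (T : Set V)
  card_eq : T.card = m

/-- There is a finite `r`-partite graph with at least `n` vertices in each part and maximum
degree `Δ` that has no `(r - D + 1)`-IT. The parts are the colour classes of a proper colouring
by `Fin r`. (`r - D + 1` is written `r + 1 - D`, which avoids truncation when `D = r + 1`.) -/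
def ExistsGraphWithoutIT (r D Δ n : ℕ) : Prop :=
  ∃ (V : Type) (_ : Fintype V) (G : SimpleGraph V) (_ : DecidableRel G.Adj)
    (c : G.Coloring (Fin r)),
    (∀ i : Fin r, n ≤ (c.colorClass i).ncard) ∧
    G.maxDegree = Δ ∧
    ¬ ∃ T : Finset V, IsIndepTransversal G c (r + 1 - D) T

/-- `n(r, D, Δ)`: the largest `n` for which there is an `r`-partite graph with at least `n`
vertices in each part, maximum degree `Δ`, and no `(r - D + 1)`-IT. -/
noncomputable def nExtremal (r D Δ : ℕ) : ℕ :=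
  sSup {n : ℕ | ExistsGraphWithoutIT r D Δ n}

/-! Suppose all classes have at least `n` vertices, with `n` beyond both bounds, and every partial
independent transversal misses at least `D = d + 1` classes; delete edges until no further deletion
preserves this. The first bound says that dominating `y` classes takes at least `2(y - D)` vertices,
and that a dominating set of about this size wastes less than `Δ/3`. The second says `n m > 2Δ(m -
1)` for `1 ≤ m < q`.

Szabó–Tardos alternation (`exists_dominating`) turns the deficiency into a full pair: a set `S` of
classes dominated by an induced matching of `|S| - D` edges that forms a forest with `D` components
on `S`. The count is so tight that such matchings are rigid. In a full pair of maximum size, the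
possible replacements for the two ends of an edge form a complete bipartite graph with sides above
`2Δ/3` (`IsSys.swap_adj`, `IsSys.lt_card_swap`). Iterating replacements partitions the vertices of
`S` into blocks, one for each end, with opposite blocks completely joined. Since `r < (q + 1) D`,
some component `C` has at most `q` classes, and the second bound forces exactly `q`.

By edge-minimality every edge of the graph lies in a full pair. Overlaying that pair with the blocks
on `C` shows that an edge between two blocks joins opposite ones (`BlockSystem.opposite_of_adj`).
Hence one vertex of each block can be chosen freely, and each choice traces a spanning tree of `C`
(`IsSys.treeSystem`). Such a system of set pairs admits a partition of `C` into `X` and `Y` that are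
met by at most `2|X| - 1` and `2|Y| - 1` blocks (`TreeSystem.exists_partition`). As `q` is odd, the
smaller part, say `X`, has `2|X| < q`. It is dominated by `2|X| - 1` vertices, so `n|X| ≤ Δ(2|X| -
1)`, against the second bound for `m = 2|X|`. -/

namespace IndepTransversal

open scoped Classical

set_option linter.unusedSectionVars false

/-! ### Forests in multigraphs: connectivity, orientations, counting components. -/

section Conn

variable {ι ι' J J' : Type*}

/-- Connectedness in the multigraph on `ι` whose edges are `e i false – e i true`, `i ∈ A`. -/
def Conn (e : J → Bool → ι) (A : Set J) : ι → ι → Prop :=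
  Relation.EqvGen fun c d => ∃ i ∈ A, c = e i false ∧ d = e i true

/-- No edge in `A` is spanned by the others: the multigraph is a forest. -/
def Acyc (e : J → Bool → ι) (A : Set J) : Prop :=
  ∀ i ∈ A, ¬ Conn e (A \ {i}) (e i false) (e i true)

variable {e : J → Bool → ι} {A B : Set J} {c d x : ι}

theorem Conn.refl (c : ι) : Conn e A c c := Relation.EqvGen.refl c

theorem Conn.of_eq (h : c = d) : Conn e A c d := h ▸ Conn.refl c

theorem Conn.symm (h : Conn e A c d) : Conn e A d c := Relation.EqvGen.symm _ _ h

theorem Conn.trans (h : Conn e A c d) (h' : Conn e A d x) : Conn e A c x :=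
  Relation.EqvGen.trans _ _ _ h h'

theorem Conn.edge {i : J} (hi : i ∈ A) (b b' : Bool) : Conn e A (e i b) (e i b') := by
  have h : Conn e A (e i false) (e i true) := Relation.EqvGen.rel _ _ ⟨i, hi, rfl, rfl⟩
  cases b <;> cases b'
  · exact Conn.refl _
  · exact h
  · exact h.symm
  · exact Conn.refl _

theorem Conn.lift {e' : J' → Bool → ι'} {A' : Set J'} {g : ι → ι'}
    (h : ∀ i ∈ A, Conn e' A' (g (e i false)) (g (e i true))) (hcd : Conn e A c d) :
    Conn e' A' (g c) (g d) := by
  induction hcd with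
  | rel x y hxy =>
    obtain ⟨i, hi, rfl, rfl⟩ := hxy
    exact h i hi
  | refl x => exact Conn.refl _
  | symm x y _ ih => exact ih.symm
  | trans x y z _ _ ih ih' => exact ih.trans ih'

theorem Conn.mono (h : A ⊆ B) (hcd : Conn e A c d) : Conn e B c d :=
  hcd.lift (g := id) fun _ hi => Conn.edge (h hi) false true

theorem Conn.congr {e' : J → Bool → ι} (h : ∀ i ∈ A, ∀ b, e i b = e' i b)
    (hcd : Conn e A c d) : Conn e' A c d :=
  hcd.lift (g := id) fun i hi => by
    rw [h i hi, h i hi]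
    exact Conn.edge hi _ _

theorem Conn.mem_iff {S : Set ι} (h : ∀ i ∈ A, e i false ∈ S ↔ e i true ∈ S)
    (hcd : Conn e A c d) : c ∈ S ↔ d ∈ S := by
  induction hcd with
  | rel x y hxy =>
    obtain ⟨i, hi, rfl, rfl⟩ := hxy
    exact h i hi
  | refl x => rfl
  | symm x y _ ih => exact ih.symm
  | trans x y z _ _ ih ih' => exact ih.trans ih'

theorem Conn.insert_cases {i : J} (hcd : Conn e (insert i A) c d) :
    Conn e A c d ∨ ∃ b, Conn e A c (e i b) ∧ Conn e A (e i !b) d := by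
  induction hcd with
  | rel x y hxy =>
    obtain ⟨j, hj, rfl, rfl⟩ := hxy
    rcases hj with rfl | hj
    · exact Or.inr ⟨false, Conn.refl _, Conn.refl _⟩
    · exact Or.inl (Conn.edge hj _ _)
  | refl x => exact Or.inl (Conn.refl _)
  | symm x y _ ih =>
    rcases ih with h | ⟨b, h, h'⟩
    · exact Or.inl h.symm
    · exact Or.inr ⟨!b, h'.symm, by simpa using h.symm⟩
  | trans x y z _ _ ih ih' =>
    rcases ih with h | ⟨b, h1, h2⟩
    · rcases ih' with h' | ⟨b', h1', h2'⟩
      · exact Or.inl (h.trans h')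
      · exact Or.inr ⟨b', h.trans h1', h2'⟩
    · rcases ih' with h' | ⟨b', h1', h2'⟩
      · exact Or.inr ⟨b, h1, h2.trans h'⟩
      · by_cases hb : b' = b
        · subst hb
          exact Or.inr ⟨b', h1, h2'⟩
        · obtain rfl : b = !b' := by cases b <;> cases b' <;> simp_all
          exact Or.inl (h1.trans h2')

theorem Acyc.mono (h : A ⊆ B) (hB : Acyc e B) : Acyc e A := fun i hi hc =>
  hB i (h hi) (hc.mono (Set.sdiff_subset_sdiff_left h))

theorem Acyc.congr {e' : J → Bool → ι} (h : ∀ i ∈ A, ∀ b, e i b = e' i b)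
    (hA : Acyc e A) : Acyc e' A := fun i hi hc => hA i hi <| by
  rw [h i hi, h i hi]
  exact hc.congr fun j hj b => (h j hj.1 b).symm

theorem Acyc.insert_edge {i : J} (hA : Acyc e A) (h : ¬ Conn e A (e i false) (e i true)) :
    Acyc e (insert i A) := by
  have h' : ∀ b, ¬ Conn e A (e i b) (e i !b) := by
    intro b hb
    cases b
    · exact h hb
    · exact h hb.symm
  intro j hj hc
  by_cases hji : j = i
  · subst hji
    exact h (hc.mono (by intro _ hk; simpa [hk.2] using hk.1.resolve_left hk.2))
  · have hjA : j ∈ A := hj.resolve_left hji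
    have hc' : Conn e (insert i (A \ {j})) (e j false) (e j true) := hc.mono (by
      rintro k ⟨rfl | hk, hkj⟩
      · exact Or.inl rfl
      · exact Or.inr ⟨hk, hkj⟩)
    rcases hc'.insert_cases with h1 | ⟨b, h1, h2⟩
    · exact hA j hjA h1
    · exact h' b ((h1.symm.mono Set.sdiff_subset).trans
        ((Conn.edge hjA _ _).trans (h2.symm.mono Set.sdiff_subset)))

theorem Acyc.not_conn {i : J} (hi : i ∉ A) (h : Acyc e (insert i A)) :
    ¬ Conn e A (e i false) (e i true) := fun hc =>
  h i (Or.inl rfl) (hc.mono fun _ hk => ⟨Or.inr hk, fun hki => hi (hki ▸ hk)⟩)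

theorem Acyc.not_conn' {i : J} (hA : Acyc e A) (hi : i ∈ A) (b : Bool) :
    ¬ Conn e (A \ {i}) (e i b) (e i !b) := by
  intro h
  apply hA i hi
  cases b
  · exact h
  · exact h.symm

theorem conn_comp_iff {f : J' → J} (A' : Set J') :
    Conn (fun i => e (f i)) A' c d ↔ Conn e (f '' A') c d := by
  constructor
  · exact fun h => h.lift (g := id) fun i hi =>
      Conn.edge (e := e) (Set.mem_image_of_mem f hi) false true
  · refine fun h => h.lift (g := id) ?_
    rintro _ ⟨i, hi, rfl⟩
    exact Conn.edge (e := fun i => e (f i)) hi false true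

theorem Acyc.comp_label {f : J' → J} (hf : f.Injective) {A' : Set J'} (h : Acyc e (f '' A')) :
    Acyc (fun i => e (f i)) A' := fun i hi hc => by
  rw [conn_comp_iff, Set.image_sdiff hf, Set.image_singleton] at hc
  exact h _ (Set.mem_image_of_mem f hi) hc

theorem Acyc.of_comp_label {f : J' → J} (hf : f.Injective) {A' : Set J'}
    (h : Acyc (fun i => e (f i)) A') : Acyc e (f '' A') := by
  rintro _ ⟨i, hi, rfl⟩ hc
  rw [← Set.image_singleton, ← Set.image_sdiff hf, ← conn_comp_iff] at hc
  exact h i hi hc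

/-- An orientation choosing one end of every edge, injectively and off a set that meets every
component at most once. -/
theorem exists_orientation (A : Finset J) (hA : Acyc e (A : Set J)) (T : Set ι)
    (hT : ∀ s ∈ T, ∀ t ∈ T, Conn e (A : Set J) s t → s = t) :
    ∃ f : J → Bool, Set.InjOn (fun i => e i (f i)) (A : Set J) ∧
      ∀ i ∈ A, e i (f i) ∉ T := by
  induction A using Finset.induction_on generalizing T with
  | empty => exact ⟨fun _ => false, by simp, by simp⟩
  | insert i A hi ih =>
    have hsub : (A : Set J) ⊆ ((insert i A : Finset J) : Set J) := by
      intro j hj; simpa using Or.inr hj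
    have hiA : i ∈ ((insert i A : Finset J) : Set J) := by simp
    have hnc : ¬ Conn e (A : Set J) (e i false) (e i true) := by
      rw [Finset.coe_insert] at hA
      exact hA.not_conn (by simpa using hi)
    -- If both ends were joined to `T`, the two elements of `T` would be connected through `i`,
    -- hence equal, and `i` would close a cycle. The end found here is added to `T`, so that no
    -- other edge chooses it.
    obtain ⟨b, hb⟩ : ∃ b, ∀ t ∈ T, ¬ Conn e (A : Set J) (e i b) t := by
      by_contra! hcon
      obtain ⟨t, ht, h1⟩ := hcon false
      obtain ⟨t', ht', h2⟩ := hcon true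
      have : t = t' := hT t ht t' ht' ((h1.mono hsub).symm.trans
        ((Conn.edge hiA _ _).trans (h2.mono hsub)))
      subst this
      exact hnc (h1.trans h2.symm)
    obtain ⟨f, hf, hf'⟩ := ih (hA.mono hsub) (insert (e i b) T) (by
      rintro s (rfl | hs) t (rfl | ht) hst
      · rfl
      · exact (hb t ht hst).elim
      · exact (hb s hs hst.symm).elim
      · exact hT s hs t ht (hst.mono hsub))
    have hne : ∀ j ∈ A, j ≠ i := fun j hj h => hi (h ▸ hj)
    refine ⟨Function.update f i b, ?_, ?_⟩
    · intro j hj k hk hjk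
      simp only [Finset.coe_insert, Set.mem_insert_iff, Finset.mem_coe] at hj hk
      rcases hj with rfl | hj <;> rcases hk with rfl | hk
      · rfl
      · simp only [Function.update_self, Function.update_of_ne (hne k hk)] at hjk
        exact (hf' k hk (Or.inl hjk.symm)).elim
      · simp only [Function.update_self, Function.update_of_ne (hne j hj)] at hjk
        exact (hf' j hj (Or.inl hjk)).elim
      · simp only [Function.update_of_ne (hne k hk), Function.update_of_ne (hne j hj)] at hjk
        exact hf hj hk hjk
    · intro j hj
      rcases Finset.mem_insert.1 hj with rfl | hj
      · simp only [Function.update_self]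
        exact fun h => hb _ h (Conn.refl _)
      · simp only [Function.update_of_ne (hne j hj)]
        exact fun h => hf' j hj (Or.inr h)

theorem card_lt_of_acyc (A : Finset J) (hA : Acyc e (A : Set J)) (X : Finset ι)
    (hX : X.Nonempty) (h : ∀ i ∈ A, ∀ b, e i b ∈ X) : A.card < X.card := by
  obtain ⟨x, hx⟩ := hX
  obtain ⟨f, hf, hf'⟩ := exists_orientation A hA {x} (by rintro s rfl t rfl _; rfl)
  have : A.card ≤ (X.erase x).card :=
    Finset.card_le_card_of_injOn (fun i => e i (f i))
      (fun i hi => Finset.mem_coe.2 (Finset.mem_erase.2 ⟨hf' i hi, h i hi _⟩)) hf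
  rw [Finset.card_erase_of_mem hx] at this
  have := Finset.card_pos.2 ⟨x, hx⟩
  omega

/-- Each new edge merges at most two components, so discarding one vertex per edge suffices. This
bounds the number of components from below without acyclicity. -/
theorem exists_pairwise_not_conn (A : Finset J) (S : Finset ι) :
    ∃ T ⊆ S, S.card ≤ T.card + A.card ∧
      ∀ s ∈ T, ∀ t ∈ T, Conn e (A : Set J) s t → s = t := by
  induction A using Finset.induction_on with
  | empty =>
    refine ⟨S, Finset.Subset.refl _, by simp, fun s _ t _ h => ?_⟩
    have := h.mem_iff (S := {s}) (by simp)
    simpa [eq_comm] using this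
  | insert i A hi ih =>
    obtain ⟨T, hTS, hcard, hT⟩ := ih
    rw [Finset.card_insert_of_notMem hi, Finset.coe_insert]
    by_cases hex : ∃ s ∈ T, ∃ t ∈ T, s ≠ t ∧ Conn e (insert i (A : Set J)) s t
    · obtain ⟨s, hs, t, ht, hst, hc⟩ := hex
      rcases hc.insert_cases with h | ⟨b, h1, h2⟩
      · exact (hst (hT s hs t ht h)).elim
      · refine ⟨T.erase s, (Finset.erase_subset _ _).trans hTS, ?_, ?_⟩
        · rw [Finset.card_erase_of_mem hs]
          have := Finset.card_pos.2 ⟨s, hs⟩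
          omega
        · intro u hu v hv huv
          rw [Finset.mem_erase] at hu hv
          rcases huv.insert_cases with h | ⟨b', h1', h2'⟩
          · exact hT u hu.2 v hv.2 h
          · by_cases hb : b' = b
            · subst hb
              exact (hu.1 (hT u hu.2 s hs (h1'.trans h1.symm))).elim
            · obtain rfl : b = !b' := by cases b <;> cases b' <;> simp_all
              exact (hv.1 (hT v hv.2 s hs (h2'.symm.trans h1.symm))).elim
    · push Not at hex
      exact ⟨T, hTS, by omega, fun s hs t ht h => by
        by_contra hne
        exact hex s hs t ht hne h⟩

/-- Connectedness as a setoid. -/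
def connSetoid (e : J → Bool → ι) (A : Set J) : Setoid ι where
  r := Conn e A
  iseqv := ⟨Conn.refl, Conn.symm, Conn.trans⟩

/-- The type of components of the multigraph. -/
def Comp (e : J → Bool → ι) (A : Set J) : Type _ := Quotient (connSetoid e A)

/-- The component of a vertex of the multigraph. -/
def comp (e : J → Bool → ι) (A : Set J) (c : ι) : Comp e A :=
  Quotient.mk (connSetoid e A) c

theorem comp_eq_iff : comp e A c = comp e A d ↔ Conn e A c d :=
  Quotient.eq (r := connSetoid e A)

theorem comp_surjective : Function.Surjective (comp e A) := Quotient.mk_surjective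

theorem exists_transversal_comp {K : Type*} (g : ι → K) (X : Finset ι) :
    ∃ T ⊆ X, T.card = (X.image g).card ∧ Set.InjOn g (T : Set ι) ∧ T.image g = X.image g := by
  obtain ⟨T, hT, hTX⟩ := Set.SurjOn.exists_bijOn_subset
    (f := g) (s := (X : Set ι)) (t := ((X.image g : Finset K) : Set K))
    (by rw [Finset.coe_image]; exact fun _ h => h)
  lift T to Finset ι using X.finite_toSet.subset hT
  have him : T.image g = X.image g := by
    apply Finset.coe_injective
    rw [Finset.coe_image]
    exact hTX.image_eq
  exact ⟨T, by exact_mod_cast hT, by rw [← him, Finset.card_image_of_injOn hTX.injOn],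
    hTX.injOn, him⟩

/-- In a forest, components are vertices minus edges. For the upper bound, orient the edges away
from one representative of each component. -/
theorem card_image_comp (A : Finset J) {A' : Set J} (hA' : A' = A) (hA : Acyc e A')
    (X : Finset ι) (h : ∀ i ∈ A, ∀ b, e i b ∈ X) :
    (X.image (comp e A')).card + A.card = X.card := by
  subst hA'
  apply le_antisymm
  · obtain ⟨T, hTX, hT, hinj, -⟩ := exists_transversal_comp (comp e (A : Set J)) X
    obtain ⟨f, hf, hf'⟩ := exists_orientation A hA (T : Set ι)
      (fun s hs t ht hst => hinj hs ht (comp_eq_iff.2 hst))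
    have : A.card ≤ (X \ T).card :=
      Finset.card_le_card_of_injOn (fun i => e i (f i))
        (fun i hi => Finset.mem_coe.2 (Finset.mem_sdiff.2 ⟨h i hi _, hf' i hi⟩)) hf
    rw [Finset.card_sdiff_of_subset hTX] at this
    have := Finset.card_le_card hTX
    omega
  · obtain ⟨T, hTX, hT, hinj⟩ := exists_pairwise_not_conn (e := e) A X
    have : T.card ≤ (X.image (comp e (A : Set J))).card :=
      Finset.card_le_card_of_injOn (comp e (A : Set J))
        (fun t ht => Finset.mem_coe.2 (Finset.mem_image_of_mem _ (hTX ht)))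
        (fun s hs t ht hst => hinj s hs t ht (comp_eq_iff.1 hst))
    omega

/-- Acyclicity of a union: the second family is acyclic after contracting the first one. -/
theorem Acyc.sum [Finite J'] {e₁ : J → Bool → ι} {e₂ : J' → Bool → ι}
    (h₁ : Acyc e₁ Set.univ)
    (h₂ : Acyc (fun i b => comp e₁ Set.univ (e₂ i b)) Set.univ) :
    Acyc (Sum.elim e₁ e₂) Set.univ := by
  have := Fintype.ofFinite J'
  have key : ∀ (A' : Set J') c d, Conn (Sum.elim e₁ e₂) (Set.range Sum.inl ∪ Sum.inr '' A') c d →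
      Conn (fun i b => comp e₁ Set.univ (e₂ i b)) A' (comp e₁ Set.univ c)
        (comp e₁ Set.univ d) := by
    intro A' c d h
    refine h.lift ?_
    rintro _ (⟨i, rfl⟩ | ⟨i, hi, rfl⟩)
    · exact Conn.of_eq (comp_eq_iff.2 (Conn.edge (Set.mem_univ i) _ _))
    · exact Conn.edge (e := fun i b => comp e₁ Set.univ (e₂ i b)) hi _ _
  have ind : ∀ A' : Finset J',
      Acyc (Sum.elim e₁ e₂) (Set.range Sum.inl ∪ Sum.inr '' (A' : Set J')) := by
    intro A'
    induction A' using Finset.induction_on with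
    | empty =>
      have : Acyc (Sum.elim e₁ e₂) (Sum.inl '' Set.univ) := Acyc.of_comp_label Sum.inl_injective h₁
      simpa using this
    | insert i A' hi ih =>
      rw [Finset.coe_insert, Set.image_insert_eq, Set.union_insert]
      refine ih.insert_edge fun hc => ?_
      exact h₂ i (Set.mem_univ i) ((key _ _ _ hc).mono fun j hj =>
        ⟨Set.mem_univ j, fun hji => hi (hji ▸ hj)⟩)
  refine (ind Finset.univ).mono ?_
  rintro (i | i) _
  · exact Or.inl ⟨i, rfl⟩
  · exact Or.inr ⟨i, by simp, rfl⟩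

end Conn

/-! ### Szabó–Tardos alternating structures. -/

section Alternation

variable {V K J : Type*} {G : SimpleGraph V} {κ : V → K}

/-- A partial independent transversal of the classes of `κ`. -/
structure IsTrans (G : SimpleGraph V) (κ : V → K) (T : Finset V) : Prop where
  indep : ∀ u ∈ T, ∀ v ∈ T, ¬ G.Adj u v
  inj : ∀ u ∈ T, ∀ v ∈ T, κ u = κ v → u = v

/-- An induced matching whose edges form a forest on the classes of `κ`. -/
structure IsIMC (G : SimpleGraph V) (κ : V → K) (z : J → Bool → V) : Prop where
  adj : ∀ j b, G.Adj (z j b) (z j !b)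
  induced : ∀ i j, i ≠ j → ∀ b b', ¬ G.Adj (z i b) (z j b')
  acyc : Acyc (fun j b => κ (z j b)) Set.univ

variable {U : Set V} {S M : Finset K} {m : ℕ} {T T' : Finset V} {w : V} {ws : List V}

/-- A partial transversal of the classes in `S` inside `U`. -/
structure IsTransIn (G : SimpleGraph V) (κ : V → K) (U : Set V) (S : Finset K)
    (T : Finset V) : Prop extends IsTrans G κ T where
  mem_U : ∀ v ∈ T, v ∈ U
  mem_S : ∀ v ∈ T, κ v ∈ S

/-- The vertices of `T` with a neighbour in `ws`. -/
noncomputable def leaves (G : SimpleGraph V) (T : Finset V) (ws : List V) : Finset V :=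
  T.filter fun v => ∃ w ∈ ws, G.Adj w v

theorem mem_leaves {v : V} : v ∈ leaves G T ws ↔ v ∈ T ∧ ∃ w ∈ ws, G.Adj w v := by
  simp [leaves]

/-- An alternating structure: `T` is a transversal missing exactly the classes in `M`, and the
vertices of the list are added one by one, each in a class that is already reached. -/
def IsAlt (G : SimpleGraph V) (κ : V → K) (U : Set V) (S M : Finset K) (m : ℕ)
    (T : Finset V) : List V → Prop
  | [] => IsTransIn G κ U S T ∧ T.card = m ∧ S \ T.image κ = M
  | w :: ws => IsAlt G κ U S M m T ws ∧ w ∈ U ∧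
      (κ w ∈ M ∨ ∃ v ∈ leaves G T ws, κ w = κ v) ∧ (∀ w' ∈ ws, ¬ G.Adj w' w) ∧
      (∀ v ∈ leaves G T ws, ¬ G.Adj w v) ∧ (T.filter (G.Adj w)).Nonempty

/-- The potential of an alternating structure: it orders the structures lexicographically. -/
noncomputable def altPot (G : SimpleGraph V) (N : ℕ) (T : Finset V) : List V → ℕ
  | [] => 0
  -- Base-`N` digits, the earliest vertex being the most significant. Fewer neighbours in `T` give a
  -- larger digit, and a longer list gives an additional one.
  | w :: ws => altPot G N T ws + (N - (T.filter (G.Adj w)).card) * N ^ (N - ws.length - 1)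

theorem IsAlt.base (h : IsAlt G κ U S M m T ws) : IsAlt G κ U S M m T [] := by
  induction ws with
  | nil => exact h
  | cons w ws ih => exact ih h.1

theorem IsAlt.disj {v : V} (h : IsAlt G κ U S M m T ws) (hv : v ∈ T) : κ v ∉ M := by
  have := h.base.2.2
  rw [← this]
  simp only [Finset.mem_sdiff, Finset.mem_image, not_and, not_not]
  exact fun _ => ⟨v, hv, rfl⟩

theorem leaves_cons : leaves G T (w :: ws) = leaves G T ws ∪ T.filter (G.Adj w) := by
  ext v
  simp only [mem_leaves, Finset.mem_union, Finset.mem_filter, List.mem_cons, exists_eq_or_imp]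
  rw [or_comm, and_or_left]

theorem IsAlt.card_leaves_cons (h : IsAlt G κ U S M m T (w :: ws)) :
    (leaves G T (w :: ws)).card = (leaves G T ws).card + (T.filter (G.Adj w)).card := by
  rw [leaves_cons, Finset.card_union_of_disjoint]
  rw [Finset.disjoint_left]
  intro v hv hv'
  exact h.2.2.2.2.1 v hv (Finset.mem_filter.1 hv').2

theorem IsAlt.length_le (h : IsAlt G κ U S M m T ws) : ws.length ≤ (leaves G T ws).card := by
  induction ws with
  | nil => simp
  | cons w ws ih =>
    rw [h.card_leaves_cons, List.length_cons]
    exact Nat.add_le_add (ih h.1) (Finset.card_pos.2 h.2.2.2.2.2)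

theorem IsAlt.congr (h : IsAlt G κ U S M m T ws) (hT' : IsAlt G κ U S M m T' [])
    (hc : ∀ w ∈ ws, T'.filter (G.Adj w) = T.filter (G.Adj w)) (N : ℕ) :
    IsAlt G κ U S M m T' ws ∧ leaves G T' ws = leaves G T ws ∧
      altPot G N T' ws = altPot G N T ws := by
  induction ws with
  | nil => exact ⟨hT', by simp [leaves], rfl⟩
  | cons w ws ih =>
    obtain ⟨h1, h2, h3⟩ := ih h.1 fun w' hw' => hc w' (List.mem_cons_of_mem _ hw')
    have hw := hc w List.mem_cons_self
    refine ⟨?_, ?_, ?_⟩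
    · refine ⟨h1, h.2.1, ?_, h.2.2.2.1, ?_, ?_⟩
      · rw [h2]; exact h.2.2.1
      · rw [h2]; exact h.2.2.2.2.1
      · rw [hw]; exact h.2.2.2.2.2
    · rw [leaves_cons, leaves_cons, h2, hw]
    · simp only [altPot, h3, hw]

theorem IsAlt.reached (h : IsAlt G κ U S M m T ws) :
    ∀ w ∈ ws, κ w ∈ M ∨ ∃ v ∈ leaves G T ws, κ w = κ v := by
  induction ws with
  | nil => simp
  | cons w ws ih =>
    have : ∀ u, (κ u ∈ M ∨ ∃ v ∈ leaves G T ws, κ u = κ v) →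
        κ u ∈ M ∨ ∃ v ∈ leaves G T (w :: ws), κ u = κ v := by
      rintro u (hu | ⟨v, hv, hu⟩)
      · exact Or.inl hu
      · exact Or.inr ⟨v, by rw [leaves_cons]; exact Finset.mem_union_left _ hv, hu⟩
    intro u hu
    rcases List.mem_cons.1 hu with rfl | hu
    · exact this _ h.2.2.1
    · exact this _ (ih h.1 u hu)

theorem IsAlt.mem_U (h : IsAlt G κ U S M m T ws) : ∀ w ∈ ws, w ∈ U := by
  induction ws with
  | nil => simp
  | cons w ws ih =>
    intro u hu
    rcases List.mem_cons.1 hu with rfl | hu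
    · exact h.2.1
    · exact ih h.1 u hu

/-- Every list vertex brings at least one new leaf, so equality means exactly one, and these pairs
are the edges. They form a forest because each new edge runs from a reached class to a class not
reached before. -/
theorem IsAlt.exists_isIMC (h : IsAlt G κ U S M m T ws)
    (hcard : (leaves G T ws).card = ws.length) :
    ∃ (J : Type) (_ : Fintype J) (z : J → Bool → V), IsIMC G κ z ∧ Fintype.card J = ws.length ∧
      (∀ j b, z j b ∈ ws ∨ z j b ∈ leaves G T ws) ∧
      (∀ v, v ∈ ws ∨ v ∈ leaves G T ws → ∃ j b, z j b = v) := by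
  induction ws with
  | nil =>
    exact ⟨Empty, inferInstance, fun j => j.elim, ⟨fun j => j.elim, fun j => j.elim,
      fun j => j.elim⟩, rfl, fun j => j.elim, fun v hv => by simp [leaves] at hv⟩
  | cons w ws ih =>
    have h1 := h.card_leaves_cons
    have h2 := h.1.length_le
    have h3 := Finset.card_pos.2 h.2.2.2.2.2
    rw [List.length_cons] at hcard
    obtain ⟨J, hJ, z, hz, hzc, hz1, hz2⟩ := ih h.1 (by omega)
    obtain ⟨v, hv⟩ := Finset.card_eq_one.1 (show (T.filter (G.Adj w)).card = 1 by omega)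
    have hvmem : v ∈ T.filter (G.Adj w) := by simp [hv]
    rw [Finset.mem_filter] at hvmem
    have hvl : v ∉ leaves G T ws := fun hl => h.2.2.2.2.1 v hl hvmem.2
    have hwz : ∀ j b, ¬ G.Adj w (z j b) := fun j b hadj => by
      rcases hz1 j b with hj | hj
      · exact h.2.2.2.1 _ hj hadj.symm
      · exact h.2.2.2.2.1 _ hj hadj
    have hvz : ∀ j b, ¬ G.Adj v (z j b) := fun j b hadj => by
      rcases hz1 j b with hj | hj
      · exact hvl (mem_leaves.2 ⟨hvmem.1, _, hj, hadj.symm⟩)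
      · exact h.base.1.indep _ hvmem.1 _ (mem_leaves.1 hj).1 hadj
    let z' : Option J → Bool → V := fun o b => o.elim (bif b then v else w) (fun j => z j b)
    have hmem : ∀ u, u ∈ leaves G T (w :: ws) ↔ u ∈ leaves G T ws ∨ u = v := by
      intro u
      rw [leaves_cons, hv]
      simp [or_comm]
    refine ⟨Option J, inferInstance, z', ⟨?_, ?_, ?_⟩, by simp [hzc], ?_, ?_⟩
    · rintro (_ | j) b
      · cases b
        · exact hvmem.2
        · exact hvmem.2.symm
      · exact hz.adj j b
    · rintro (_ | i) (_ | j) hij b b'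
      · exact (hij rfl).elim
      · cases b
        · exact hwz j b'
        · exact hvz j b'
      · cases b'
        · exact fun hadj => hwz i b hadj.symm
        · exact fun hadj => hvz i b hadj.symm
      · exact hz.induced i j (fun hh => hij (by rw [hh])) b b'
    · have hac : Acyc (fun o b => κ (z' o b)) (Option.some '' Set.univ) :=
        Acyc.of_comp_label (e := fun o b => κ (z' o b)) (Option.some_injective J) hz.acyc
      have hX := hac.insert_edge (i := none) (fun hc => by
        have key := hc.mem_iff (S := {c | c ∈ M ∨ ∃ v ∈ leaves G T ws, c = κ v}) (by
          have hin : ∀ j b, κ (z j b) ∈ M ∨ ∃ v ∈ leaves G T ws, κ (z j b) = κ v := by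
            intro j b
            rcases hz1 j b with hj | hj
            · exact h.1.reached _ hj
            · exact Or.inr ⟨_, hj, rfl⟩
          rintro _ ⟨j, -, rfl⟩
          exact iff_of_true (hin j false) (hin j true))
        rcases key.1 h.2.2.1 with hk | ⟨u, hu, hk⟩
        · exact h.disj hvmem.1 hk
        · have : v = u := h.base.1.inj v hvmem.1 u (mem_leaves.1 hu).1 hk
          exact hvl (this ▸ hu))
      refine hX.mono ?_
      rintro (_ | j) _
      · exact Or.inl rfl
      · exact Or.inr ⟨j, trivial, rfl⟩
    · rintro (_ | j) b
      · cases b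
        · exact Or.inl List.mem_cons_self
        · exact Or.inr ((hmem _).2 (Or.inr rfl))
      · rcases hz1 j b with hj | hj
        · exact Or.inl (List.mem_cons_of_mem _ hj)
        · exact Or.inr ((hmem _).2 (Or.inl hj))
    · intro u hu
      rw [hmem, List.mem_cons] at hu
      rcases hu with (rfl | hu) | hu | rfl
      · exact ⟨none, false, rfl⟩
      · obtain ⟨j, b, hj⟩ := hz2 u (Or.inl hu)
        exact ⟨some j, b, hj⟩
      · obtain ⟨j, b, hj⟩ := hz2 u (Or.inr hu)
        exact ⟨some j, b, hj⟩
      · exact ⟨none, true, rfl⟩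

variable [Fintype V]

theorem IsAlt.length_lt (h : IsAlt G κ U S M m T ws) : ws.length < Fintype.card V + 1 :=
  Nat.lt_succ_of_le (h.length_le.trans (Finset.card_le_univ _))

theorem pow_step {N l : ℕ} (hl : l < N) : N * N ^ (N - l - 1) = N ^ (N - l) := by
  rw [← pow_succ']
  congr 1
  omega

/-- Digits are at most `N - 1`, as each list vertex has a neighbour in `T`; the summand `N ^ (N -
ws.length)` is one spare unit of the last digit. -/
theorem IsAlt.altPot_le (h : IsAlt G κ U S M m T ws) {N : ℕ} (hN : N = Fintype.card V + 1) :
    altPot G N T ws + N ^ (N - ws.length) ≤ N ^ N := by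
  induction ws with
  | nil => simp [altPot]
  | cons w ws ih =>
    have hl : ws.length < N := hN ▸ h.1.length_lt
    refine le_trans ?_ (ih h.1)
    have hd := Finset.card_pos.2 h.2.2.2.2.2
    have : (N - (T.filter (G.Adj w)).card + 1) * N ^ (N - ws.length - 1) ≤
        N * N ^ (N - ws.length - 1) := Nat.mul_le_mul_right _ (by omega)
    rw [pow_step hl, add_mul] at this
    simp only [altPot, List.length_cons]
    rw [show N - (ws.length + 1) = N - ws.length - 1 by omega]
    omega

/-- An undominated vertex in a reached class without neighbours in `T` can be used to increase
the potential. -/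
theorem IsAlt.improve {N : ℕ} (hN : N = Fintype.card V + 1)
    (hmax : ∀ T, IsTransIn G κ U S T → T.card ≤ m) (ws : List V) :
    ∀ (T : Finset V) (w : V), IsAlt G κ U S M m T ws → w ∈ U →
      (κ w ∈ M ∨ ∃ v ∈ leaves G T ws, κ w = κ v) → (∀ w' ∈ ws, ¬ G.Adj w' w) →
      T.filter (G.Adj w) = ∅ →
      ∃ T' ws', IsAlt G κ U S M m T' ws' ∧
        altPot G N T ws + N ^ (N - ws.length) ≤ altPot G N T' ws' := by
  have noM : ∀ (ws : List V) (T : Finset V) (w : V), IsAlt G κ U S M m T ws → w ∈ U →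
      T.filter (G.Adj w) = ∅ → κ w ∉ M := by
    intro ws T w hA hwU hT hM
    have hb := hA.base
    have hTw : ∀ v ∈ T, ¬ G.Adj w v := fun v hv hadj => by
      have : v ∈ T.filter (G.Adj w) := Finset.mem_filter.2 ⟨hv, hadj⟩
      simp [hT] at this
    have hwT : w ∉ T := fun h => hA.disj h hM
    have hne : ∀ v ∈ T, κ v ≠ κ w := fun v hv h => hA.disj hv (h ▸ hM)
    have := hmax (insert w T) {
      indep := by
        intro u hu v hv
        rcases Finset.mem_insert.1 hu with rfl | hu2 <;>
          rcases Finset.mem_insert.1 hv with rfl | hv2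
        · exact G.irrefl
        · exact hTw v hv2
        · exact fun h => hTw u hu2 h.symm
        · exact hb.1.indep u hu2 v hv2
      inj := by
        intro u hu v hv huv
        rcases Finset.mem_insert.1 hu with rfl | hu2 <;>
          rcases Finset.mem_insert.1 hv with rfl | hv2
        · rfl
        · exact (hne v hv2 huv.symm).elim
        · exact (hne u hu2 huv).elim
        · exact hb.1.inj u hu2 v hv2 huv
      mem_U := by
        intro v hv
        rcases Finset.mem_insert.1 hv with rfl | hv
        · exact hwU
        · exact hb.1.mem_U v hv
      mem_S := by
        intro v hv
        rcases Finset.mem_insert.1 hv with rfl | hv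
        · have := hb.2.2
          rw [← this] at hM
          exact (Finset.mem_sdiff.1 hM).1
        · exact hb.1.mem_S v hv }
    rw [Finset.card_insert_of_notMem hwT, hb.2.1] at this
    omega
  induction ws with
  | nil =>
    intro T w hA hwU hκ _ hT
    rcases hκ with h | ⟨v, hv, -⟩
    · exact (noM _ T w hA hwU hT h).elim
    · simp [leaves] at hv
  | cons w1 ws ih =>
    intro T w hA hwU hκ hws hT
    have hl : ws.length < N := hN ▸ hA.1.length_lt
    have hTw : ∀ v ∈ T, ¬ G.Adj w v := fun v hv hadj => by
      have : v ∈ T.filter (G.Adj w) := Finset.mem_filter.2 ⟨hv, hadj⟩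
      simp [hT] at this
    have hd := Finset.card_pos.2 hA.2.2.2.2.2
    -- A unit gained at the end of `ws` outweighs the digit of `w1` plus one unit of that digit, so
    -- it suffices to improve the shorter list.
    have hpot : ∀ P, altPot G N T ws + N ^ (N - ws.length) ≤ P →
        altPot G N T (w1 :: ws) + N ^ (N - (w1 :: ws).length) ≤ P := by
      intro P hP
      refine le_trans ?_ hP
      have : (N - (T.filter (G.Adj w1)).card + 1) * N ^ (N - ws.length - 1) ≤
          N * N ^ (N - ws.length - 1) := Nat.mul_le_mul_right _ (by omega)
      rw [pow_step hl, add_mul] at this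
      simp only [altPot, List.length_cons]
      rw [show N - (ws.length + 1) = N - ws.length - 1 by omega]
      omega
    have hκ' := hκ.resolve_left (noM _ T w hA hwU hT)
    by_cases hex : ∃ v ∈ leaves G T ws, κ w = κ v
    · obtain ⟨T', ws', h1, h2⟩ := ih T w hA.1 hwU (Or.inr hex)
        (fun w' hw' => hws w' (List.mem_cons_of_mem _ hw')) hT
      exact ⟨T', ws', h1, hpot _ h2⟩
    obtain ⟨v, hv, hwv⟩ := hκ'
    have hv' : v ∉ leaves G T ws := fun h => hex ⟨v, h, hwv⟩
    have hvT := (mem_leaves.1 hv).1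
    have hv1 : G.Adj w1 v := by
      obtain ⟨w', hw', hadj⟩ := (mem_leaves.1 hv).2
      rcases List.mem_cons.1 hw' with rfl | h
      · exact hadj
      · exact (hv' (mem_leaves.2 ⟨hvT, w', h, hadj⟩)).elim
    have hb := hA.base
    have hwT : w ∉ T := fun h => by
      have := hb.1.inj w h v hvT hwv
      subst this
      exact hws w1 List.mem_cons_self hv1
    -- Exchanging `v` for `w` changes no neighbourhood in `T` of earlier list vertices, since `v` is
    -- not one of their leaves; `w1` loses exactly one neighbour.
    set T' := insert w (T.erase v) with hT'
    have hmemT' : ∀ u, u ∈ T' ↔ u = w ∨ (u ≠ v ∧ u ∈ T) := by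
      intro u; simp [hT']
    have himg : T'.image κ = T.image κ := by
      ext c
      simp only [Finset.mem_image, hmemT']
      constructor
      · rintro ⟨u, rfl | hu, rfl⟩
        · exact ⟨v, hvT, hwv.symm⟩
        · exact ⟨u, hu.2, rfl⟩
      · rintro ⟨u, hu, rfl⟩
        by_cases huv : u = v
        · exact ⟨w, Or.inl rfl, by rw [huv, hwv]⟩
        · exact ⟨u, Or.inr ⟨huv, hu⟩, rfl⟩
    have hA' : IsAlt G κ U S M m T' [] := by
      refine ⟨{ indep := ?_, inj := ?_, mem_U := ?_, mem_S := ?_ }, ?_, ?_⟩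
      · intro u hu u' hu'
        rcases (hmemT' _).1 hu with rfl | hu2 <;> rcases (hmemT' _).1 hu' with rfl | hu2'
        · exact G.irrefl
        · exact hTw _ hu2'.2
        · exact fun h => hTw _ hu2.2 h.symm
        · exact hb.1.indep _ hu2.2 _ hu2'.2
      · intro u hu u' hu' huu
        rcases (hmemT' _).1 hu with rfl | hu2 <;> rcases (hmemT' _).1 hu' with rfl | hu2'
        · rfl
        · exact (hu2'.1 (hb.1.inj _ hu2'.2 v hvT (huu.symm.trans hwv))).elim
        · exact (hu2.1 (hb.1.inj _ hu2.2 v hvT (huu.trans hwv))).elim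
        · exact hb.1.inj _ hu2.2 _ hu2'.2 huu
      · intro u hu
        rcases (hmemT' _).1 hu with rfl | hu
        · exact hwU
        · exact hb.1.mem_U _ hu.2
      · intro u hu
        rcases (hmemT' _).1 hu with rfl | hu
        · rw [hwv]; exact hb.1.mem_S v hvT
        · exact hb.1.mem_S _ hu.2
      · rw [hT', Finset.card_insert_of_notMem (by simp [hwT]), Finset.card_erase_of_mem hvT,
          ← hb.2.1]
        have := Finset.card_pos.2 ⟨v, hvT⟩
        omega
      · rw [himg]; exact hb.2.2
    have hfil : ∀ u ∈ ws, T'.filter (G.Adj u) = T.filter (G.Adj u) := by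
      intro u hu
      ext x
      simp only [Finset.mem_filter, hmemT']
      constructor
      · rintro ⟨rfl | hx, hadj⟩
        · exact (hws u (List.mem_cons_of_mem _ hu) hadj).elim
        · exact ⟨hx.2, hadj⟩
      · rintro ⟨hx, hadj⟩
        refine ⟨Or.inr ⟨?_, hx⟩, hadj⟩
        rintro rfl
        exact hv' (mem_leaves.2 ⟨hx, u, hu, hadj⟩)
    have hfil1 : T'.filter (G.Adj w1) = (T.filter (G.Adj w1)).erase v := by
      ext x
      simp only [Finset.mem_filter, hmemT', Finset.mem_erase]
      constructor
      · rintro ⟨rfl | hx, hadj⟩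
        · exact (hws w1 List.mem_cons_self hadj).elim
        · exact ⟨hx.1, hx.2, hadj⟩
      · rintro ⟨hx1, hx2, hadj⟩
        exact ⟨Or.inr ⟨hx1, hx2⟩, hadj⟩
    have hcard1 : (T'.filter (G.Adj w1)).card = (T.filter (G.Adj w1)).card - 1 := by
      rw [hfil1, Finset.card_erase_of_mem (Finset.mem_filter.2 ⟨hvT, hv1⟩)]
    obtain ⟨c1, c2, c3⟩ := hA.1.congr hA' hfil N
    -- If `w1` lost its last neighbour, it plays the role of `w` for the shorter list; otherwise its
    -- digit has grown.
    by_cases hemp : T'.filter (G.Adj w1) = ∅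
    · obtain ⟨T2, ws2, h1, h2⟩ := ih T' w1 c1 hA.2.1 (by rw [c2]; exact hA.2.2.1)
        hA.2.2.2.1 hemp
      exact ⟨T2, ws2, h1, hpot _ (c3 ▸ h2)⟩
    · refine ⟨T', w1 :: ws, ⟨c1, hA.2.1, by rw [c2]; exact hA.2.2.1, hA.2.2.2.1,
        by rw [c2]; exact hA.2.2.2.2.1, Finset.nonempty_iff_ne_empty.2 hemp⟩, ?_⟩
      simp only [altPot, List.length_cons, c3, hcard1]
      have hle : (T.filter (G.Adj w1)).card ≤ Fintype.card V := Finset.card_le_univ _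
      rw [show N - (ws.length + 1) = N - ws.length - 1 by omega,
        show N - ((T.filter (G.Adj w1)).card - 1) = N - (T.filter (G.Adj w1)).card + 1 by omega,
        add_mul]
      omega

/-- An undominated vertex of a reached class either lengthens the list or, having no neighbour in
`T`, permits an improvement. Both raise the potential, which is bounded by `N ^ N`. -/
theorem IsAlt.exists_terminal {T₀ : Finset V} (h₀ : IsAlt G κ U S M m T₀ [])
    (hmax : ∀ T, IsTransIn G κ U S T → T.card ≤ m) :
    ∃ T ws, IsAlt G κ U S M m T ws ∧
      ∀ w ∈ U, (κ w ∈ M ∨ ∃ v ∈ leaves G T ws, κ w = κ v) →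
        (∃ w' ∈ ws, G.Adj w' w) ∨ ∃ v ∈ leaves G T ws, G.Adj v w := by
  by_contra! hcon
  set N := Fintype.card V + 1 with hN
  have step : ∀ n, ∃ T ws, IsAlt G κ U S M m T ws ∧ n ≤ altPot G N T ws := by
    intro n
    induction n with
    | zero => exact ⟨T₀, [], h₀, Nat.zero_le _⟩
    | succ n ih =>
      obtain ⟨T, ws, hA, hn⟩ := ih
      obtain ⟨w, hwU, hκ, hw1, hw2⟩ := hcon T ws hA
      by_cases hT : T.filter (G.Adj w) = ∅
      · obtain ⟨T', ws', h1, h2⟩ := IsAlt.improve hN hmax ws T w hA hwU hκ hw1 hT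
        have : 0 < N ^ (N - ws.length) := Nat.pow_pos (by omega)
        exact ⟨T', ws', h1, by omega⟩
      · refine ⟨T, w :: ws, ⟨hA, hwU, hκ, hw1, fun v hv h => hw2 v hv h.symm,
          Finset.nonempty_iff_ne_empty.2 hT⟩, ?_⟩
        have hle : (T.filter (G.Adj w)).card ≤ Fintype.card V := Finset.card_le_univ _
        have : 0 < (N - (T.filter (G.Adj w)).card) * N ^ (N - ws.length - 1) :=
          Nat.mul_pos (by omega) (Nat.pow_pos (by omega))
        simp only [altPot]
        omega
  obtain ⟨T, ws, hA, hn⟩ := step (N ^ N + 1)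
  have := hA.altPot_le hN
  omega

/-- **The Szabó–Tardos lemma.** Around a maximum partial transversal `T₀` there is a set of
classes, containing all those missed by `T₀`, whose vertices are dominated either by few vertices or
by an induced matching forming a forest. -/
theorem exists_dominating {T₀ : Finset V} (h₀ : IsTransIn G κ U S T₀)
    (hmax : ∀ T, IsTransIn G κ U S T → T.card ≤ T₀.card) (hM : S \ T₀.image κ = M) :
    ∃ Q, M ⊆ Q ∧ Q ⊆ S ∧
      ((∃ W : Finset V, 2 * M.card + W.card + 1 ≤ 2 * Q.card ∧
          ∀ v ∈ U, κ v ∈ Q → ∃ w ∈ W, G.Adj w v) ∨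
        ∃ (J : Type) (_ : Fintype J) (z : J → Bool → V), IsIMC G κ z ∧
          (∀ j b, z j b ∈ U ∧ κ (z j b) ∈ Q) ∧ Fintype.card J + M.card = Q.card ∧
          ∀ v ∈ U, κ v ∈ Q → ∃ j b, G.Adj (z j b) v) := by
  obtain ⟨T, ws, hA, hterm⟩ := IsAlt.exists_terminal (m := T₀.card) ⟨h₀, rfl, hM⟩ hmax
  have hb := hA.base
  have hMS : M ⊆ S := hb.2.2 ▸ Finset.sdiff_subset
  have hQ : (M ∪ (leaves G T ws).image κ).card = M.card + (leaves G T ws).card := by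
    rw [Finset.card_union_of_disjoint, Finset.card_image_of_injOn]
    · exact fun u hu v hv huv => hb.1.inj u (mem_leaves.1 hu).1 v (mem_leaves.1 hv).1 huv
    · rw [Finset.disjoint_left]
      intro c hc hc'
      obtain ⟨v, hv, rfl⟩ := Finset.mem_image.1 hc'
      exact hA.disj (mem_leaves.1 hv).1 hc
  have hreach : ∀ w, κ w ∈ M ∪ (leaves G T ws).image κ ↔
      (κ w ∈ M ∨ ∃ v ∈ leaves G T ws, κ w = κ v) := by
    intro w
    simp [eq_comm]
  refine ⟨M ∪ (leaves G T ws).image κ, Finset.subset_union_left, ?_, ?_⟩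
  · refine Finset.union_subset hMS ?_
    intro c hc
    obtain ⟨v, hv, rfl⟩ := Finset.mem_image.1 hc
    exact hb.1.mem_S v (mem_leaves.1 hv).1
  have hle := hA.length_le
  -- Either some list vertex has two leaves, and list and leaves together number less than twice the
  -- leaves, or they pair up into an induced matching.
  rcases hle.lt_or_eq with hlt | heq
  · left
    refine ⟨ws.toFinset ∪ leaves G T ws, ?_, ?_⟩
    · have h1 := Finset.card_union_le ws.toFinset (leaves G T ws)
      have h2 := ws.toFinset_card_le
      rw [hQ]
      omega
    · intro v hv hvQ
      rcases hterm v hv ((hreach v).1 hvQ) with ⟨w, hw, hadj⟩ | ⟨w, hw, hadj⟩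
      · exact ⟨w, by simp [hw], hadj⟩
      · exact ⟨w, by simp [hw], hadj⟩
  · right
    obtain ⟨J, hJ, z, hz, hzc, hz1, hz2⟩ := hA.exists_isIMC heq.symm
    refine ⟨J, hJ, z, hz, ?_, by rw [hQ]; omega, ?_⟩
    · intro j b
      rw [hreach]
      rcases hz1 j b with h | h
      · exact ⟨hA.mem_U _ h, hA.reached _ h⟩
      · exact ⟨hb.1.mem_U _ (mem_leaves.1 h).1, Or.inr ⟨_, h, rfl⟩⟩
    · intro v hv hvQ
      rcases hterm v hv ((hreach v).1 hvQ) with ⟨w, hw, hadj⟩ | ⟨w, hw, hadj⟩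
      · obtain ⟨j, b, rfl⟩ := hz2 w (Or.inl hw)
        exact ⟨j, b, hadj⟩
      · obtain ⟨j, b, rfl⟩ := hz2 w (Or.inr hw)
        exact ⟨j, b, hadj⟩

end Alternation

/-! ### Deficient graphs with large classes; contracting a matching. -/

section Host

variable {V ι J J₁ J₂ : Type*} [Fintype V] [Fintype ι] {G : SimpleGraph V} {κ : V → ι}
  {n Δ D : ℕ}

/-- The neighbourhood of a vertex. -/
noncomputable def nb (G : SimpleGraph V) (v : V) : Finset V := Finset.univ.filter (G.Adj v)

theorem mem_nb {u v : V} : u ∈ nb G v ↔ G.Adj v u := by simp [nb]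

/-- A graph of maximum degree at most `Δ` with classes of size at least `n` all of whose partial
independent transversals miss at least `D` classes, where `n` is large. -/
structure Host (G : SimpleGraph V) (κ : V → ι) (n Δ D : ℕ) : Prop where
  deg : ∀ v, (nb G v).card ≤ Δ
  size : ∀ c, n ≤ (Finset.univ.filter fun v => κ v = c).card
  missing : ∀ T, IsTrans G κ T → T.card + D ≤ Fintype.card ι
  one_le : 1 ≤ D
  -- That is, `n * y > 2Δ(y - D) - Δ/3`: the `2(y - D)` neighbourhoods that a domination of `y`
  -- classes affords have less than `Δ/3` to waste.
  tight : ∀ y, 1 ≤ y → y ≤ Fintype.card ι → 6 * Δ * y < 3 * n * y + 6 * Δ * D + Δ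

/-- The union of the classes in `X`. -/
noncomputable def verts (κ : V → ι) (X : Finset ι) : Finset V :=
  Finset.univ.filter fun v => κ v ∈ X

theorem mem_verts {X : Finset ι} {v : V} : v ∈ verts κ X ↔ κ v ∈ X := by simp [verts]

theorem Host.le_card_verts (H : Host G κ n Δ D) (X : Finset ι) : n * X.card ≤ (verts κ X).card := by
  have : (verts κ X).card = ∑ c ∈ X, (Finset.univ.filter fun v => κ v = c).card := by
    rw [Finset.card_eq_sum_card_fiberwise (f := κ) (t := X)
      (fun v hv => Finset.mem_coe.2 (mem_verts.1 hv))]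
    refine Finset.sum_congr rfl fun c hc => ?_
    congr 1
    ext v
    simp only [Finset.mem_filter, mem_verts, Finset.mem_univ, true_and]
    exact ⟨fun h => h.2, fun h => ⟨h ▸ hc, h⟩⟩
  rw [this, mul_comm, ← smul_eq_mul]
  exact Finset.card_nsmul_le_sum _ _ _ fun c _ => H.size c

theorem Host.card_le_of_cover (H : Host G κ n Δ D) {X : Finset V} (W E : Finset V)
    (h : ∀ v ∈ X, v ∈ E ∨ ∃ w ∈ W, G.Adj w v) : X.card ≤ Δ * W.card + E.card := by
  have h1 : X ⊆ (W.biUnion (nb G)) ∪ E := by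
    intro v hv
    rcases h v hv with h | ⟨w, hw, hadj⟩
    · exact Finset.mem_union_right _ h
    · exact Finset.mem_union_left _ (Finset.mem_biUnion.2 ⟨w, hw, mem_nb.2 hadj⟩)
  have h2 := Finset.card_le_card h1
  have h3 := Finset.card_union_le (W.biUnion (nb G)) E
  have h4 : (W.biUnion (nb G)).card ≤ W.card * Δ :=
    Finset.card_biUnion_le_card_mul _ _ _ fun w _ => H.deg w
  rw [mul_comm] at h4
  omega

theorem Host.tight_cover (H : Host G κ n Δ D) {X : Finset ι} (hX : X.Nonempty) (W E : Finset V)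
    (h : ∀ v, κ v ∈ X → v ∈ E ∨ ∃ w ∈ W, G.Adj w v) :
    6 * Δ * X.card < 3 * Δ * W.card + 3 * E.card + 6 * Δ * D + Δ := by
  have h1 := H.card_le_of_cover (X := verts κ X) W E fun v hv => h v (mem_verts.1 hv)
  have h2 := H.le_card_verts X
  have h3 := H.tight X.card (Finset.card_pos.2 hX) (Finset.card_le_univ _)
  nlinarith

/-- Using one vertex fewer loses `Δ` in the count, whereas the slack is only `Δ/3`. -/
theorem Host.two_mul_card_le (H : Host G κ n Δ D) {X : Finset ι} (hX : X.Nonempty) (W : Finset V)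
    (h : ∀ v, κ v ∈ X → ∃ w ∈ W, G.Adj w v) : 2 * X.card ≤ W.card + 2 * D := by
  have h1 := H.tight_cover hX W ∅ fun v hv => Or.inr (h v hv)
  by_contra! hc
  have : 3 * Δ * (W.card + 2 * D + 1) ≤ 3 * Δ * (2 * X.card) := Nat.mul_le_mul_left _ hc
  simp only [Finset.card_empty] at h1
  nlinarith

/-- An independent set in pairwise distinct components, not adjacent to the matching edges with
labels in `A`, extends by one end of each of these edges. -/
theorem Host.explosion (H : Host G κ n Δ D) {z : J → Bool → V} (hz : IsIMC G κ z) (A : Finset J)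
    {T : Finset V} (hT : IsTrans G κ T) (hTz : ∀ t ∈ T, ∀ j ∈ A, ∀ b, ¬ G.Adj (z j b) t)
    (hc : ∀ s ∈ T, ∀ t ∈ T, Conn (fun j b => κ (z j b)) (A : Set J) (κ s) (κ t) → s = t) :
    T.card + A.card + D ≤ Fintype.card ι := by
  obtain ⟨f, hf, hf'⟩ := exists_orientation A (hz.acyc.mono (Set.subset_univ _))
    ((T.image κ : Finset ι) : Set ι) (by
      intro c hc' d hd hcd
      obtain ⟨s, hs, rfl⟩ := Finset.mem_image.1 (Finset.mem_coe.1 hc')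
      obtain ⟨t, ht, rfl⟩ := Finset.mem_image.1 (Finset.mem_coe.1 hd)
      rw [hc s hs t ht hcd])
  have hf2 : ∀ i ∈ A, ∀ t ∈ T, κ (z i (f i)) ≠ κ t := fun i hi t ht h =>
    hf' i hi (Finset.mem_coe.2 (Finset.mem_image.2 ⟨t, ht, h.symm⟩))
  have := H.missing (T ∪ A.image fun i => z i (f i)) {
    indep := by
      intro u hu v hv
      rcases Finset.mem_union.1 hu with hu | hu <;> rcases Finset.mem_union.1 hv with hv | hv
      · exact hT.indep u hu v hv
      · obtain ⟨j, hj, rfl⟩ := Finset.mem_image.1 hv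
        exact fun h => hTz u hu j hj _ h.symm
      · obtain ⟨j, hj, rfl⟩ := Finset.mem_image.1 hu
        exact hTz v hv j hj _
      · obtain ⟨i, hi, rfl⟩ := Finset.mem_image.1 hu
        obtain ⟨j, hj, rfl⟩ := Finset.mem_image.1 hv
        by_cases hij : i = j
        · subst hij; exact G.irrefl
        · exact hz.induced i j hij _ _
    inj := by
      intro u hu v hv huv
      rcases Finset.mem_union.1 hu with hu | hu <;> rcases Finset.mem_union.1 hv with hv | hv
      · exact hT.inj u hu v hv huv
      · obtain ⟨j, hj, rfl⟩ := Finset.mem_image.1 hv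
        exact (hf2 j hj u hu huv.symm).elim
      · obtain ⟨j, hj, rfl⟩ := Finset.mem_image.1 hu
        exact (hf2 j hj v hv huv).elim
      · obtain ⟨i, hi, rfl⟩ := Finset.mem_image.1 hu
        obtain ⟨j, hj, rfl⟩ := Finset.mem_image.1 hv
        rw [hf hi hj huv] }
  rwa [Finset.card_union_of_disjoint, Finset.card_image_of_injOn] at this
  · intro i hi j hj hij
    exact hf hi hj (congrArg κ hij)
  · rw [Finset.disjoint_left]
    intro t ht ht'
    obtain ⟨i, hi, rfl⟩ := Finset.mem_image.1 ht'
    exact hf2 i hi _ ht rfl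

/-- The classes of `G`, after contraction of the edges of the matching `z`. -/
def ccomp (κ : V → ι) (z : J → Bool → V) : ι → Comp (fun j b => κ (z j b)) Set.univ :=
  comp (fun j b => κ (z j b)) Set.univ

/-- The set of vertices not dominated by the matching `z`. -/
def free (G : SimpleGraph V) (z : J → Bool → V) : Set V := {v | ∀ j b, ¬ G.Adj (z j b) v}

/-- Every transversal of `Q` among the contracted classes misses `D` of them. -/
def IsDef (G : SimpleGraph V) (κ : V → ι) (D : ℕ) (z : J → Bool → V)
    (Q : Finset (Comp (fun j b => κ (z j b)) Set.univ)) : Prop :=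
  ∀ T, IsTransIn G (fun v => ccomp κ z (κ v)) (free G z) Q T → T.card + D ≤ Q.card

theorem IsIMC.sum [Finite J₂] {z₁ : J₁ → Bool → V} {z₂ : J₂ → Bool → V} (h₁ : IsIMC G κ z₁)
    (h₂ : IsIMC G (fun v => ccomp κ z₁ (κ v)) z₂) (h : ∀ j b, z₂ j b ∈ free G z₁) :
    IsIMC G κ (Sum.elim z₁ z₂) where
  adj := by
    rintro (j | j) b
    · exact h₁.adj j b
    · exact h₂.adj j b
  induced := by
    rintro (i | i) (j | j) hij b b'
    · exact h₁.induced i j (fun h => hij (congrArg _ h)) b b'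
    · exact h j b' i b
    · exact fun hadj => h i b j b' hadj.symm
    · exact h₂.induced i j (fun h => hij (congrArg _ h)) b b'
  acyc := by
    have := Acyc.sum h₁.acyc h₂.acyc
    convert this using 2 with j
    rcases j with j | j <;> rfl

/-- Since `Q` without `c` is not deficient, there is a maximum transversal of `Q` missing exactly
`D` contracted classes, one of them `c`. Alternation starts from it; a matching found there lives in
`free G z₁` and can be added to `z₁`. -/
theorem exists_extension {z₁ : J₁ → Bool → V} (h₁ : IsIMC G κ z₁)
    {Q : Finset (Comp (fun j b => κ (z₁ j b)) Set.univ)}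
    {c : Comp (fun j b => κ (z₁ j b)) Set.univ} (hc : c ∈ Q) (hQ : IsDef G κ D z₁ Q)
    (hQ' : ¬ IsDef G κ D z₁ (Q.erase c)) :
    ∃ Q' ⊆ Q, c ∈ Q' ∧
      ((∃ W : Finset V, W.card + 2 * D + 1 ≤ 2 * Q'.card ∧
          ∀ v ∈ free G z₁, ccomp κ z₁ (κ v) ∈ Q' → ∃ w ∈ W, G.Adj w v) ∨
        ∃ (J₂ : Type) (_ : Fintype J₂) (z₂ : J₂ → Bool → V), IsIMC G κ (Sum.elim z₁ z₂) ∧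
          (∀ j b, ccomp κ z₁ (κ (z₂ j b)) ∈ Q') ∧ Fintype.card J₂ + D = Q'.card ∧
          ∀ v ∈ free G z₁, ccomp κ z₁ (κ v) ∈ Q' → ∃ j b, G.Adj (z₂ j b) v) := by
  unfold IsDef at hQ'
  push Not at hQ'
  obtain ⟨T, hT, hcard⟩ := hQ'
  have hT' : IsTransIn G (fun v => ccomp κ z₁ (κ v)) (free G z₁) Q T :=
    { hT with mem_S := fun v hv => Finset.mem_of_mem_erase (hT.mem_S v hv) }
  have h2 := hQ T hT'
  rw [Finset.card_erase_of_mem hc] at hcard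
  have hpos := Finset.card_pos.2 ⟨c, hc⟩
  have hTD : T.card + D = Q.card := by omega
  have hM : (Q \ T.image fun v => ccomp κ z₁ (κ v)).card = D := by
    rw [Finset.card_sdiff_of_subset, Finset.card_image_of_injOn]
    · omega
    · exact fun u hu v hv huv => hT.inj u hu v hv huv
    · intro x hx
      obtain ⟨v, hv, rfl⟩ := Finset.mem_image.1 hx
      exact hT'.mem_S v hv
  have hcM : c ∈ Q \ T.image fun v => ccomp κ z₁ (κ v) := by
    refine Finset.mem_sdiff.2 ⟨hc, fun hx => ?_⟩
    obtain ⟨v, hv, hvc⟩ := Finset.mem_image.1 hx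
    exact Finset.ne_of_mem_erase (hT.mem_S v hv) hvc
  obtain ⟨Q', h3, h4, h5⟩ := exists_dominating hT' (fun T'' hT'' => by
    have := hQ T'' hT''
    omega) rfl
  refine ⟨Q', h4, h3 hcM, ?_⟩
  rw [hM] at h5
  rcases h5 with ⟨W, hW, hdom⟩ | ⟨J₂, hJ₂, z₂, hz₂, hmem, hcd, hdom⟩
  · exact Or.inl ⟨W, by omega, hdom⟩
  · exact Or.inr ⟨J₂, hJ₂, z₂, h₁.sum hz₂ fun j b => (hmem j b).1, fun j b => (hmem j b).2,
      by omega, hdom⟩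

variable [Fintype J] [Fintype J₁]

/-- A full pair: a forest-like induced matching on the classes of `S` which dominates all of them
and has the maximum possible number of edges. -/
structure IsFull (G : SimpleGraph V) (κ : V → ι) (D : ℕ) (S : Finset ι) (z : J → Bool → V) : Prop
    extends IsIMC G κ z where
  mem : ∀ j b, κ (z j b) ∈ S
  card_eq : Fintype.card J + D = S.card
  dom : ∀ v, κ v ∈ S → ∃ j b, G.Adj (z j b) v

/-- The vertices of the edges with labels in `A`. -/
noncomputable def ends (z : J → Bool → V) (A : Finset J) : Finset V :=
  (A ×ˢ Finset.univ).image fun s => z s.1 s.2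

theorem mem_ends {z : J → Bool → V} {A : Finset J} {v : V} :
    v ∈ ends z A ↔ ∃ j ∈ A, ∃ b, z j b = v := by
  simp only [ends, Finset.mem_image, Finset.mem_product, Finset.mem_univ, and_true, Prod.exists]
  constructor
  · rintro ⟨j, b, hj, h⟩; exact ⟨j, hj, b, h⟩
  · rintro ⟨j, hj, b, h⟩; exact ⟨j, b, hj, h⟩

theorem card_ends_le (z : J → Bool → V) (A : Finset J) : (ends z A).card ≤ 2 * A.card := by
  refine Finset.card_image_le.trans ?_
  rw [Finset.card_product, Finset.card_univ, Fintype.card_bool, mul_comm]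

theorem card_ccomp {z : J → Bool → V} (hz : IsIMC G κ z) (X : Finset ι)
    (h : ∀ i b, κ (z i b) ∈ X) :
    (X.image (ccomp κ z)).card + Fintype.card J = X.card := by
  rw [← card_image_comp (e := fun j b => κ (z j b)) Finset.univ Finset.coe_univ.symm hz.acyc X
    (fun i _ b => h i b), Finset.card_univ]
  rfl

end Host

/-! ### Rigidity and enlargement of full pairs. -/

section Full

variable {V ι : Type*} {J J₁ : Type} [Fintype V] [Fintype ι] [Fintype J] [Fintype J₁]
  {G : SimpleGraph V} {κ : V → ι} {n Δ D : ℕ} {S : Finset ι} {z : J → Bool → V}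

theorem exists_max_isTransIn {K : Type*} (G : SimpleGraph V) (κ : V → K) (U : Set V)
    (S : Finset K) :
    ∃ T, IsTransIn G κ U S T ∧ ∀ T', IsTransIn G κ U S T' → T'.card ≤ T.card := by
  obtain ⟨T, hT, hmax⟩ := Finset.exists_max_image
    (Finset.univ.filter fun T => IsTransIn G κ U S T) Finset.card
    ⟨∅, by
      rw [Finset.mem_filter]
      exact ⟨Finset.mem_univ _, ⟨by simp, by simp⟩, by simp, by simp⟩⟩
  exact ⟨T, (Finset.mem_filter.1 hT).2, fun T' hT' =>
    hmax T' (Finset.mem_filter.2 ⟨Finset.mem_univ _, hT'⟩)⟩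

theorem IsFull.conn_eq (hF : IsFull G κ D S z) {A : Set J} {c d : ι} (hc : c ∉ S)
    (h : Conn (fun i b => κ (z i b)) A c d) : c = d := by
  have := h.mem_iff (S := {c}) fun i _ =>
    iff_of_false (fun h => hc (h ▸ hF.mem i _)) (fun h => hc (h ▸ hF.mem i _))
  exact (this.1 rfl).symm

theorem IsFull.conn_mem_iff (hF : IsFull G κ D S z) {A : Set J} {c d : ι}
    (h : Conn (fun i b => κ (z i b)) A c d) {Y : Finset ι} (hY : S ⊆ Y) : c ∈ Y ↔ d ∈ Y :=
  h.mem_iff (S := (Y : Set ι)) fun i _ => iff_of_true (hY (hF.mem i _)) (hY (hF.mem i _))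

theorem card_erase_univ (j : J) :
    (Finset.univ.erase j).card + 1 = Fintype.card J := by
  rw [Finset.card_erase_add_one (Finset.mem_univ j), Finset.card_univ]

theorem coe_erase_univ (j : J) : ((Finset.univ.erase j : Finset J) : Set J) = {j}ᶜ := by
  ext; simp

/-- A vertex of `S` dominated at most by the edge `j`, outside the component of an end of that edge
after deletion of the edge, is adjacent to this end. -/
theorem IsFull.light (H : Host G κ n Δ D) (hF : IsFull G κ D S z) {j : J} {w : V}
    (hwS : κ w ∈ S) (hw : ∀ i ≠ j, ∀ b, ¬ G.Adj (z i b) w) {b : Bool}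
    (hnc : ¬ Conn (fun i b => κ (z i b)) {j}ᶜ (κ w) (κ (z j b))) : G.Adj (z j b) w := by
  by_contra hnadj
  set U : Set V := {v | (∀ i ≠ j, ∀ b', ¬ G.Adj (z i b') v) ∧ ¬ G.Adj w v ∧ ¬ G.Adj (z j b) v}
    with hU
  -- Were `w` and `z j b` not adjacent, `T` could be extended by both and by one end of each other
  -- edge. Deficiency then forces `T` to miss a class outside `S`, from which alternation can start.
  obtain ⟨T, hT, hmax⟩ := exists_max_isTransIn G κ U Sᶜ
  have hTS : ∀ t ∈ T, κ t ∉ S := fun t ht => Finset.mem_compl.1 (hT.mem_S t ht)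
  have hxT : ∀ t ∈ T, κ (z j b) ≠ κ t := fun t ht h => hTS t ht (h ▸ hF.mem j b)
  have hwT : ∀ t ∈ T, κ w ≠ κ t := fun t ht h => hTS t ht (h ▸ hwS)
  have hexp := H.explosion hF.toIsIMC (Finset.univ.erase j)
    (T := insert (z j b) (insert w T)) {
    indep := by
      intro u hu v hv
      simp only [Finset.mem_insert] at hu hv
      rcases hu with rfl | rfl | hu
      · rcases hv with rfl | rfl | hv
        · exact G.irrefl
        · exact hnadj
        · exact (hT.mem_U v hv).2.2
      · rcases hv with rfl | rfl | hv
        · exact fun h => hnadj h.symm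
        · exact G.irrefl
        · exact (hT.mem_U v hv).2.1
      · rcases hv with rfl | rfl | hv
        · exact fun h => (hT.mem_U u hu).2.2 h.symm
        · exact fun h => (hT.mem_U u hu).2.1 h.symm
        · exact hT.indep u hu v hv
    inj := by
      intro u hu v hv huv
      simp only [Finset.mem_insert] at hu hv
      rcases hu with rfl | rfl | hu
      · rcases hv with rfl | rfl | hv
        · rfl
        · exact (hnc (Conn.of_eq huv.symm)).elim
        · exact (hxT v hv huv).elim
      · rcases hv with rfl | rfl | hv
        · exact (hnc (Conn.of_eq huv)).elim
        · rfl
        · exact (hwT v hv huv).elim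
      · rcases hv with rfl | rfl | hv
        · exact (hxT u hu huv.symm).elim
        · exact (hwT u hu huv.symm).elim
        · exact hT.inj u hu v hv huv }
    (by
      intro t ht i hi b'
      have hij := Finset.ne_of_mem_erase hi
      simp only [Finset.mem_insert] at ht
      rcases ht with rfl | rfl | ht
      · exact hF.induced i j hij b' b
      · exact hw i hij b'
      · exact (hT.mem_U t ht).1 i hij b')
    (by
      rw [coe_erase_univ]
      intro u hu v hv huv
      simp only [Finset.mem_insert] at hu hv
      rcases hu with rfl | rfl | hu
      · rcases hv with rfl | rfl | hv
        · rfl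
        · exact (hnc huv.symm).elim
        · exact (hxT v hv (hF.conn_eq (hTS v hv) huv.symm).symm).elim
      · rcases hv with rfl | rfl | hv
        · exact (hnc huv).elim
        · rfl
        · exact (hwT v hv (hF.conn_eq (hTS v hv) huv.symm).symm).elim
      · rcases hv with rfl | rfl | hv
        · exact (hxT u hu (hF.conn_eq (hTS u hu) huv).symm).elim
        · exact (hwT u hu (hF.conn_eq (hTS u hu) huv).symm).elim
        · exact hT.inj u hu v hv (hF.conn_eq (hTS u hu) huv))
  have hne : w ∉ T := fun h => hwT w h rfl
  have hne' : z j b ∉ insert w T := by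
    rw [Finset.mem_insert]
    rintro (h | h)
    · exact hnc (Conn.of_eq (by rw [h]))
    · exact hxT _ h rfl
  rw [Finset.card_insert_of_notMem hne', Finset.card_insert_of_notMem hne] at hexp
  have h1 := card_erase_univ j
  have h2 := hF.card_eq
  have h3 := Finset.card_add_card_compl S
  have hM : 1 ≤ (Sᶜ \ T.image κ).card := by
    have := Finset.le_card_sdiff (T.image κ) Sᶜ
    have := Finset.card_image_le (s := T) (f := κ)
    omega
  obtain ⟨Q, -, hQS, hQ⟩ := exists_dominating hT hmax rfl
  obtain ⟨W, hW, hdom⟩ : ∃ W : Finset V, 2 + W.card ≤ 2 * Q.card ∧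
      ∀ v ∈ U, κ v ∈ Q → ∃ w ∈ W, G.Adj w v := by
    rcases hQ with ⟨W, hW, hdom⟩ | ⟨J₂, _, z₂, -, -, hc, hdom⟩
    · exact ⟨W, by omega, hdom⟩
    · refine ⟨ends z₂ Finset.univ, ?_, fun v hv hvQ => ?_⟩
      · have := card_ends_le z₂ Finset.univ
        rw [Finset.card_univ] at this
        omega
      · obtain ⟨i, b', h⟩ := hdom v hv hvQ
        exact ⟨_, mem_ends.2 ⟨i, Finset.mem_univ _, b', rfl⟩, h⟩
  -- `w`, all matching ends and `W` number at most `2(|S ∪ Q| - D) - 1`, too few to dominate `S ∪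
  -- Q`.
  have h4 := H.two_mul_card_le (X := S ∪ Q) ⟨κ w, Finset.mem_union_left _ hwS⟩
    (insert w (ends z Finset.univ ∪ W)) (by
      intro v hv
      have hz : ∀ i b', G.Adj (z i b') v →
          ∃ u ∈ insert w (ends z Finset.univ ∪ W), G.Adj u v := fun i b' h =>
        ⟨_, Finset.mem_insert_of_mem (Finset.mem_union_left _
          (mem_ends.2 ⟨i, Finset.mem_univ _, b', rfl⟩)), h⟩
      rcases Finset.mem_union.1 hv with hv | hv
      · obtain ⟨i, b', h⟩ := hF.dom v hv
        exact hz i b' h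
      · by_cases hvU : v ∈ U
        · obtain ⟨u, hu, h⟩ := hdom v hvU hv
          exact ⟨u, Finset.mem_insert_of_mem (Finset.mem_union_right _ hu), h⟩
        · by_contra! hcon
          refine hvU ⟨fun i _ b' h => ?_, hcon w (Finset.mem_insert_self _ _), fun h => ?_⟩
          · obtain ⟨u, hu, h'⟩ := hz i b' h
            exact hcon u hu h'
          · obtain ⟨u, hu, h'⟩ := hz j b h
            exact hcon u hu h')
  have h5 := Finset.card_insert_le w (ends z Finset.univ ∪ W)
  have h6 := Finset.card_union_le (ends z Finset.univ) W
  have h7 := card_ends_le z Finset.univ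
  rw [Finset.card_univ] at h7
  have h8 : (S ∪ Q).card = S.card + Q.card := Finset.card_union_of_disjoint
    (Finset.disjoint_left.2 fun c hc hc' => Finset.mem_compl.1 (hQS hc') hc)
  omega

/-- The matching without the edge `j`. -/
def dropEdge (z : J → Bool → V) (j : J) : {i // i ≠ j} → Bool → V := fun i b => z i b

theorem image_val_univ (j : J) : (Subtype.val '' (Set.univ : Set {i // i ≠ j})) = {j}ᶜ := by
  ext; simp

theorem IsIMC.dropEdge (hz : IsIMC G κ z) (j : J) : IsIMC G κ (dropEdge z j) where
  adj i b := hz.adj i b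
  induced i i' h b b' := hz.induced i i' (fun h' => h (Subtype.ext h')) b b'
  acyc := Acyc.comp_label (e := fun i b => κ (z i b)) Subtype.val_injective
    (hz.acyc.mono (Set.subset_univ _))

theorem ccomp_dropEdge {j : J} {c d : ι} :
    ccomp κ (dropEdge z j) c = ccomp κ (dropEdge z j) d ↔
      Conn (fun i b => κ (z i b)) {j}ᶜ c d := by
  rw [← image_val_univ, ← conn_comp_iff]
  exact comp_eq_iff

theorem card_ne (j : J) : Fintype.card {i // i ≠ j} + 1 = Fintype.card J := by
  rw [← card_erase_univ j, Fintype.card_subtype]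
  congr 2
  ext; simp

/-- Without `j`, contracting the other edges leaves `S` with `D + 1` classes, and `{x, y}` meets two
of them. So `S` alone is not deficient, and alternation must use classes outside `S` to replace the
edge `j`. -/
theorem IsFull.larger (H : Host G κ n Δ D) (hF : IsFull G κ D S z) {j : J} {x y : V}
    (hx : κ x ∈ S) (hy : κ y ∈ S) (hxU : ∀ i ≠ j, ∀ b, ¬ G.Adj (z i b) x)
    (hyU : ∀ i ≠ j, ∀ b, ¬ G.Adj (z i b) y)
    (hnc : ¬ Conn (fun i b => κ (z i b)) {j}ᶜ (κ x) (κ y)) (hxy : ¬ G.Adj x y) :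
    ∃ (S' : Finset ι) (J' : Type) (_ : Fintype J') (z' : J' → Bool → V),
      IsFull G κ D S' z' ∧ S.card < S'.card ∧ ∀ i ≠ j, ∃ i', z' i' = z i := by
  set z₁ := IndepTransversal.dropEdge z j with hz₁
  have h₁ : IsIMC G κ z₁ := hF.toIsIMC.dropEdge j
  set mk := ccomp κ z₁ with hmk
  have mk_eq : ∀ {c d}, mk c = mk d ↔ Conn (fun i b => κ (z i b)) {j}ᶜ c d := ccomp_dropEdge
  have hcJ := card_ne j
  have hcS := hF.card_eq
  have hsingle : ∀ {c d}, c ∉ S → mk c = mk d → c = d := fun hc h =>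
    hF.conn_eq hc (mk_eq.1 h)
  have hcard : ∀ X, S ⊆ X → (X.image mk).card + Fintype.card {i // i ≠ j} = X.card := fun X hX =>
    card_ccomp h₁ X fun i b => hX (hF.mem _ _)
  obtain ⟨R, hR, hRmin⟩ := Finset.exists_min_image
    (Sᶜ.powerset.filter fun R => IsDef G κ D z₁ ((S ∪ R).image mk)) Finset.card ⟨Sᶜ, by
      rw [Finset.mem_filter, Finset.union_compl]
      refine ⟨Finset.mem_powerset_self _, fun T hT => ?_⟩
      have h2 := H.explosion hF.toIsIMC (Finset.univ.erase j) (T := T)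
        ⟨hT.indep, fun u hu v hv huv => hT.inj u hu v hv (by rw [huv])⟩
        (fun t ht i hi b => hT.mem_U t ht ⟨i, Finset.ne_of_mem_erase hi⟩ b)
        (by
          rw [coe_erase_univ]
          exact fun s hs t ht h => hT.inj s hs t ht (mk_eq.2 h))
      have h3 := card_erase_univ j
      have h4 := hcard Finset.univ (Finset.subset_univ _)
      rw [Finset.card_univ] at h4
      omega⟩
  rw [Finset.mem_filter, Finset.mem_powerset] at hR
  obtain ⟨hRS, hRdef⟩ := hR
  have hRne : R.Nonempty := by
    rw [Finset.nonempty_iff_ne_empty]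
    rintro rfl
    have hxy' : x ≠ y := fun h => hnc (Conn.of_eq (by rw [h]))
    have := hRdef {x, y} {
      indep := by
        intro u hu v hv
        simp only [Finset.mem_insert, Finset.mem_singleton] at hu hv
        rcases hu with rfl | rfl <;> rcases hv with rfl | rfl
        · exact G.irrefl
        · exact hxy
        · exact fun h => hxy h.symm
        · exact G.irrefl
      inj := by
        intro u hu v hv huv
        simp only [Finset.mem_insert, Finset.mem_singleton] at hu hv
        rcases hu with rfl | rfl <;> rcases hv with rfl | rfl
        · rfl
        · exact (hnc (mk_eq.1 huv)).elim
        · exact (hnc (mk_eq.1 huv.symm)).elim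
        · rfl
      mem_U := by
        intro u hu
        simp only [Finset.mem_insert, Finset.mem_singleton] at hu
        rcases hu with rfl | rfl
        · exact fun i b => hxU i i.2 b
        · exact fun i b => hyU i i.2 b
      mem_S := by
        intro u hu
        simp only [Finset.mem_insert, Finset.mem_singleton] at hu
        rw [Finset.union_empty]
        rcases hu with rfl | rfl
        · exact Finset.mem_image_of_mem _ hx
        · exact Finset.mem_image_of_mem _ hy }
    rw [Finset.card_pair hxy'] at this
    have h5 := hcard (S ∪ ∅) Finset.subset_union_left
    rw [Finset.union_empty] at h5 this
    omega
  obtain ⟨c, hcR⟩ := hRne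
  have hcS' : c ∉ S := Finset.mem_compl.1 (hRS hcR)
  have herase : (S ∪ R.erase c).image mk = ((S ∪ R).image mk).erase (mk c) := by
    ext q
    simp only [Finset.mem_image, Finset.mem_union, Finset.mem_erase]
    constructor
    · rintro ⟨d, hd, rfl⟩
      refine ⟨fun h => ?_, d, hd.imp id fun h => h.2, rfl⟩
      have hcd := hsingle hcS' h.symm
      subst hcd
      rcases hd with hd | hd
      · exact hcS' hd
      · exact hd.1 rfl
    · rintro ⟨hne, d, hd, rfl⟩
      exact ⟨d, hd.imp id fun h => ⟨fun hdc => hne (by rw [hdc]), h⟩, rfl⟩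
  have hcrit : ¬ IsDef G κ D z₁ (((S ∪ R).image mk).erase (mk c)) := by
    rw [← herase]
    intro hdef
    have := hRmin (R.erase c) (Finset.mem_filter.2 ⟨Finset.mem_powerset.2
      ((Finset.erase_subset _ _).trans hRS), hdef⟩)
    rw [Finset.card_erase_of_mem hcR] at this
    have := Finset.card_pos.2 ⟨c, hcR⟩
    omega
  obtain ⟨Q', hQ'sub, hcQ', hQ'⟩ := exists_extension h₁
    (Finset.mem_image_of_mem mk (Finset.mem_union_right _ hcR)) hRdef hcrit
  set Y : Finset ι := S ∪ (S ∪ R).filter fun d => mk d ∈ Q' with hY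
  have hSY : S ⊆ Y := Finset.subset_union_left
  have hQ'Y : Q' ⊆ Y.image mk := by
    intro q hq
    obtain ⟨d, hd, rfl⟩ := Finset.mem_image.1 (hQ'sub hq)
    exact Finset.mem_image_of_mem _ (Finset.mem_union_right _ (Finset.mem_filter.2 ⟨hd, hq⟩))
  have hYcard := hcard Y hSY
  have hcY : c ∈ Y := Finset.mem_union_right _
    (Finset.mem_filter.2 ⟨Finset.mem_union_right _ hcR, hcQ'⟩)
  -- Contracted classes of `Y` outside `Q'` come from `S`. By `IsFull.light`, the free vertices of
  -- such a class are all dominated by an end of `j` lying in another component, so each of these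
  -- classes costs one vertex rather than two.
  have hbad : ∀ q : Comp (fun j b => κ (z₁ j b)) Set.univ, ∃ b, mk (κ (z j b)) ≠ q := by
    intro q
    by_contra! hcon
    have := (hcon false).trans (hcon true).symm
    rw [mk_eq] at this
    refine hF.acyc j (Set.mem_univ j) (this.mono ?_)
    intro i hi
    exact ⟨Set.mem_univ _, hi⟩
  choose β hβ using hbad
  set WE : Finset V := (Y.image mk \ Q').image fun q => z j (β q) with hWE
  have hWEcard : WE.card + Q'.card ≤ (Y.image mk).card := by
    have h1 : WE.card ≤ (Y.image mk \ Q').card := Finset.card_image_le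
    rw [Finset.card_sdiff_of_subset hQ'Y] at h1
    have := Finset.card_le_card hQ'Y
    omega
  have hcover : ∀ W : Finset V,
      (∀ v ∈ free G z₁, mk (κ v) ∈ Q' → ∃ w ∈ W, G.Adj w v) →
      2 * Y.card ≤ (ends z₁ Finset.univ ∪ (WE ∪ W)).card + 2 * D := by
    intro W hW
    refine H.two_mul_card_le ⟨c, hcY⟩ _ fun v hv => ?_
    by_cases hvU : v ∈ free G z₁
    · by_cases hvQ : mk (κ v) ∈ Q'
      · obtain ⟨w, hw, h⟩ := hW v hvU hvQ
        exact ⟨w, Finset.mem_union_right _ (Finset.mem_union_right _ hw), h⟩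
      · have hvS : κ v ∈ S := by
          rcases Finset.mem_union.1 hv with h | h
          · exact h
          · exact (hvQ (Finset.mem_filter.1 h).2).elim
        refine ⟨z j (β (mk (κ v))), Finset.mem_union_right _ (Finset.mem_union_left _
          (Finset.mem_image.2 ⟨mk (κ v), Finset.mem_sdiff.2
            ⟨Finset.mem_image_of_mem _ hv, hvQ⟩, rfl⟩)), ?_⟩
        refine hF.light H hvS (fun i hi b => hvU ⟨i, hi⟩ b) fun h => ?_
        exact hβ (mk (κ v)) (mk_eq.2 h.symm)
    · unfold free at hvU
      simp only [Set.mem_ofPred_eq, not_forall, not_not] at hvU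
      obtain ⟨i, b, h⟩ := hvU
      exact ⟨_, Finset.mem_union_left _ (mem_ends.2 ⟨i, Finset.mem_univ _, b, rfl⟩), h⟩
  have hunion : ∀ W : Finset V, (ends z₁ Finset.univ ∪ (WE ∪ W)).card ≤
      2 * Fintype.card {i // i ≠ j} + (WE.card + W.card) := by
    intro W
    have h1 := Finset.card_union_le (ends z₁ Finset.univ) (WE ∪ W)
    have h2 := Finset.card_union_le WE W
    have h3 := card_ends_le z₁ Finset.univ
    rw [Finset.card_univ] at h3
    omega
  -- The count rules out the first outcome, and in the second it forces `Q'` to be all of `Y.image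
  -- mk`.
  rcases hQ' with ⟨W, hW, hdom⟩ | ⟨J₂, hJ₂, z₂, hz₂, hmem, hcd, hdom⟩
  · exfalso
    have h1 := hcover W hdom
    have h2 := hunion W
    omega
  · have h1 := hcover (ends z₂ Finset.univ) fun v hv hvQ => by
      obtain ⟨i, b, h⟩ := hdom v hv hvQ
      exact ⟨_, mem_ends.2 ⟨i, Finset.mem_univ _, b, rfl⟩, h⟩
    have h2 := hunion (ends z₂ Finset.univ)
    have h3 := card_ends_le z₂ Finset.univ
    rw [Finset.card_univ] at h3
    have hQeq : Q' = Y.image mk := Finset.eq_of_subset_of_card_le hQ'Y (by omega)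
    refine ⟨Y, {i // i ≠ j} ⊕ J₂, inferInstance, Sum.elim z₁ z₂,
      { hz₂ with mem := ?_, card_eq := ?_, dom := ?_ }, ?_, ?_⟩
    · rintro (i | i) b
      · exact hSY (hF.mem _ _)
      · have := hmem i b
        rw [hQeq] at this
        obtain ⟨d, hd, hdi⟩ := Finset.mem_image.1 this
        exact (hF.conn_mem_iff (mk_eq.1 hdi) hSY).1 hd
    · rw [Fintype.card_sum]
      rw [hQeq] at hcd
      omega
    · intro v hv
      by_cases hvU : v ∈ free G z₁
      · obtain ⟨i, b, h⟩ := hdom v hvU (hQeq ▸ Finset.mem_image_of_mem _ hv)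
        exact ⟨Sum.inr i, b, h⟩
      · unfold free at hvU
        simp only [Set.mem_ofPred_eq, not_forall, not_not] at hvU
        obtain ⟨i, b, h⟩ := hvU
        exact ⟨Sum.inl i, b, h⟩
    · exact Finset.card_lt_card ⟨hSY, fun h => hcS' (h hcY)⟩
    · exact fun i hi => ⟨Sum.inl ⟨i, hi⟩, rfl⟩

end Full

/-! ### Existence of full pairs, also through a critical edge. -/

section Sys

variable {V ι : Type*} {J J₁ : Type} [Fintype V] [Fintype ι] [Fintype J] [Fintype J₁]
  {G : SimpleGraph V} {κ : V → ι} {n Δ D : ℕ} {S : Finset ι} {z : J → Bool → V}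

/-- Undoing the contraction adds equally many classes and edges, so the difference `D` persists. The
outcome with few dominators would contradict `Host.two_mul_card_le`; as all edges of `z₁` lie in
`c`, they belong to the resulting pair. -/
theorem exists_full_of_isDef (H : Host G κ n Δ D) {z₁ : J₁ → Bool → V} (h₁ : IsIMC G κ z₁)
    {Q : Finset (Comp (fun j b => κ (z₁ j b)) Set.univ)}
    {c : Comp (fun j b => κ (z₁ j b)) Set.univ} (hc : c ∈ Q) (hQ : IsDef G κ D z₁ Q)
    (hQ' : ¬ IsDef G κ D z₁ (Q.erase c)) (hz₁ : ∀ j b, ccomp κ z₁ (κ (z₁ j b)) = c) :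
    ∃ (S : Finset ι) (J : Type) (_ : Fintype J) (z : J → Bool → V), IsFull G κ D S z ∧
      ∀ i, ∃ i', z i' = z₁ i := by
  obtain ⟨Q', -, hcQ', hQ'⟩ := exists_extension h₁ hc hQ hQ'
  set X : Finset ι := Finset.univ.filter fun d => ccomp κ z₁ d ∈ Q' with hX
  have hXmem : ∀ d, d ∈ X ↔ ccomp κ z₁ d ∈ Q' := by simp [hX]
  have hends : ∀ j b, κ (z₁ j b) ∈ X := fun j b => by rw [hXmem, hz₁]; exact hcQ'
  have himg : X.image (ccomp κ z₁) = Q' := by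
    ext q
    obtain ⟨d, rfl⟩ := comp_surjective q
    rw [Finset.mem_image]
    constructor
    · rintro ⟨d', hd', h⟩
      rw [← h]
      exact (hXmem d').1 hd'
    · exact fun h => ⟨d, (hXmem d).2 h, rfl⟩
  have hcard := card_ccomp h₁ X hends
  rw [himg] at hcard
  have hXne : X.Nonempty := by
    rw [← Finset.image_nonempty (f := ccomp κ z₁), himg]
    exact ⟨c, hcQ'⟩
  have hfree : ∀ v, v ∉ free G z₁ → ∃ i b, G.Adj (z₁ i b) v := by
    intro v hv
    unfold free at hv
    simpa only [Set.mem_ofPred_eq, not_forall, not_not] using hv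
  rcases hQ' with ⟨W, hW, hdom⟩ | ⟨J₂, hJ₂, z₂, hz₂, hmem, hcd, hdom⟩
  · exfalso
    have h2 := H.two_mul_card_le hXne (ends z₁ Finset.univ ∪ W) fun v hv => by
      by_cases hvU : v ∈ free G z₁
      · obtain ⟨w, hw, h⟩ := hdom v hvU ((hXmem _).1 hv)
        exact ⟨w, Finset.mem_union_right _ hw, h⟩
      · obtain ⟨i, b, h⟩ := hfree v hvU
        exact ⟨_, Finset.mem_union_left _ (mem_ends.2 ⟨i, Finset.mem_univ _, b, rfl⟩), h⟩
    have h3 := Finset.card_union_le (ends z₁ Finset.univ) W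
    have h4 := card_ends_le z₁ Finset.univ
    rw [Finset.card_univ] at h4
    omega
  · refine ⟨X, J₁ ⊕ J₂, inferInstance, Sum.elim z₁ z₂,
      { hz₂ with mem := ?_, card_eq := ?_, dom := ?_ }, fun i => ⟨Sum.inl i, rfl⟩⟩
    · rintro (i | i) b
      · exact hends i b
      · exact (hXmem _).2 (hmem i b)
    · rw [Fintype.card_sum]
      omega
    · intro v hv
      by_cases hvU : v ∈ free G z₁
      · obtain ⟨i, b, h⟩ := hdom v hvU ((hXmem _).1 hv)
        exact ⟨Sum.inr i, b, h⟩
      · obtain ⟨i, b, h⟩ := hfree v hvU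
        exact ⟨Sum.inl i, b, h⟩

theorem Host.isDef_univ (H : Host G κ n Δ D) {z₁ : J₁ → Bool → V} (h₁ : IsIMC G κ z₁) :
    IsDef G κ D z₁ (Finset.univ.image (ccomp κ z₁)) := by
  intro T hT
  have h2 := H.explosion h₁ Finset.univ (T := T)
    ⟨hT.indep, fun u hu v hv huv => hT.inj u hu v hv (by rw [huv])⟩
    (fun t ht i _ b => hT.mem_U t ht i b)
    (by
      rw [Finset.coe_univ]
      exact fun s hs t ht h => hT.inj s hs t ht (comp_eq_iff.2 h))
  have h4 := card_ccomp h₁ Finset.univ fun _ _ => Finset.mem_univ _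
  rw [Finset.card_univ] at h4 h2
  omega

theorem IsDef.exists_minimal {z₁ : J₁ → Bool → V}
    {Q : Finset (Comp (fun j b => κ (z₁ j b)) Set.univ)} (hQ : IsDef G κ D z₁ Q) :
    ∃ Q' ⊆ Q, IsDef G κ D z₁ Q' ∧ ∀ c ∈ Q', ¬ IsDef G κ D z₁ (Q'.erase c) := by
  obtain ⟨Q', hQ', hmin⟩ := Finset.exists_min_image
    (Q.powerset.filter fun Q' => IsDef G κ D z₁ Q') Finset.card
    ⟨Q, Finset.mem_filter.2 ⟨Finset.mem_powerset_self _, hQ⟩⟩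
  rw [Finset.mem_filter, Finset.mem_powerset] at hQ'
  refine ⟨Q', hQ'.1, hQ'.2, fun c hc hdef => ?_⟩
  have := hmin (Q'.erase c) (Finset.mem_filter.2 ⟨Finset.mem_powerset.2
    ((Finset.erase_subset _ _).trans hQ'.1), hdef⟩)
  rw [Finset.card_erase_of_mem hc] at this
  have := Finset.card_pos.2 ⟨c, hc⟩
  omega

theorem Host.exists_full (H : Host G κ n Δ D) :
    ∃ (S : Finset ι) (J : Type) (_ : Fintype J) (z : J → Bool → V), IsFull G κ D S z := by
  let z₁ : Empty → Bool → V := fun i => i.elim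
  have h₁ : IsIMC G κ z₁ := ⟨fun i => i.elim, fun i => i.elim, fun i => i.elim⟩
  obtain ⟨Q, -, hQ, hmin⟩ := (H.isDef_univ h₁).exists_minimal
  have hne : Q.Nonempty := by
    rw [Finset.nonempty_iff_ne_empty]
    rintro rfl
    have := hQ ∅ ⟨⟨by simp, by simp⟩, by simp, by simp⟩
    have := H.one_le
    simp at *
    omega
  obtain ⟨c, hc⟩ := hne
  obtain ⟨S, J, hJ, z, hF, -⟩ := exists_full_of_isDef H h₁ hc hQ (hmin c hc) fun i => i.elim
  exact ⟨S, J, hJ, z, hF⟩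

/-- An edge whose deletion creates a large partial transversal lies in a full pair. -/
theorem Host.exists_full_edge (H : Host G κ n Δ D) {f : Bool → V} (hf : G.Adj (f false) (f true))
    {T : Finset V} (hTadj : ∀ u ∈ T, ∀ v ∈ T, G.Adj u v →
      (u = f false ∧ v = f true) ∨ (u = f true ∧ v = f false))
    (hTinj : ∀ u ∈ T, ∀ v ∈ T, κ u = κ v → u = v) (hT : Fintype.card ι < T.card + D) :
    ∃ (S : Finset ι) (J : Type) (_ : Fintype J) (z : J → Bool → V), IsFull G κ D S z ∧
      ∃ i, z i = f := by
  have hfT : ∀ b, f b ∈ T := by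
    have : f false ∈ T ∧ f true ∈ T := by
      by_contra hcon
      have := H.missing T ⟨fun u hu v hv h => by
        rcases hTadj u hu v hv h with ⟨rfl, rfl⟩ | ⟨rfl, rfl⟩
        · exact hcon ⟨hu, hv⟩
        · exact hcon ⟨hv, hu⟩, hTinj⟩
      omega
    intro b
    cases b
    exacts [this.1, this.2]
  have hκ : κ (f false) ≠ κ (f true) := fun h =>
    hf.ne (hTinj _ (hfT _) _ (hfT _) h)
  let z₁ : Unit → Bool → V := fun _ => f
  have h₁ : IsIMC G κ z₁ := by
    refine ⟨fun _ b => ?_, fun i j hij => (hij rfl).elim, fun i _ h => hκ ?_⟩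
    · cases b
      exacts [hf, hf.symm]
    · have := h.mem_iff (S := {κ (f false)}) fun i hi => (hi.2 rfl).elim
      exact (this.1 rfl).symm
  have hsingle : ∀ {c d}, c ≠ κ (f false) → c ≠ κ (f true) →
      ccomp κ z₁ c = ccomp κ z₁ d → c = d := by
    intro c d h2 h3 h
    have := (comp_eq_iff.1 h).mem_iff (S := {c}) fun i _ =>
      iff_of_false (fun h => h2 h.symm) (fun h => h3 h.symm)
    exact (this.1 rfl).symm
  obtain ⟨Q, hQsub, hQ, hmin⟩ := (H.isDef_univ h₁).exists_minimal
  set a := ccomp κ z₁ (κ (f false)) with ha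
  have hends : ∀ j b, ccomp κ z₁ (κ (z₁ j b)) = a := fun j b =>
    comp_eq_iff.2 (Conn.edge (e := fun j b => κ (z₁ j b)) (Set.mem_univ j) b false)
  -- If `Q` avoided the contracted edge, `T` without the two ends of `f` would miss at most `D`
  -- contracted classes, one of them `a`, hence fewer than `D` classes of `Q`.
  by_cases haQ : a ∈ Q
  · obtain ⟨S, J, hJ, z, hF, hz⟩ := exists_full_of_isDef H h₁ haQ hQ (hmin a haQ) hends
    exact ⟨S, J, hJ, z, hF, hz ()⟩
  · exfalso
    set T' := (T.erase (f false)).erase (f true) with hT'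
    have hT'mem : ∀ t ∈ T', t ∈ T ∧ t ≠ f false ∧ t ≠ f true := by
      intro t ht
      rw [hT', Finset.mem_erase, Finset.mem_erase] at ht
      exact ⟨ht.2.2, ht.2.1, ht.1⟩
    have hT'κ : ∀ t ∈ T', κ t ≠ κ (f false) ∧ κ t ≠ κ (f true) := fun t ht =>
      ⟨fun h => (hT'mem t ht).2.1 (hTinj _ (hT'mem t ht).1 _ (hfT _) h),
        fun h => (hT'mem t ht).2.2 (hTinj _ (hT'mem t ht).1 _ (hfT _) h)⟩
    have hT'card : T'.card + 2 = T.card := by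
      have h2 := Finset.card_erase_add_one (hfT false)
      have h3 := Finset.card_erase_add_one (s := T.erase (f false)) (a := f true)
        (Finset.mem_erase.2 ⟨hf.ne', hfT true⟩)
      rw [← hT'] at h3
      omega
    have hinj : ∀ u ∈ T', ∀ v ∈ T', ccomp κ z₁ (κ u) = ccomp κ z₁ (κ v) → u = v :=
      fun u hu v hv h => hTinj u (hT'mem u hu).1 v (hT'mem v hv).1
        (hsingle (hT'κ u hu).1 (hT'κ u hu).2 h)
    have h2 := hQ (T'.filter fun v => ccomp κ z₁ (κ v) ∈ Q) {
      indep := by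
        intro u hu v hv h
        have hu := hT'mem u (Finset.mem_filter.1 hu).1
        have hv := hT'mem v (Finset.mem_filter.1 hv).1
        rcases hTadj u hu.1 v hv.1 h with h | h
        · exact hu.2.1 h.1
        · exact hu.2.2 h.1
      inj := fun u hu v hv h =>
        hinj u (Finset.mem_filter.1 hu).1 v (Finset.mem_filter.1 hv).1 h
      mem_U := by
        intro v hv _ b h
        have hv := hT'mem v (Finset.mem_filter.1 hv).1
        rcases hTadj _ (hfT b) v hv.1 h with h | h
        · exact hv.2.2 h.2
        · exact hv.2.1 h.2
      mem_S := fun v hv => (Finset.mem_filter.1 hv).2 }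
    have h3 : (T'.filter fun v => ¬ ccomp κ z₁ (κ v) ∈ Q).card ≤
        ((Finset.univ.image (ccomp κ z₁)).erase a \ Q).card := by
      refine Finset.card_le_card_of_injOn (fun v => ccomp κ z₁ (κ v)) ?_ ?_
      · intro v hv
        have hv := Finset.mem_filter.1 (Finset.mem_coe.1 hv)
        refine Finset.mem_coe.2 (Finset.mem_sdiff.2 ⟨Finset.mem_erase.2 ⟨fun h => ?_,
          Finset.mem_image_of_mem _ (Finset.mem_univ _)⟩, hv.2⟩)
        exact (hT'κ v hv.1).1 (hsingle (hT'κ v hv.1).1 (hT'κ v hv.1).2 h)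
      · exact fun u hu v hv h => hinj u (Finset.mem_filter.1 hu).1 v (Finset.mem_filter.1 hv).1 h
    have hQsub' : Q ⊆ (Finset.univ.image (ccomp κ z₁)).erase a := fun q hq =>
      Finset.mem_erase.2 ⟨fun h => haQ (h ▸ hq), hQsub hq⟩
    rw [Finset.card_sdiff_of_subset hQsub'] at h3
    have h4 := Finset.card_le_card hQsub'
    have h5 := Finset.card_erase_add_one (s := Finset.univ.image (ccomp κ z₁)) (a := a)
      (Finset.mem_image_of_mem _ (Finset.mem_univ _))
    have h6 := card_ccomp h₁ Finset.univ fun _ _ => Finset.mem_univ _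
    rw [Finset.card_univ, Fintype.card_unit] at h6
    have h7 := Finset.card_filter_add_card_filter_not (s := T')
      (p := fun v => ccomp κ z₁ (κ v) ∈ Q)
    omega

/-- A full pair of maximum size among those containing the edges in `F`; the edges with labels in
`A` are free to be changed. -/
structure IsSys (G : SimpleGraph V) (κ : V → ι) (D : ℕ) (F : Set (Bool → V)) (A : Set J)
    (S : Finset ι) (z : J → Bool → V) : Prop where
  full : IsFull G κ D S z
  fix : ∀ f ∈ F, ∃ i, i ∉ A ∧ z i = f
  max : ∀ (S' : Finset ι) (J' : Type) (_ : Fintype J') (z' : J' → Bool → V),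
    IsFull G κ D S' z' → (∀ f ∈ F, ∃ i, z' i = f) → S'.card ≤ S.card

theorem exists_max_full (F : Set (Bool → V)) (hF : IsFull G κ D S z)
    (hz : ∀ f ∈ F, ∃ i, z i = f) :
    ∃ (S : Finset ι) (J : Type) (_ : Fintype J) (z : J → Bool → V), IsFull G κ D S z ∧
      (∀ f ∈ F, ∃ i, z i = f) ∧ ∀ (S' : Finset ι) (J' : Type) (_ : Fintype J')
        (z' : J' → Bool → V), IsFull G κ D S' z' → (∀ f ∈ F, ∃ i, z' i = f) →
          S'.card ≤ S.card := by
  by_contra! hcon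
  have key : ∀ m : ℕ, ∃ (S : Finset ι) (J : Type) (_ : Fintype J) (z : J → Bool → V),
      IsFull G κ D S z ∧ (∀ f ∈ F, ∃ i, z i = f) ∧ m ≤ S.card := by
    intro m
    induction m with
    | zero => exact ⟨S, J, inferInstance, z, hF, hz, Nat.zero_le _⟩
    | succ m ih =>
      obtain ⟨S, J, hJ, z, hF, hz, hm⟩ := ih
      obtain ⟨S', J', hJ', z', hF', hz', hlt⟩ := hcon S J hJ z hF hz
      exact ⟨S', J', hJ', z', hF', hz', by omega⟩
  obtain ⟨S, J, _, z, _, _, h⟩ := key (Fintype.card ι + 1)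
  have := Finset.card_le_univ S
  omega

theorem Host.exists_isSys (H : Host G κ n Δ D) :
    ∃ (S : Finset ι) (J : Type) (_ : Fintype J) (z : J → Bool → V),
      IsSys G κ D ∅ Set.univ S z := by
  obtain ⟨S, J, hJ, z, hF⟩ := H.exists_full
  obtain ⟨S, J, hJ, z, hF, -, hmax⟩ := exists_max_full ∅ hF (by simp)
  exact ⟨S, J, hJ, z, hF, by simp, hmax⟩

theorem Host.exists_isSys_edge (H : Host G κ n Δ D) {f : Bool → V}
    (hf : G.Adj (f false) (f true))
    {T : Finset V} (hTadj : ∀ u ∈ T, ∀ v ∈ T, G.Adj u v →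
      (u = f false ∧ v = f true) ∨ (u = f true ∧ v = f false))
    (hTinj : ∀ u ∈ T, ∀ v ∈ T, κ u = κ v → u = v) (hT : Fintype.card ι < T.card + D) :
    ∃ (S : Finset ι) (J : Type) (_ : Fintype J) (z : J → Bool → V) (j : J), z j = f ∧
      IsSys G κ D {f} {j}ᶜ S z := by
  obtain ⟨S, J, hJ, z, hF, hz⟩ := H.exists_full_edge hf hTadj hTinj hT
  obtain ⟨S, J, hJ, z, hF, hz, hmax⟩ := exists_max_full {f} hF (by simpa using hz)
  obtain ⟨j, hj⟩ := hz f rfl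
  exact ⟨S, J, hJ, z, j, hj, hF, by
    rintro _ rfl
    exact ⟨j, by simp, hj⟩, hmax⟩

end Sys

/-! ### Replacing one end of a matching edge. -/

section Swap

variable {V ι : Type*} {J : Type} [Fintype V] [Fintype ι] [Fintype J]
  {G : SimpleGraph V} {κ : V → ι} {n Δ D : ℕ} {S : Finset ι} {z : J → Bool → V}
  {F : Set (Bool → V)} {A : Set J}

/-- The vertices by which the end `z j b` may be replaced. -/
noncomputable def swap (G : SimpleGraph V) (κ : V → ι) (S : Finset ι) (z : J → Bool → V) (j : J)
    (b : Bool) : Finset V :=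
  Finset.univ.filter fun w => κ w ∈ S ∧ (∀ i ≠ j, ∀ b', ¬ G.Adj (z i b') w) ∧
    Conn (fun i b => κ (z i b)) {j}ᶜ (κ w) (κ (z j b))

theorem mem_swap {j : J} {b : Bool} {w : V} :
    w ∈ swap G κ S z j b ↔ κ w ∈ S ∧ (∀ i ≠ j, ∀ b', ¬ G.Adj (z i b') w) ∧
      Conn (fun i b => κ (z i b)) {j}ᶜ (κ w) (κ (z j b)) := by simp [swap]

/-- The matching with the end `z j b` replaced by `w`. -/
noncomputable def setEnd (z : J → Bool → V) (j : J) (b : Bool) (w : V) : J → Bool → V :=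
  fun i b' => if i = j ∧ b' = b then w else z i b'

theorem setEnd_self (j : J) (b : Bool) (w : V) : setEnd z j b w j b = w := by simp [setEnd]

theorem setEnd_not (j : J) (b : Bool) (w : V) : setEnd z j b w j (!b) = z j !b := by
  simp [setEnd]

theorem setEnd_of_ne {i j : J} (h : i ≠ j) (b : Bool) (w : V) : setEnd z j b w i = z i := by
  funext b'; simp [setEnd, h]

theorem setEnd_setEnd (j : J) (b : Bool) (w w' : V) :
    setEnd (setEnd z j b w) j b w' = setEnd z j b w' := by
  funext i b'
  simp only [setEnd]
  split_ifs <;> rfl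

theorem setEnd_eq (j : J) (b : Bool) : setEnd z j b (z j b) = z := by
  funext i b'
  simp only [setEnd]
  split_ifs with h
  · rw [h.1, h.2]
  · rfl

theorem conn_setEnd {j : J} {b : Bool} {w : V} {c d : ι} :
    Conn (fun i b' => κ (setEnd z j b w i b')) {j}ᶜ c d ↔
      Conn (fun i b' => κ (z i b')) {j}ᶜ c d := by
  constructor
  · exact fun h => h.congr fun i hi b' => by rw [setEnd_of_ne hi]
  · exact fun h => h.congr fun i hi b' => by rw [setEnd_of_ne hi]

theorem swap_setEnd {j : J} {b b' : Bool} {w : V} (hw : w ∈ swap G κ S z j b) :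
    swap G κ S (setEnd z j b w) j b' = swap G κ S z j b' := by
  have hc := (mem_swap.1 hw).2.2
  ext u
  rw [mem_swap, mem_swap, conn_setEnd]
  refine and_congr_right fun _ => and_congr ?_ ?_
  · exact forall₂_congr fun i hi => by rw [setEnd_of_ne hi]
  · by_cases hb : b' = b
    · subst hb
      rw [setEnd_self]
      exact ⟨fun h => h.trans hc, fun h => h.trans hc.symm⟩
    · obtain rfl : b' = !b := by cases b <;> cases b' <;> simp_all
      rw [setEnd_not]

theorem IsFull.self_mem_swap (hF : IsFull G κ D S z) (j : J) (b : Bool) :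
    z j b ∈ swap G κ S z j b :=
  mem_swap.2 ⟨hF.mem j b, fun i hi b' => hF.induced i j hi b' b, Conn.refl _⟩

theorem IsFull.swap_disjoint (hF : IsFull G κ D S z) {j j' : J} {b b' : Bool} {w : V}
    (h : w ∈ swap G κ S z j b) (h' : w ∈ swap G κ S z j' b') : j = j' ∧ b = b' := by
  rw [mem_swap] at h h'
  have hj : j = j' := by
    by_contra hne
    obtain ⟨i, b'', hi⟩ := hF.dom w h.1
    by_cases hij : i = j
    · subst hij
      exact h'.2.1 i hne b'' hi
    · exact h.2.1 i hij b'' hi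
  subst hj
  refine ⟨rfl, ?_⟩
  by_contra hne
  obtain rfl : b' = !b := by cases b <;> cases b' <;> simp_all
  have h3 := h.2.2.symm.trans h'.2.2
  refine hF.acyc.not_conn' (Set.mem_univ j) b (h3.mono ?_)
  intro i hi
  exact ⟨Set.mem_univ _, hi⟩

/-- Drop one of the two ends as a dominator: only its private neighbourhood becomes uncovered, and
the count forces that part above `2Δ/3`. -/
theorem IsFull.overlap (H : Host G κ n Δ D) (hF : IsFull G κ D S z) {j j' : J} {b b' : Bool}
    (hne : ¬ (j = j' ∧ b = b')) : 3 * (nb G (z j b) ∩ nb G (z j' b')).card < Δ := by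
  have hS : S.Nonempty := ⟨_, hF.mem j b⟩
  set W : Finset V := ((Finset.univ : Finset (J × Bool)).erase (j', b')).image fun s => z s.1 s.2
    with hW
  have hWcard : W.card + 1 ≤ 2 * Fintype.card J := by
    have h1 : W.card ≤ _ := Finset.card_image_le
    have h2 := Finset.card_erase_add_one (Finset.mem_univ (j', b'))
    rw [Finset.card_univ, Fintype.card_prod, Fintype.card_bool] at h2
    omega
  have hmemW : ∀ i b'', ¬ (i = j' ∧ b'' = b') → z i b'' ∈ W := fun i b'' h =>
    Finset.mem_image.2 ⟨(i, b''), Finset.mem_erase.2 ⟨fun h' => h (by simpa using h'),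
      Finset.mem_univ _⟩, rfl⟩
  have h1 := H.tight_cover hS W (nb G (z j' b') \ nb G (z j b)) (by
    intro v hv
    obtain ⟨i, b'', h⟩ := hF.dom v hv
    by_cases hi : i = j' ∧ b'' = b'
    · by_cases hv' : v ∈ nb G (z j b)
      · exact Or.inr ⟨_, hmemW j b hne, mem_nb.1 hv'⟩
      · obtain ⟨rfl, rfl⟩ := hi
        exact Or.inl (Finset.mem_sdiff.2 ⟨mem_nb.2 h, hv'⟩)
    · exact Or.inr ⟨_, hmemW i b'' hi, h⟩)
  have h2 := Finset.card_sdiff_add_card_inter (nb G (z j' b')) (nb G (z j b))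
  rw [Finset.inter_comm] at h2
  have h3 := H.deg (z j' b')
  have h4 := hF.card_eq
  have h5 : 3 * Δ * (W.card + 1) ≤ 3 * Δ * (2 * Fintype.card J) := Nat.mul_le_mul_left _ hWcard
  rw [← h4] at h1
  nlinarith

/-- Otherwise `IsFull.larger` gives a larger full pair, which still contains `F` because only the
free edge `j` is given up. -/
theorem IsSys.adj_of_not_conn (H : Host G κ n Δ D) (hZ : IsSys G κ D F A S z) {j : J}
    (hj : j ∈ A) {x y : V} (hx : κ x ∈ S) (hy : κ y ∈ S)
    (hxU : ∀ i ≠ j, ∀ b, ¬ G.Adj (z i b) x) (hyU : ∀ i ≠ j, ∀ b, ¬ G.Adj (z i b) y)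
    (hnc : ¬ Conn (fun i b => κ (z i b)) {j}ᶜ (κ x) (κ y)) : G.Adj x y := by
  by_contra hxy
  obtain ⟨S', J', hJ', z', hF', hlt, hz'⟩ := hZ.full.larger H hx hy hxU hyU hnc hxy
  have := hZ.max S' J' hJ' z' hF' fun f hf => by
    obtain ⟨i, hi, rfl⟩ := hZ.fix f hf
    exact hz' i fun h => hi (h ▸ hj)
  omega

theorem IsFull.not_conn_swap (hF : IsFull G κ D S z) {j : J} {b : Bool} {x y : V}
    (hx : x ∈ swap G κ S z j b) (hy : y ∈ swap G κ S z j !b) :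
    ¬ Conn (fun i b => κ (z i b)) {j}ᶜ (κ x) (κ y) := by
  rw [mem_swap] at hx hy
  intro h
  refine hF.acyc.not_conn' (Set.mem_univ j) b
    ((hx.2.2.symm.trans (h.trans hy.2.2)).mono fun i hi => ⟨Set.mem_univ _, hi⟩)

theorem IsSys.swap_adj (H : Host G κ n Δ D) (hZ : IsSys G κ D F A S z) {j : J} (hj : j ∈ A)
    {b : Bool} {x y : V} (hx : x ∈ swap G κ S z j b) (hy : y ∈ swap G κ S z j !b) :
    G.Adj x y :=
  hZ.adj_of_not_conn H hj (mem_swap.1 hx).1 (mem_swap.1 hy).1 (mem_swap.1 hx).2.1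
    (mem_swap.1 hy).2.1 (hZ.full.not_conn_swap hx hy)

theorem IsSys.swap_subset_nb (H : Host G κ n Δ D) (hZ : IsSys G κ D F A S z) {j : J} (hj : j ∈ A)
    (b : Bool) : swap G κ S z j b ⊆ nb G (z j !b) := fun _ hx =>
  mem_nb.2 (hZ.swap_adj H hj hx (hZ.full.self_mem_swap j !b)).symm

theorem IsSys.card_swap_le (H : Host G κ n Δ D) (hZ : IsSys G κ D F A S z) {j : J} (hj : j ∈ A)
    (b : Bool) : (swap G κ S z j b).card ≤ Δ :=
  (Finset.card_le_card (hZ.swap_subset_nb H hj b)).trans (H.deg _)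

/-- The vertices of `S` not dominated by edges other than `j`. -/
noncomputable def loose (G : SimpleGraph V) (κ : V → ι) (S : Finset ι) (z : J → Bool → V)
    (j : J) : Finset V :=
  Finset.univ.filter fun w => κ w ∈ S ∧ ∀ i ≠ j, ∀ b', ¬ G.Adj (z i b') w

theorem mem_loose {j : J} {w : V} :
    w ∈ loose G κ S z j ↔ κ w ∈ S ∧ ∀ i ≠ j, ∀ b', ¬ G.Adj (z i b') w := by simp [loose]

/-- Without `j` the matching is two vertices short of the required `2(|S| - D)`, which leaves `2Δ`
minus the slack `Δ/3`. -/
theorem IsFull.card_loose (H : Host G κ n Δ D) (hF : IsFull G κ D S z) (j : J) :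
    5 * Δ < 3 * (loose G κ S z j).card := by
  have hS : S.Nonempty := ⟨_, hF.mem j false⟩
  have h1 := H.tight_cover hS (ends z (Finset.univ.erase j)) (loose G κ S z j) (by
    intro v hv
    by_cases h : v ∈ loose G κ S z j
    · exact Or.inl h
    · rw [mem_loose] at h
      push Not at h
      obtain ⟨i, hi, b, h⟩ := h hv
      exact Or.inr ⟨_, mem_ends.2 ⟨i, Finset.mem_erase.2 ⟨hi, Finset.mem_univ _⟩, b, rfl⟩, h⟩)
  have h2 := card_ends_le z (Finset.univ.erase j)
  have h3 := card_erase_univ j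
  have h4 := hF.card_eq
  have h5 : 3 * Δ * ((ends z (Finset.univ.erase j)).card + 2) ≤ 3 * Δ * (2 * Fintype.card J) :=
    Nat.mul_le_mul_left _ (by omega)
  rw [← h4] at h1
  nlinarith

/-- Loose vertices in distinct components are adjacent, so the part in each component has at least
`|L| - Δ` vertices. Three parts would give `3(|L| - Δ) ≤ |L|`, but `|L| > 5Δ/3`. -/
theorem IsSys.mem_swap_of_loose (H : Host G κ n Δ D) (hZ : IsSys G κ D F A S z) {j : J}
    (hj : j ∈ A) {w : V} (hw : w ∈ loose G κ S z j) : ∃ b, w ∈ swap G κ S z j b := by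
  by_contra! hcon
  have hnc : ∀ b, ¬ Conn (fun i b => κ (z i b)) {j}ᶜ (κ w) (κ (z j b)) := fun b h =>
    hcon b (mem_swap.2 ⟨(mem_loose.1 hw).1, (mem_loose.1 hw).2, h⟩)
  set L := loose G κ S z j with hL
  let B : V → Finset V := fun x => L.filter fun u => Conn (fun i b => κ (z i b)) {j}ᶜ (κ u) (κ x)
  have hB : ∀ x ∈ L, L.card ≤ (B x).card + Δ := by
    intro x hx
    rw [← Finset.card_filter_add_card_filter_not (s := L)
      (p := fun u => Conn (fun i b => κ (z i b)) {j}ᶜ (κ u) (κ x))]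
    refine Nat.add_le_add_left ((Finset.card_le_card fun u hu => ?_).trans (H.deg x)) _
    rw [Finset.mem_filter] at hu
    rw [mem_loose] at hx
    have hu' := mem_loose.1 hu.1
    exact mem_nb.2 (hZ.adj_of_not_conn H hj hu'.1 hx.1 hu'.2 hx.2 hu.2).symm
  have hdisj : ∀ x y, ¬ Conn (fun i b => κ (z i b)) {j}ᶜ (κ x) (κ y) → Disjoint (B x) (B y) :=
    fun x y hxy => Finset.disjoint_left.2 fun u hu hu' => hxy
      ((Finset.mem_filter.1 hu).2.symm.trans (Finset.mem_filter.1 hu').2)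
  have hz : ∀ b, z j b ∈ L := fun b =>
    mem_loose.2 ⟨hZ.full.mem j b, fun i hi b' => hZ.full.induced i j hi b' b⟩
  have h1 := hB _ hw
  have h2 := hB _ (hz false)
  have h3 := hB _ (hz true)
  have h4 : (B w ∪ (B (z j false) ∪ B (z j true))).card ≤ L.card :=
    Finset.card_le_card (Finset.union_subset (Finset.filter_subset _ _)
      (Finset.union_subset (Finset.filter_subset _ _) (Finset.filter_subset _ _)))
  rw [Finset.card_union_of_disjoint, Finset.card_union_of_disjoint] at h4
  · have := hZ.full.card_loose H j
    rw [← hL] at this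
    omega
  · exact hdisj _ _ (hZ.full.not_conn_swap (hZ.full.self_mem_swap j false)
      (hZ.full.self_mem_swap j true))
  · rw [Finset.disjoint_union_right]
    exact ⟨hdisj _ _ (hnc false), hdisj _ _ (hnc true)⟩

theorem IsSys.card_swap_add (H : Host G κ n Δ D) (hZ : IsSys G κ D F A S z) {j : J} (hj : j ∈ A)
    (b : Bool) : 5 * Δ < 3 * ((swap G κ S z j b).card + (swap G κ S z j !b).card) := by
  refine (hZ.full.card_loose H j).trans_le (Nat.mul_le_mul_left _ ?_)
  refine (Finset.card_le_card ?_).trans (Finset.card_union_le _ _)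
  intro w hw
  obtain ⟨b', hb'⟩ := hZ.mem_swap_of_loose H hj hw
  by_cases h : b' = b
  · exact Finset.mem_union_left _ (h ▸ hb')
  · obtain rfl : b' = !b := by cases b <;> cases b' <;> simp_all
    exact Finset.mem_union_right _ hb'

theorem IsSys.lt_card_swap (H : Host G κ n Δ D) (hZ : IsSys G κ D F A S z) {j : J} (hj : j ∈ A)
    (b : Bool) : 2 * Δ < 3 * (swap G κ S z j b).card := by
  have h1 := hZ.card_swap_add H hj b
  have h2 := hZ.card_swap_le H hj !b
  omega

/-- The loose vertices split into two completely joined sides, so `w` dominates what only the old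
end did. The forest survives because `w` lies in the component of the old end after removal of `j`.
-/
theorem IsSys.replace (H : Host G κ n Δ D) (hZ : IsSys G κ D F A S z) {j : J} (hj : j ∈ A)
    {b : Bool} {w : V} (hw : w ∈ swap G κ S z j b) : IsSys G κ D F A S (setEnd z j b w) := by
  have hF := hZ.full
  have hw' := mem_swap.1 hw
  have hb : ∀ b', b' = b ∨ b' = !b := fun b' => by cases b <;> cases b' <;> simp
  have hadj : G.Adj w (z j !b) := hZ.swap_adj H hj hw (hF.self_mem_swap j !b)
  have hself : ∀ i ≠ j, ∀ b' b'', ¬ G.Adj (z i b') (setEnd z j b w j b'') := by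
    intro i hi b' b''
    rcases hb b'' with rfl | rfl
    · rw [setEnd_self]; exact hw'.2.1 i hi b'
    · rw [setEnd_not]; exact hF.induced i j hi _ _
  refine ⟨{ adj := ?_, induced := ?_, acyc := ?_, mem := ?_, card_eq := hF.card_eq, dom := ?_ },
    ?_, hZ.max⟩
  · intro i b'
    by_cases hi : i = j
    · subst hi
      rcases hb b' with rfl | rfl
      · rw [setEnd_self, setEnd_not]; exact hadj
      · rw [setEnd_not, Bool.not_not, setEnd_self]; exact hadj.symm
    · rw [setEnd_of_ne hi]; exact hF.adj i b'
  · intro i i' hii' b' b''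
    by_cases hi : i = j
    · subst hi
      rw [setEnd_of_ne (Ne.symm hii')]
      exact fun h => hself i' (Ne.symm hii') b'' b' h.symm
    · rw [setEnd_of_ne hi]
      by_cases hi' : i' = j
      · subst hi'
        exact hself i hi b' b''
      · rw [setEnd_of_ne hi']; exact hF.induced i i' hii' b' b''
  · have h1 : Acyc (fun i b' => κ (setEnd z j b w i b')) {j}ᶜ :=
      (hF.acyc.mono (Set.subset_univ _)).congr fun i hi b' => by rw [setEnd_of_ne hi]
    refine (h1.insert_edge (i := j) fun hc => ?_).mono fun i _ => ?_
    · rw [conn_setEnd] at hc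
      refine hF.not_conn_swap hw (hF.self_mem_swap j !b) ?_
      cases b
      · simpa [setEnd] using hc
      · simpa [setEnd] using hc.symm
    · by_cases hi : i = j
      · exact Or.inl hi
      · exact Or.inr hi
  · intro i b'
    by_cases hi : i = j
    · subst hi
      rcases hb b' with rfl | rfl
      · rw [setEnd_self]; exact hw'.1
      · rw [setEnd_not]; exact hF.mem _ _
    · rw [setEnd_of_ne hi]; exact hF.mem _ _
  · intro v hv
    by_cases hvl : v ∈ loose G κ S z j
    · obtain ⟨b', hb'⟩ := hZ.mem_swap_of_loose H hj hvl
      rcases hb b' with rfl | rfl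
      · exact ⟨j, !b', by rw [setEnd_not]; exact (hZ.swap_adj H hj hb' (hF.self_mem_swap j _)).symm⟩
      · exact ⟨j, b, by rw [setEnd_self]; exact hZ.swap_adj H hj hw hb'⟩
    · rw [mem_loose] at hvl
      push Not at hvl
      obtain ⟨i, hi, b', h⟩ := hvl hv
      exact ⟨i, b', by rw [setEnd_of_ne hi]; exact h⟩
  · intro f hf
    obtain ⟨i, hi, rfl⟩ := hZ.fix f hf
    exact ⟨i, hi, setEnd_of_ne (fun h : i = j => hi (h ▸ hj)) _ _⟩

/-- One replacement of an end of a free edge. -/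
def Step (G : SimpleGraph V) (κ : V → ι) (S : Finset ι) (A : Set J) (z z' : J → Bool → V) : Prop :=
  ∃ j ∈ A, ∃ b, ∃ w ∈ swap G κ S z j b, z' = setEnd z j b w

/-- A sequence of replacements. -/
def Reach (G : SimpleGraph V) (κ : V → ι) (S : Finset ι) (A : Set J) :
    (J → Bool → V) → (J → Bool → V) → Prop :=
  Relation.ReflTransGen (Step G κ S A)

theorem IsSys.reach (H : Host G κ n Δ D) (hZ : IsSys G κ D F A S z) {z' : J → Bool → V}
    (h : Reach G κ S A z z') : IsSys G κ D F A S z' := by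
  induction h with
  | refl => exact hZ
  | tail _ h ih =>
    obtain ⟨j, hj, b, w, hw, rfl⟩ := h
    exact ih.replace H hj hw

theorem conn_of_mem_swap {j : J} {b : Bool} {w : V} (hw : w ∈ swap G κ S z j b) {c d : ι}
    (h : Conn (fun i b' => κ (setEnd z j b w i b')) Set.univ c d) :
    Conn (fun i b => κ (z i b)) Set.univ c d := by
  refine h.lift (g := id) fun i _ => ?_
  have hc := (mem_swap.1 hw).2.2.mono (Set.subset_univ _)
  by_cases hi : i = j
  · subst hi
    have h2 := hc.trans (Conn.edge (e := fun i b => κ (z i b)) (Set.mem_univ i) b (!b))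
    cases b
    · simpa [setEnd] using h2
    · simpa [setEnd] using h2.symm
  · simp only [setEnd_of_ne hi]
    exact Conn.edge (e := fun i b => κ (z i b)) (Set.mem_univ i) _ _

theorem IsFull.swap_back (hF : IsFull G κ D S z) {j : J} {b : Bool} {w : V}
    (hw : w ∈ swap G κ S z j b) :
    z j b ∈ swap G κ S (setEnd z j b w) j b ∧ setEnd (setEnd z j b w) j b (z j b) = z := by
  refine ⟨?_, by rw [setEnd_setEnd, setEnd_eq]⟩
  rw [swap_setEnd hw]
  exact hF.self_mem_swap j b

theorem IsSys.conn_reach (H : Host G κ n Δ D) (hZ : IsSys G κ D F A S z) {z' : J → Bool → V}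
    (h : Reach G κ S A z z') {c d : ι} :
    Conn (fun i b => κ (z' i b)) Set.univ c d ↔ Conn (fun i b => κ (z i b)) Set.univ c d := by
  induction h with
  | refl => rfl
  | tail hr h ih =>
    obtain ⟨j, hj, b, w, hw, rfl⟩ := h
    rw [← ih]
    refine ⟨conn_of_mem_swap hw, fun h => ?_⟩
    obtain ⟨h1, h2⟩ := (hZ.reach H hr).full.swap_back hw
    refine conn_of_mem_swap h1 ?_
    rwa [h2]

end Swap

/-! ### The blocks of a maximum full pair. -/

section Blocks

variable {V ι : Type*} {J : Type} [Fintype V] [Fintype ι] [Fintype J]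
  {G : SimpleGraph V} {κ : V → ι} {n Δ D : ℕ} {S : Finset ι} {z z₀ : J → Bool → V}
  {F : Set (Bool → V)} {A : Set J}

/-- Two subsets of a neighbourhood with large total size intersect. -/
theorem exists_mem_inter {X Y N : Finset V} (hX : X ⊆ N) (hY : Y ⊆ N)
    (h : N.card < X.card + Y.card) : ∃ t, t ∈ X ∧ t ∈ Y := by
  by_contra! hcon
  have h1 : Disjoint X Y := Finset.disjoint_left.2 hcon
  have h2 := Finset.card_le_card (Finset.union_subset hX hY)
  rw [Finset.card_union_of_disjoint h1] at h2
  omega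

theorem card_add_le_inter {X Y N : Finset V} (hX : X ⊆ N) (hY : Y ⊆ N) :
    X.card + Y.card ≤ (X ∩ Y).card + N.card := by
  have h2 := Finset.card_le_card (Finset.union_subset hX hY)
  have h3 := Finset.card_union_add_card_inter X Y
  omega

/-- By replacements, a vertex dominated only by free edges becomes dominated by just one of its
original dominators. -/
theorem IsSys.exists_unique_dominator (H : Host G κ n Δ D) (hZ : IsSys G κ D F A S z) {v : V}
    (hv : κ v ∈ S) (hvA : ∀ i ∉ A, ∀ b, ¬ G.Adj (z i b) v) :
    ∃ z', Reach G κ S A z z' ∧ ∃ j ∈ A, ∃ b, z' j b = z j b ∧ G.Adj (z j b) v ∧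
      v ∈ swap G κ S z' j !b := by
  let dm : (J → Bool → V) → Finset (J × Bool) := fun y =>
    Finset.univ.filter fun s => G.Adj (y s.1 s.2) v
  have hdm : ∀ y j b, (j, b) ∈ dm y ↔ G.Adj (y j b) v := fun y j b => by simp [dm]
  -- Only matchings in which `v` has acquired no new dominator are admitted; one with fewest
  -- dominators is chosen. There the swap set of each dominator lies in `nb G v`, for otherwise this
  -- dominator could be swapped away.
  let good : Set (J → Bool → V) := {y | Reach G κ S A z y ∧
    ∀ j b, G.Adj (y j b) v → y j b = z j b}
  obtain ⟨y, hy, hmin⟩ : ∃ y ∈ good, ∀ y' ∈ good, (dm y).card ≤ (dm y').card := by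
    have hne : ∃ m, ∃ y ∈ good, (dm y).card = m :=
      ⟨_, z, ⟨Relation.ReflTransGen.refl, fun _ _ _ => rfl⟩, rfl⟩
    obtain ⟨y, hy, hm⟩ := Nat.find_spec hne
    exact ⟨y, hy, fun y' hy' => hm ▸ Nat.find_min' hne ⟨y', hy', rfl⟩⟩
  have hY := hZ.reach H hy.1
  have hA : ∀ j b, G.Adj (y j b) v → j ∈ A := by
    intro j b h
    by_contra hj
    rw [hy.2 j b h] at h
    exact hvA j hj b h
  have hsub : ∀ j b, G.Adj (y j b) v → swap G κ S y j b ⊆ nb G v := by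
    intro j b h w hw
    by_contra hwv
    rw [mem_nb] at hwv
    have hsub : dm (setEnd y j b w) ⊆ (dm y).erase (j, b) := by
      rintro ⟨i, b'⟩ hi
      rw [hdm] at hi
      rw [Finset.mem_erase, hdm]
      by_cases hib : i = j ∧ b' = b
      · obtain ⟨rfl, rfl⟩ := hib
        rw [setEnd_self] at hi
        exact (hwv hi.symm).elim
      · refine ⟨fun h => hib (by simpa using h), ?_⟩
        simpa [setEnd, hib] using hi
    have h1 := Finset.card_le_card hsub
    have h2 := Finset.card_erase_add_one ((hdm y j b).2 h)
    have h3 := hmin (setEnd y j b w) ⟨hy.1.tail ⟨j, hA j b h, b, w, hw, rfl⟩, fun i b' hi => by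
      have := Finset.mem_of_mem_erase (hsub ((hdm _ i b').2 hi))
      rw [hdm] at this
      rw [← hy.2 i b' this]
      by_cases hib : i = j ∧ b' = b
      · obtain ⟨rfl, rfl⟩ := hib
        rw [setEnd_self] at hi
        exact (hwv hi.symm).elim
      · simp [setEnd, hib]⟩
    omega
  obtain ⟨j, b, hjb⟩ := hY.full.dom v hv
  -- Swap sets of different ends are disjoint and exceed `2Δ/3`, so `nb G v` has room for only one.
  have huniq : ∀ i b', G.Adj (y i b') v → i = j ∧ b' = b := by
    intro i b' h
    obtain ⟨t, ht, ht'⟩ := exists_mem_inter (hsub i b' h) (hsub j b hjb) (by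
      have h1 := hY.lt_card_swap H (hA i b' h) b'
      have h2 := hY.lt_card_swap H (hA j b hjb) b
      have h3 := H.deg v
      omega)
    exact hY.full.swap_disjoint ht ht'
  refine ⟨y, hy.1, j, hA j b hjb, b, hy.2 j b hjb, hy.2 j b hjb ▸ hjb, ?_⟩
  obtain ⟨b', hb'⟩ := hY.mem_swap_of_loose H (hA j b hjb) (w := v)
    (mem_loose.2 ⟨hv, fun i hi b' h => hi (huniq i b' h).1⟩)
  have h1 := huniq j (!b') (hY.swap_adj H (hA j b hjb) hb' (hY.full.self_mem_swap j _)).symm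
  obtain rfl : b' = !b := by rw [← h1.2, Bool.not_not]
  exact hb'

/-- `u` and `v` form an edge of a matching reachable from `z₀`. -/
def GAdj (G : SimpleGraph V) (κ : V → ι) (S : Finset ι) (z₀ : J → Bool → V) (u v : V) : Prop :=
  ∃ z, Reach G κ S Set.univ z₀ z ∧ ∃ j b, z j b = u ∧ z j (!b) = v

theorem IsSys.adj_of_gAdj (H : Host G κ n Δ D) (hZ : IsSys G κ D ∅ Set.univ S z₀) {u v : V}
    (h : GAdj G κ S z₀ u v) : G.Adj u v := by
  obtain ⟨z, hz, j, b, rfl, rfl⟩ := h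
  exact (hZ.reach H hz).full.adj j b

theorem IsSys.exists_gAdj (H : Host G κ n Δ D) (hZ : IsSys G κ D ∅ Set.univ S z₀)
    (hz : Reach G κ S Set.univ z₀ z) {v : V} (hv : κ v ∈ S) :
    ∃ j b, GAdj G κ S z₀ v (z j b) := by
  obtain ⟨z', hz', j, -, b, h1, -, h3⟩ := (hZ.reach H hz).exists_unique_dominator H hv (by simp)
  refine ⟨j, b, setEnd z' j (!b) v, (hz.trans hz').tail ⟨j, trivial, !b, v, h3, rfl⟩, j, !b,
    setEnd_self _ _ _, ?_⟩
  rw [setEnd_not, Bool.not_not, h1]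

/-- Given two partners of `v`, the swap sets opposite to `v` share some `t`, both being large in `nb
G v`. The swap sets on the side of `v` lie in `nb G t`, so they share more than `Δ/3` vertices, all
adjacent to both partners, against `IsFull.overlap`. -/
theorem IsSys.gAdj_unique (H : Host G κ n Δ D) (hZ : IsSys G κ D ∅ Set.univ S z₀)
    (hz : Reach G κ S Set.univ z₀ z) {v : V} {j j' : J} {b b' : Bool}
    (h : GAdj G κ S z₀ v (z j b)) (h' : GAdj G κ S z₀ v (z j' b')) : j = j' ∧ b = b' := by
  by_contra hne
  have hov := (hZ.reach H hz).full.overlap H hne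
  obtain ⟨y, hy, i, c, hv, hu⟩ := h
  obtain ⟨y', hy', i', c', hv', hu'⟩ := h'
  have hY := hZ.reach H hy
  have hY' := hZ.reach H hy'
  have h1 : ∀ d, 2 * Δ < 3 * (swap G κ S y i d).card := hY.lt_card_swap H trivial
  have h2 : ∀ d, 2 * Δ < 3 * (swap G κ S y' i' d).card := hY'.lt_card_swap H trivial
  have hsub : ∀ d, swap G κ S y i (!d) ⊆ nb G (y i d) := fun d => by
    simpa using hY.swap_subset_nb H trivial (!d)
  have hsub' : ∀ d, swap G κ S y' i' (!d) ⊆ nb G (y' i' d) := fun d => by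
    simpa using hY'.swap_subset_nb H trivial (!d)
  obtain ⟨t, ht, ht'⟩ := exists_mem_inter (X := swap G κ S y i (!c)) (Y := swap G κ S y' i' (!c'))
    (N := nb G v) (hv ▸ hsub c) (hv' ▸ hsub' c') (by
      have := H.deg v
      have := h1 !c
      have := h2 !c'
      omega)
  have h3 : swap G κ S y i c ⊆ nb G t := fun x hx =>
    mem_nb.2 (hY.swap_adj H trivial hx ht).symm
  have h4 : swap G κ S y' i' c' ⊆ nb G t := fun x hx =>
    mem_nb.2 (hY'.swap_adj H trivial hx ht').symm
  have h5 := card_add_le_inter h3 h4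
  have h6 : swap G κ S y i c ∩ swap G κ S y' i' c' ⊆ nb G (z j b) ∩ nb G (z j' b') := by
    refine Finset.inter_subset_inter ?_ ?_
    · rw [← hu]; simpa using hsub !c
    · rw [← hu']; simpa using hsub' !c'
  have h7 := Finset.card_le_card h6
  have h8 := H.deg t
  have h9 := h1 c
  have h10 := h2 c'
  omega

/-- A replacement alters a single slot. If the partner slot of `v` changed, one of the two slots
would be unaltered, and `v` would have two partners in the same matching. -/
theorem IsSys.gAdj_reach (H : Host G κ n Δ D) (hZ : IsSys G κ D ∅ Set.univ S z₀)
    (hz : Reach G κ S Set.univ z₀ z) {v : V} (hv : κ v ∈ S) (j : J) (b : Bool) :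
    GAdj G κ S z₀ v (z j b) ↔ GAdj G κ S z₀ v (z₀ j b) := by
  induction hz generalizing j b with
  | refl => rfl
  | tail hr h ih =>
    rename_i y y'
    have hr' := hr.tail h
    obtain ⟨i, -, c, w, -, rfl⟩ := h
    rw [← ih]
    have key : ∀ j b, ¬ (j = i ∧ b = c) → setEnd y i c w j b = y j b := by
      intro j b h
      simp [setEnd, h]
    obtain ⟨k, d, hkd⟩ := hZ.exists_gAdj H hr hv
    obtain ⟨k', d', hkd'⟩ := hZ.exists_gAdj H hr' hv
    have hk : k = k' ∧ d = d' := by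
      by_cases h1 : k = i ∧ d = c
      · by_cases h2 : k' = i ∧ d' = c
        · exact ⟨h1.1.trans h2.1.symm, h1.2.trans h2.2.symm⟩
        · rw [key _ _ h2] at hkd'
          exact hZ.gAdj_unique H hr hkd hkd'
      · rw [← key _ _ h1] at hkd
        exact hZ.gAdj_unique H hr' hkd hkd'
    obtain ⟨rfl, rfl⟩ := hk
    constructor
    · intro h
      obtain ⟨rfl, rfl⟩ := hZ.gAdj_unique H hr' hkd' h
      exact hkd
    · intro h
      obtain ⟨rfl, rfl⟩ := hZ.gAdj_unique H hr hkd h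
      exact hkd'

/-- The block of a slot: the vertices that reachable matchings have in this slot. -/
noncomputable def block (G : SimpleGraph V) (κ : V → ι) (S : Finset ι) (z₀ : J → Bool → V) (j : J)
    (b : Bool) : Finset V :=
  Finset.univ.filter fun w => κ w ∈ S ∧ GAdj G κ S z₀ w (z₀ j !b)

theorem mem_block {j : J} {b : Bool} {w : V} :
    w ∈ block G κ S z₀ j b ↔ κ w ∈ S ∧ GAdj G κ S z₀ w (z₀ j !b) := by simp [block]

theorem IsSys.mem_block_reach (H : Host G κ n Δ D) (hZ : IsSys G κ D ∅ Set.univ S z₀)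
    (hz : Reach G κ S Set.univ z₀ z) (j : J) (b : Bool) {w : V} :
    w ∈ block G κ S z₀ j b ↔ κ w ∈ S ∧ GAdj G κ S z₀ w (z j !b) := by
  rw [mem_block]
  exact and_congr_right fun hw => (hZ.gAdj_reach H hz hw j !b).symm

theorem IsSys.exists_block (hZ : IsSys G κ D ∅ Set.univ S z₀) (H : Host G κ n Δ D) {v : V}
    (hv : κ v ∈ S) : ∃ j b, v ∈ block G κ S z₀ j b := by
  obtain ⟨j, b, h⟩ := hZ.exists_gAdj H Relation.ReflTransGen.refl hv
  exact ⟨j, !b, mem_block.2 ⟨hv, by simpa using h⟩⟩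

theorem IsSys.block_disjoint (H : Host G κ n Δ D) (hZ : IsSys G κ D ∅ Set.univ S z₀) {v : V}
    {j j' : J} {b b' : Bool} (h : v ∈ block G κ S z₀ j b) (h' : v ∈ block G κ S z₀ j' b') :
    j = j' ∧ b = b' := by
  have := hZ.gAdj_unique H Relation.ReflTransGen.refl (mem_block.1 h).2 (mem_block.1 h').2
  simpa using this

theorem IsSys.end_mem_block (H : Host G κ n Δ D) (hZ : IsSys G κ D ∅ Set.univ S z₀)
    (hz : Reach G κ S Set.univ z₀ z) (j : J) (b : Bool) : z j b ∈ block G κ S z₀ j b :=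
  (hZ.mem_block_reach H hz j b).2 ⟨(hZ.reach H hz).full.mem j b, z, hz, j, b, rfl, rfl⟩

theorem IsSys.exists_reach_of_mem_block (H : Host G κ n Δ D) (hZ : IsSys G κ D ∅ Set.univ S z₀)
    {j : J} {b : Bool} {w : V} (hw : w ∈ block G κ S z₀ j b) :
    ∃ z, Reach G κ S Set.univ z₀ z ∧ z j b = w := by
  obtain ⟨z, hz, i, c, rfl, -⟩ := (mem_block.1 hw).2
  obtain ⟨rfl, rfl⟩ := hZ.block_disjoint H hw (hZ.end_mem_block H hz i c)
  exact ⟨z, hz, rfl⟩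

theorem IsSys.block_adj (H : Host G κ n Δ D) (hZ : IsSys G κ D ∅ Set.univ S z₀) {j : J} {b : Bool}
    {x y : V} (hx : x ∈ block G κ S z₀ j b) (hy : y ∈ block G κ S z₀ j !b) : G.Adj x y := by
  obtain ⟨z, hz, rfl⟩ := hZ.exists_reach_of_mem_block H hx
  have := (hZ.mem_block_reach H hz j _).1 hy
  rw [Bool.not_not] at this
  exact (hZ.adj_of_gAdj H this.2).symm

theorem IsSys.swap_subset_block (H : Host G κ n Δ D) (hZ : IsSys G κ D ∅ Set.univ S z₀)
    (hz : Reach G κ S Set.univ z₀ z) (j : J) (b : Bool) :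
    swap G κ S z j b ⊆ block G κ S z₀ j b := fun w hw =>
  (hZ.mem_block_reach H hz j b).2 ⟨(mem_swap.1 hw).1, setEnd z j b w,
    hz.tail ⟨j, trivial, b, w, hw, rfl⟩, j, b, setEnd_self _ _ _, setEnd_not _ _ _⟩

theorem IsSys.lt_card_block (H : Host G κ n Δ D) (hZ : IsSys G κ D ∅ Set.univ S z₀) (j : J)
    (b : Bool) : 2 * Δ < 3 * (block G κ S z₀ j b).card :=
  (hZ.lt_card_swap H trivial b).trans_le (Nat.mul_le_mul_left _
    (Finset.card_le_card (hZ.swap_subset_block H Relation.ReflTransGen.refl j b)))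

theorem IsSys.conn_end_reach (H : Host G κ n Δ D) (hZ : IsSys G κ D F A S z₀)
    (hz : Reach G κ S A z₀ z) (j : J) (b : Bool) :
    Conn (fun i b => κ (z₀ i b)) Set.univ (κ (z j b)) (κ (z₀ j b)) := by
  induction hz with
  | refl => exact Conn.refl _
  | tail hr h ih =>
    obtain ⟨i, -, c, w, hw, rfl⟩ := h
    by_cases hij : j = i ∧ b = c
    · obtain ⟨rfl, rfl⟩ := hij
      rw [setEnd_self]
      exact ((hZ.conn_reach H hr).1 ((mem_swap.1 hw).2.2.mono (Set.subset_univ _))).trans ih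
    · simpa [setEnd, hij] using ih

theorem IsSys.conn_of_mem_block (H : Host G κ n Δ D) (hZ : IsSys G κ D ∅ Set.univ S z₀) {j : J}
    {b : Bool} {w : V} (hw : w ∈ block G κ S z₀ j b) (b' : Bool) :
    Conn (fun i b => κ (z₀ i b)) Set.univ (κ w) (κ (z₀ j b')) := by
  obtain ⟨z, hz, rfl⟩ := hZ.exists_reach_of_mem_block H hw
  exact (hZ.conn_end_reach H hz j b).trans
    (Conn.edge (e := fun i b => κ (z₀ i b)) (Set.mem_univ j) _ _)

end Blocks

/-! ### Graph edges between blocks. -/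

section BlockSystem

variable {V ι : Type*} {J L : Type} [Fintype V] [Fintype ι] [Fintype J] [Fintype L]
  {G : SimpleGraph V} {κ : V → ι} {n Δ D : ℕ} {S C : Finset ι} {y z : J → Bool → V}
  {F : Set (Bool → V)} {A : Set J} {B : L → Bool → Finset V}

/-- A partition of the vertices of the classes in `C` into pairs of large blocks, opposite blocks
being completely joined. -/
structure BlockSystem (G : SimpleGraph V) (κ : V → ι) (Δ : ℕ) (C : Finset ι)
    (B : L → Bool → Finset V) : Prop where
  cover : ∀ v, κ v ∈ C → ∃ l b, v ∈ B l b
  mem : ∀ l b, ∀ v ∈ B l b, κ v ∈ C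
  adj : ∀ l b, ∀ x ∈ B l b, ∀ y ∈ B l !b, G.Adj x y
  large : ∀ l b, 2 * Δ < 3 * (B l b).card
  card_eq : Fintype.card L + 1 = C.card

theorem BlockSystem.subset_nb (hB : BlockSystem G κ Δ C B) {l : L} {b : Bool} {x : V}
    (hx : x ∈ B l b) : B l (!b) ⊆ nb G x := fun y hy => mem_nb.2 (hB.adj l b x hx y hy)

theorem BlockSystem.nonempty (hB : BlockSystem G κ Δ C B) (l : L) (b : Bool) :
    (B l b).Nonempty := by
  have := hB.large l b
  exact Finset.card_pos.1 (by omega)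

/-- A swap set meeting a block has a large intersection with it, and so do the opposite sets. -/
theorem BlockSystem.meet (H : Host G κ n Δ D) (hB : BlockSystem G κ Δ C B)
    (hY : IsSys G κ D F A S y) {i : J} (hi : i ∈ A) {c : Bool} {l : L} {d : Bool} {w : V}
    (hw : w ∈ swap G κ S y i c) (hw' : w ∈ B l d) :
    (swap G κ S y i (!c)).card + (B l !d).card ≤
      (swap G κ S y i (!c) ∩ B l !d).card + Δ := by
  have h1 : swap G κ S y i (!c) ⊆ nb G w := fun x hx => mem_nb.2 (hY.swap_adj H hi hw hx)
  exact (card_add_le_inter h1 (hB.subset_nb hw')).trans (Nat.add_le_add_left (H.deg w) _)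

theorem BlockSystem.exists_meet (H : Host G κ n Δ D) (hB : BlockSystem G κ Δ C B)
    (hY : IsSys G κ D F A S y) {i : J} (hi : i ∈ A) {c : Bool} {l : L} {d : Bool} {w : V}
    (hw : w ∈ swap G κ S y i c) (hw' : w ∈ B l d) :
    ∃ w', w' ∈ swap G κ S y i (!c) ∧ w' ∈ B l !d := by
  have h1 := hB.meet H hY hi hw hw'
  have h2 := hB.large l !d
  have h3 := hY.lt_card_swap H hi !c
  obtain ⟨w', h⟩ := Finset.card_pos.1 (show 0 < (swap G κ S y i (!c) ∩ B l !d).card by omega)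
  exact ⟨w', Finset.mem_inter.1 h⟩

theorem BlockSystem.meet' (H : Host G κ n Δ D) (hB : BlockSystem G κ Δ C B)
    (hY : IsSys G κ D F A S y) {i : J} (hi : i ∈ A) {c : Bool} {l : L} {d : Bool} {w : V}
    (hw : w ∈ swap G κ S y i c) (hw' : w ∈ B l d) :
    (swap G κ S y i c).card + (B l d).card ≤ (swap G κ S y i c ∩ B l d).card + Δ := by
  obtain ⟨w', h1, h2⟩ := hB.exists_meet H hY hi hw hw'
  simpa using hB.meet H hY hi h1 h2

/-- The vertices dominated by at least two ends of the matching. -/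
noncomputable def exotic (G : SimpleGraph V) (κ : V → ι) (S : Finset ι) (y : J → Bool → V) :
    Finset V :=
  Finset.univ.filter fun v => κ v ∈ S ∧ ∃ j b j' b', ¬ (j = j' ∧ b = b') ∧ G.Adj (y j b) v ∧
    G.Adj (y j' b') v

/-- Double count incidences: the neighbourhoods of the ends cover `S` with total waste below `Δ/3`,
and each such vertex wastes at least one. -/
theorem IsFull.card_exotic (H : Host G κ n Δ D) (hF : IsFull G κ D S y) (j₀ : J) :
    3 * (exotic G κ S y).card < Δ := by
  let dm : V → Finset (J × Bool) := fun v => Finset.univ.filter fun s => G.Adj (y s.1 s.2) v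
  have h1 : ∑ v ∈ verts κ S, (dm v).card ≤ ∑ s : J × Bool, (nb G (y s.1 s.2)).card := by
    simp only [dm, Finset.card_filter]
    rw [Finset.sum_comm]
    refine Finset.sum_le_sum fun s _ => ?_
    rw [← Finset.card_filter]
    exact Finset.card_le_card fun v hv => mem_nb.2 (Finset.mem_filter.1 hv).2
  have h2 : ∑ s : J × Bool, (nb G (y s.1 s.2)).card ≤ 2 * Fintype.card J * Δ := by
    refine (Finset.sum_le_card_nsmul _ _ Δ fun s _ => H.deg _).trans ?_
    rw [Finset.card_univ, Fintype.card_prod, Fintype.card_bool, smul_eq_mul, mul_comm 2]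
  have h3 : (verts κ S).card + (exotic G κ S y).card ≤ ∑ v ∈ verts κ S, (dm v).card := by
    have hex : (exotic G κ S y).card = ∑ v ∈ verts κ S, if v ∈ exotic G κ S y then 1 else 0 := by
      rw [← Finset.card_filter]
      congr 1
      ext v
      simp only [exotic, Finset.mem_filter, Finset.mem_univ, true_and, mem_verts]
      exact ⟨fun h => ⟨h.1, h⟩, fun h => h.2⟩
    rw [hex, Finset.card_eq_sum_ones, ← Finset.sum_add_distrib]
    refine Finset.sum_le_sum fun v hv => ?_
    split_ifs with h
    · simp only [exotic, Finset.mem_filter, Finset.mem_univ, true_and] at h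
      obtain ⟨-, j, b, j', b', hne, h, h'⟩ := h
      have : ({(j, b), (j', b')} : Finset (J × Bool)) ⊆ dm v := by
        intro s hs
        simp only [Finset.mem_insert, Finset.mem_singleton] at hs
        rcases hs with rfl | rfl
        · simpa [dm] using h
        · simpa [dm] using h'
      have h4 := Finset.card_le_card this
      rwa [Finset.card_pair (by simpa using hne)] at h4
    · obtain ⟨j, b, h⟩ := hF.dom v (mem_verts.1 hv)
      exact Finset.card_pos.2 ⟨(j, b), by simpa [dm] using h⟩
  have h4 := H.le_card_verts S
  have h5 := H.tight S.card (Finset.card_pos.2 ⟨_, hF.mem j₀ false⟩) (Finset.card_le_univ _)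
  have h6 := hF.card_eq
  rw [← h6] at h4 h5
  nlinarith

/-- If an edge of a full pair joins two blocks, these blocks are opposite. -/
theorem BlockSystem.opposite_of_adj (H : Host G κ n Δ D) (hB : BlockSystem G κ Δ C B)
    (hC : ∀ m, 1 ≤ m → m < C.card → 2 * Δ * (m - 1) < n * m) {j₀ : J} {f : Bool → V}
    (hf : y j₀ = f) (hY : IsSys G κ D {f} {j₀}ᶜ S y) {l l' : L} {c c' : Bool}
    (ha : f false ∈ B l c) (hb : f true ∈ B l' c') : l = l' ∧ c' = !c := by
  have hF := hY.full
  have hya : y j₀ false = f false := by rw [hf]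
  have hyb : y j₀ true = f true := by rw [hf]
  by_cases hll : l = l'
  · subst hll
    refine ⟨rfl, ?_⟩
    by_contra hcc
    obtain rfl : c' = c := by cases c <;> cases c' <;> simp_all
    have h1 := hF.overlap H (j := j₀) (j' := j₀) (b := false) (b' := true) (by simp)
    rw [hya, hyb] at h1
    have h2 := Finset.card_le_card (Finset.subset_inter (hB.subset_nb ha) (hB.subset_nb hb))
    have h3 := hB.large l !c'
    omega
  exfalso
  -- the labels whose swap sets meet the block system
  let TC : Finset J := Finset.univ.filter fun i => i ≠ j₀ ∧
    ∃ b, ∃ w ∈ swap G κ S y i b, κ w ∈ C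
  have hTC : ∀ i, i ∈ TC ↔ i ≠ j₀ ∧ ∃ b, ∃ w ∈ swap G κ S y i b, κ w ∈ C := by simp [TC]
  -- A swap set meeting a block forces the opposite swap set to meet the opposite block, so the
  -- label `i` is aligned with one pair of blocks; `δ` records the orientation.
  have hmatch : ∀ i, ∃ (k : L) (d : Bool), i ∈ TC → ∀ b, ∃ w, w ∈ swap G κ S y i b ∧
      w ∈ B k (xor b d) := by
    intro i
    by_cases hi : i ∈ TC
    · obtain ⟨hij, b, w, hw, hwC⟩ := (hTC i).1 hi
      obtain ⟨k, e, hwe⟩ := hB.cover w hwC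
      obtain ⟨w', hw', hwe'⟩ := hB.exists_meet H hY (i := i) hij hw hwe
      refine ⟨k, xor b e, fun _ b' => ?_⟩
      by_cases hbb : b' = b
      · subst hbb
        exact ⟨w, hw, by simpa using hwe⟩
      · obtain rfl : b' = !b := by cases b <;> cases b' <;> simp_all
        refine ⟨w', hw', ?_⟩
        cases b <;> cases e <;> simpa using hwe'
    · exact ⟨l, false, fun h => (hi h).elim⟩
  choose φ δ hφ using hmatch
  -- Two disjoint swap sets aligned with one block would give three sets larger than `2Δ/3` of total
  -- size at most `2Δ`.
  have hφinj : ∀ i ∈ TC, ∀ i' ∈ TC, φ i = φ i' → i = i' := by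
    intro i hi i' hi' h
    by_contra hne
    obtain ⟨w, hw, hwB⟩ := hφ i hi false
    have hb' : ∃ b', xor b' (δ i') = xor false (δ i) :=
      ⟨xor (δ i) (δ i'), by cases δ i <;> cases δ i' <;> rfl⟩
    obtain ⟨b', hb'⟩ := hb'
    obtain ⟨w', hw', hwB'⟩ := hφ i' hi' b'
    rw [hb', ← h] at hwB'
    have h1 := hB.meet' H hY ((hTC i).1 hi).1 hw hwB
    have h2 := hB.meet' H hY ((hTC i').1 hi').1 hw' hwB'
    have h3 : Disjoint (swap G κ S y i false ∩ B (φ i) (xor false (δ i)))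
        (swap G κ S y i' b' ∩ B (φ i) (xor false (δ i))) :=
      Finset.disjoint_left.2 fun x hx hx' => hne
        (hF.swap_disjoint (Finset.mem_inter.1 hx).1 (Finset.mem_inter.1 hx').1).1
    have h4 := Finset.card_le_card (Finset.union_subset
      (Finset.inter_subset_right (s₁ := swap G κ S y i false) (s₂ := B (φ i) (xor false (δ i))))
      (Finset.inter_subset_right (s₁ := swap G κ S y i' b') (s₂ := B (φ i) (xor false (δ i)))))
    rw [Finset.card_union_of_disjoint h3] at h4
    have h5 := hB.large (φ i) (xor false (δ i))
    have h6 := hY.lt_card_swap H (j := i) ((hTC i).1 hi).1 false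
    have h7 := hY.lt_card_swap H (j := i') ((hTC i').1 hi').1 b'
    omega
  -- An end of `j₀` in a block is adjacent to the whole opposite block, while swap vertices of other
  -- labels are not adjacent to it.
  have hφne : ∀ i ∈ TC, ∀ b k d, y j₀ b ∈ B k d → φ i ≠ k := by
    rintro i hi b k d hk rfl
    obtain ⟨w, hw, hwB⟩ := hφ i hi (xor (!d) (δ i))
    have : xor (xor (!d) (δ i)) (δ i) = !d := by cases d <;> cases δ i <;> rfl
    rw [this] at hwB
    exact (mem_swap.1 hw).2.1 j₀ (Ne.symm ((hTC i).1 hi).1) b (hB.adj _ _ _ hk _ hwB)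
  have hφl : ∀ i ∈ TC, φ i ≠ l := fun i hi => hφne i hi false l c (hya ▸ ha)
  have hφl' : ∀ i ∈ TC, φ i ≠ l' := fun i hi => hφne i hi true l' c' (hyb ▸ hb)
  have hTCcard : TC.card + 2 ≤ Fintype.card L := by
    have h1 : TC.card ≤ ((Finset.univ.erase l).erase l').card :=
      Finset.card_le_card_of_injOn φ (fun i hi => Finset.mem_coe.2 (Finset.mem_erase.2
        ⟨hφl' i hi, Finset.mem_erase.2 ⟨hφl i hi, Finset.mem_univ _⟩⟩))
        (fun i hi i' hi' h => hφinj i hi i' hi' h)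
    have h2 := Finset.card_erase_add_one (Finset.mem_univ l)
    have h3 := Finset.card_erase_add_one (s := Finset.univ.erase l) (a := l')
      (Finset.mem_erase.2 ⟨fun h => hll h.symm, Finset.mem_univ l'⟩)
    rw [Finset.card_univ] at h2
    omega
  -- the common classes are dominated by the edges with these labels
  have hdom : ∀ v, κ v ∈ C → κ v ∈ S → ∃ i ∈ insert j₀ TC, ∃ b, G.Adj (y i b) v := by
    intro v hvC hvS
    by_contra! hcon
    -- After replacements, `v` belongs to the swap set opposite a single end `y i b`. That set meets
    -- the block of `v` in more than `Δ/3` vertices adjacent to `y i b`, so the original swap set,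
    -- above `2Δ/3` in the same neighbourhood, meets this block too and `i ∈ TC`.
    obtain ⟨y', hy', i, hi, b, hyi, hadj, hv⟩ := hY.exists_unique_dominator H hvS (by
      intro i hi b
      have : i = j₀ := by simpa using hi
      subst this
      exact hcon i (Finset.mem_insert_self _ _) b)
    have hY' := hY.reach H hy'
    refine hcon i (Finset.mem_insert_of_mem ((hTC i).2 ⟨hi, ?_⟩)) b hadj
    obtain ⟨k, e, hvB⟩ := hB.cover v hvC
    have h1 := hB.meet' H hY' hi hv hvB
    have h2 := hB.large k e
    have h3 := hY'.lt_card_swap H hi !b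
    have h4 := hY.lt_card_swap H hi !b
    have h5 : swap G κ S y' i (!b) ∩ B k e ⊆ nb G (y i b) := by
      intro x hx
      rw [← hyi]
      simpa using hY'.swap_subset_nb H hi (!b) (Finset.mem_inter.1 hx).1
    have h6 : swap G κ S y i (!b) ⊆ nb G (y i b) := by
      simpa using hY.swap_subset_nb H hi !b
    obtain ⟨w, hw, hw'⟩ := exists_mem_inter h5 h6 (by
      have := H.deg (y i b)
      omega)
    exact ⟨!b, w, hw', hB.mem k e w (Finset.mem_inter.1 hw).2⟩
  have hj₀TC : j₀ ∉ TC := fun h => ((hTC j₀).1 h).1 rfl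
  have hm : (C ∩ S).card ≤ TC.card + 1 := by
    by_contra! hlt
    have h1 := H.card_le_of_cover (X := verts κ (C ∩ S)) (ends y (insert j₀ TC)) ∅ fun v hv => by
      obtain ⟨h1, h2⟩ := Finset.mem_inter.1 (mem_verts.1 hv)
      obtain ⟨i, hi, b, h⟩ := hdom v h1 h2
      exact Or.inr ⟨_, mem_ends.2 ⟨i, hi, b, rfl⟩, h⟩
    have h2 := H.le_card_verts (C ∩ S)
    have h3 := card_ends_le y (insert j₀ TC)
    rw [Finset.card_insert_of_notMem hj₀TC] at h3
    rw [Finset.card_empty, add_zero] at h1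
    have h4 : n * (C ∩ S).card ≤ Δ * (2 * (TC.card + 1)) :=
      h2.trans (h1.trans (Nat.mul_le_mul_left _ h3))
    have h5 := Finset.card_le_card (Finset.inter_subset_left (s₁ := C) (s₂ := S))
    have h6 := hB.card_eq
    -- `hC` needs `m < |C|`. If `C ⊆ S`, take `m = |C| - 1`; this is large enough because the pairs
    -- `l` and `l'` are not used by `TC`.
    obtain ⟨m, hm1, hm2, hm3, hm4⟩ : ∃ m, 1 ≤ m ∧ m < C.card ∧ m ≤ (C ∩ S).card ∧
        TC.card + 1 ≤ m - 1 := by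
      by_cases h : (C ∩ S).card < C.card
      · exact ⟨(C ∩ S).card, by omega, h, le_rfl, by omega⟩
      · exact ⟨C.card - 1, by omega, by omega, by omega, by omega⟩
    have h7 := hC m hm1 hm2
    have h8 : n * m ≤ n * (C ∩ S).card := Nat.mul_le_mul_left _ hm3
    have h9 : 2 * Δ * (TC.card + 1) ≤ 2 * Δ * (m - 1) := Nat.mul_le_mul_left _ hm4
    have h10 : Δ * (2 * (TC.card + 1)) = 2 * Δ * (TC.card + 1) := by ring
    omega
  -- a small set dominating all classes involved
  have hq : ∀ (k : L) (d : Bool), ∃ q : V, B k d ⊆ nb G q ∧ (k = l → d = (!c) → q = f false) ∧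
      (k = l' → d = (!c') → q = f true) ∧
      ∀ i ∈ TC, φ i = k → ∀ b, xor b (δ i) = d → swap G κ S y i b ⊆ nb G q := by
    intro k d
    by_cases h1 : k = l ∧ d = !c
    · obtain ⟨rfl, rfl⟩ := h1
      exact ⟨f false, hB.subset_nb ha, fun _ _ => rfl, fun h => (hll h).elim,
        fun i hi h => (hφl i hi h).elim⟩
    by_cases h2 : k = l' ∧ d = !c'
    · obtain ⟨rfl, rfl⟩ := h2
      exact ⟨f true, hB.subset_nb hb, fun h => (hll h.symm).elim, fun _ _ => rfl,
        fun i hi h => (hφl' i hi h).elim⟩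
    by_cases h3 : ∃ i ∈ TC, φ i = k
    · obtain ⟨i, hi, rfl⟩ := h3
      obtain ⟨w, hw, hwB⟩ := hφ i hi (xor (!d) (δ i))
      have : xor (xor (!d) (δ i)) (δ i) = !d := by cases d <;> cases δ i <;> rfl
      rw [this] at hwB
      refine ⟨w, by simpa using hB.subset_nb hwB, fun h => (hφl i hi h).elim,
        fun h => (hφl' i hi h).elim, fun i' hi' h b hbd => ?_⟩
      obtain rfl := hφinj i' hi' i hi h
      have hb' : xor (!d) (δ i') = !b := by rw [← hbd]; cases b <;> cases δ i' <;> rfl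
      rw [hb'] at hw
      exact fun x hx => mem_nb.2 (hY.swap_adj H ((hTC i').1 hi').1 hx hw).symm
    · obtain ⟨w, hw⟩ := hB.nonempty k !d
      exact ⟨w, by simpa using hB.subset_nb hw, fun h h' => (h1 ⟨h, h'⟩).elim,
        fun h h' => (h2 ⟨h, h'⟩).elim, fun i hi h => (h3 ⟨i, hi, h⟩).elim⟩
  -- One vertex per block dominates `C`, and these vertices also take over from the edges in `insert
  -- j₀ TC`, except at exotic vertices. The ends of those edges are thus saved.
  choose q hq1 hq2 hq3 hq4 using hq
  let W₁ : Finset V := (Finset.univ : Finset (L × Bool)).image fun s => q s.1 s.2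
  have hqW : ∀ k d, q k d ∈ W₁ := fun k d => Finset.mem_image.2 ⟨(k, d), Finset.mem_univ _, rfl⟩
  have hW₁ : W₁.card ≤ 2 * Fintype.card L := by
    refine Finset.card_image_le.trans ?_
    rw [Finset.card_univ, Fintype.card_prod, Fintype.card_bool, mul_comm]
  have hW₂ := card_ends_le y (insert j₀ TC)ᶜ
  have hcompl := Finset.card_add_card_compl (insert j₀ TC)
  rw [Finset.card_insert_of_notMem hj₀TC] at hcompl
  have hcov := H.tight_cover (X := S ∪ C) ⟨_, Finset.mem_union_left _ (hF.mem j₀ false)⟩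
    (W₁ ∪ ends y (insert j₀ TC)ᶜ) (exotic G κ S y) (by
      intro v hv
      by_cases hvC : κ v ∈ C
      · obtain ⟨k, d, hk⟩ := hB.cover v hvC
        exact Or.inr ⟨q k d, Finset.mem_union_left _ (hqW k d), mem_nb.1 (hq1 k d hk)⟩
      have hvS : κ v ∈ S := (Finset.mem_union.1 hv).resolve_right hvC
      by_cases hex : v ∈ exotic G κ S y
      · exact Or.inl hex
      right
      obtain ⟨i, b, h⟩ := hF.dom v hvS
      have huniq : ∀ i' b', G.Adj (y i' b') v → i = i' ∧ b = b' := by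
        intro i' b' h'
        by_contra hne
        exact hex (Finset.mem_filter.2 ⟨Finset.mem_univ _, hvS, i, b, i', b', hne, h, h'⟩)
      by_cases hi : i ∈ insert j₀ TC
      · rcases Finset.mem_insert.1 hi with rfl | hi
        · cases b
          · exact ⟨y i false, Finset.mem_union_left _ (by
              rw [hya, ← hq2 l (!c) rfl rfl]; exact hqW _ _), h⟩
          · exact ⟨y i true, Finset.mem_union_left _ (by
              rw [hyb, ← hq3 l' (!c') rfl rfl]; exact hqW _ _), h⟩
        · obtain ⟨b', hb'⟩ := hY.mem_swap_of_loose H (j := i) ((hTC i).1 hi).1 (w := v)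
            (mem_loose.2 ⟨hvS, fun i' hi' b' h' => hi' (huniq i' b' h').1.symm⟩)
          exact ⟨q (φ i) (xor b' (δ i)), Finset.mem_union_left _ (hqW _ _),
            mem_nb.1 (hq4 _ _ i hi rfl b' rfl hb')⟩
      · exact ⟨y i b, Finset.mem_union_right _ (mem_ends.2
          ⟨i, Finset.mem_compl.2 hi, b, rfl⟩), h⟩)
  have hW := Finset.card_union_le W₁ (ends y (insert j₀ TC)ᶜ)
  have hex := hF.card_exotic H j₀
  have hFc := hF.card_eq
  have hunion := Finset.card_union_add_card_inter S C
  rw [Finset.inter_comm] at hunion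
  have hBc := hB.card_eq
  -- The bound is `2(|C| - 1) + 2(|S| - D - |TC| - 1)` with `|C ∩ S| ≤ |TC| + 1`. Being two vertices
  -- short costs `2Δ`, more than the slack and the exotic vertices together.
  have hfin : (W₁ ∪ ends y (insert j₀ TC)ᶜ).card + 2 * D + 2 ≤ 2 * (S ∪ C).card := by omega
  have := Nat.mul_le_mul_left (3 * Δ) hfin
  nlinarith

end BlockSystem

/-! ### Pairs of sets all of whose choices are spanning trees. -/

section Hypertree

variable {ι : Type*} {L : Type} [Fintype ι] [Fintype L] {C Y : Finset ι}
  {f : L → Bool → Finset ι} {s : L → Bool → ι}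

/-- A family of pairs of sets of vertices such that each choice of ends yields a spanning tree
of `C`. -/
structure TreeSystem (C : Finset ι) (f : L → Bool → Finset ι) : Prop where
  nonempty : ∀ l b, (f l b).Nonempty
  subset : ∀ l b, f l b ⊆ C
  acyc : ∀ s : L → Bool → ι, (∀ l b, s l b ∈ f l b) → Acyc s Set.univ
  card_eq : Fintype.card L + 1 = C.card

/-- The pairs contained in `Y`. -/
noncomputable def inner (f : L → Bool → Finset ι) (Y : Finset ι) : Finset L :=
  Finset.univ.filter fun l => ∀ b, f l b ⊆ Y

theorem mem_inner {l : L} : l ∈ inner f Y ↔ ∀ b, f l b ⊆ Y := by simp [inner]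

theorem conn_univ_compl {j : L} {c d : ι} (h : Conn s Set.univ c d) :
    Conn s {j}ᶜ c d ∨ ∃ b, Conn s {j}ᶜ c (s j b) ∧ Conn s {j}ᶜ (s j !b) d := by
  refine Conn.insert_cases (h.mono fun i _ => ?_)
  by_cases hi : i = j
  · exact Or.inl hi
  · exact Or.inr hi

theorem mem_setEnd {l : L} {b : Bool} {c : ι} (hs : ∀ l b, s l b ∈ f l b) (hc : c ∈ f l b)
    (l' : L) (b' : Bool) : setEnd s l b c l' b' ∈ f l' b' := by
  unfold setEnd
  split_ifs with h
  · rw [h.1, h.2]; exact hc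
  · exact hs l' b'

namespace TreeSystem

theorem conn (hf : TreeSystem C f) (hs : ∀ l b, s l b ∈ f l b) {c d : ι} (hc : c ∈ C)
    (hd : d ∈ C) : Conn s Set.univ c d := by
  have h1 := card_image_comp Finset.univ Finset.coe_univ.symm (hf.acyc s hs) C
    fun l _ b => hf.subset l b (hs l b)
  have h2 := hf.card_eq
  rw [Finset.card_univ] at h1
  exact comp_eq_iff.1 (Finset.card_le_one.1 (by omega) _ (Finset.mem_image_of_mem _ hc) _
    (Finset.mem_image_of_mem _ hd))

theorem card_inner_lt (hf : TreeSystem C f) (hY : Y.Nonempty) :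
    (inner f Y).card < Y.card := by
  choose s hs using hf.nonempty
  exact card_lt_of_acyc (e := s) (inner f Y) ((hf.acyc s hs).mono (Set.subset_univ _)) Y hY
    fun l hl b => mem_inner.1 hl b (hs l b)

theorem conn_inner (hf : TreeSystem C f) (hs : ∀ l b, s l b ∈ f l b)
    (hY : Y.card ≤ (inner f Y).card + 1) {c d : ι} (hc : c ∈ Y) (hd : d ∈ Y) :
    Conn s (inner f Y : Set L) c d := by
  have h1 := card_image_comp (inner f Y) rfl ((hf.acyc s hs).mono (Set.subset_univ _)) Y
    fun l hl b => mem_inner.1 hl b (hs l b)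
  exact comp_eq_iff.1 (Finset.card_le_one.1 (by omega) _ (Finset.mem_image_of_mem _ hc) _
    (Finset.mem_image_of_mem _ hd))

theorem not_conn (hf : TreeSystem C f) (hs : ∀ l b, s l b ∈ f l b) (j : L) (b : Bool) :
    ¬ Conn s {j}ᶜ (s j b) (s j !b) := fun h =>
  (hf.acyc s hs).not_conn' (Set.mem_univ j) b (h.mono fun _ hi => ⟨Set.mem_univ _, hi⟩)

/-- A choice of ends with a smallest side of the edge `j`: this side only contains edges which can
not be moved out of it. -/
theorem exists_side (hf : TreeSystem C f) {j : L} {b : Bool} {c₀ : ι} (hc₀ : c₀ ∈ f j b) :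
    ∃ s : L → Bool → ι, (∀ l b, s l b ∈ f l b) ∧ s j b = c₀ ∧
      ∀ l ≠ j, ∀ b', Conn s {j}ᶜ (s l b') (s j b) →
        ∀ b'', ∀ c ∈ f l b'', Conn s {j}ᶜ c (s j b) := by
  let side : (L → Bool → ι) → Finset ι := fun s => C.filter fun c => Conn s {j}ᶜ c (s j b)
  let good : Set (L → Bool → ι) := {s | (∀ l b, s l b ∈ f l b) ∧ s j b = c₀}
  obtain ⟨s, hs, hmin⟩ : ∃ s ∈ good, ∀ s' ∈ good, (side s).card ≤ (side s').card := by
    have hne : ∃ m, ∃ s ∈ good, (side s).card = m := by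
      choose s hs using hf.nonempty
      exact ⟨_, setEnd s j b c₀, ⟨mem_setEnd hs hc₀, setEnd_self _ _ _⟩, rfl⟩
    obtain ⟨s, hs, hm⟩ := Nat.find_spec hne
    exact ⟨s, hs, fun s' hs' => hm ▸ Nat.find_min' hne ⟨s', hs', rfl⟩⟩
  refine ⟨s, hs.1, hs.2, fun l hlj b' hlb' c c' hc' => ?_⟩
  by_contra hc'A
  have hl : ∀ b₁, Conn s {j}ᶜ (s l b₁) (s j b) := fun b₁ =>
    (Conn.edge (e := s) (A := {j}ᶜ) hlj b₁ b').trans hlb'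
  set s' := setEnd s l c c' with hs'
  have hs'f : ∀ l b, s' l b ∈ f l b := mem_setEnd hs.1 hc'
  have hs'j : ∀ b, s' j b = s j b := fun b => by rw [hs', setEnd_of_ne (Ne.symm hlj)]
  have hs'l : s' l c = c' := setEnd_self _ _ _
  have hs'l' : s' l (!c) = s l !c := setEnd_not _ _ _
  set K : Set L := {j}ᶜ \ {l} with hK
  have hKsub : K ⊆ {j}ᶜ := Set.sdiff_subset
  have hKs : ∀ {x y}, Conn s K x y ↔ Conn s' K x y := by
    intro x y
    constructor
    · exact fun h => h.congr fun i hi b' => by rw [hs', setEnd_of_ne hi.2]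
    · exact fun h => h.congr fun i hi b' => by rw [hs', setEnd_of_ne hi.2]
  have hcases : ∀ (t : L → Bool → ι) {x y}, Conn t {j}ᶜ x y →
      Conn t K x y ∨ ∃ b, Conn t K x (t l b) ∧ Conn t K (t l !b) y := by
    intro t x y h
    refine Conn.insert_cases (h.mono fun i hi => ?_)
    by_cases hil : i = l
    · exact Or.inl hil
    · exact Or.inr ⟨hi, hil⟩
  by_cases h1 : Conn s K (s l !c) (s j b)
  · -- the moved edge joins the two sides, which yields a cycle
    have hcon : Conn s K c' (s j !b) := by
      have h2 : Conn s {j}ᶜ c' (s j !b) := by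
        rcases conn_univ_compl (j := j) (hf.conn hs.1 (hf.subset _ _ hc')
          (hf.subset _ _ (hs.1 j b))) with h | ⟨b₂, h, h'⟩
        · exact (hc'A h).elim
        · by_cases hb : b₂ = b
          · exact (hc'A (hb ▸ h)).elim
          · obtain rfl : b₂ = !b := by cases b <;> cases b₂ <;> simp_all
            exact h
      rcases hcases s h2 with h | ⟨b₂, h, -⟩
      · exact h
      · exact (hc'A ((h.mono hKsub).trans (hl b₂))).elim
    refine hf.not_conn hs'f j b ?_
    rw [hs'j, hs'j]
    have h3 : Conn s' {j}ᶜ (s l !c) c' := by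
      rw [← hs'l', ← hs'l]
      exact Conn.edge hlj _ _
    exact ((hKs.1 h1).symm.mono hKsub).trans (h3.trans ((hKs.1 hcon).mono hKsub))
  -- Otherwise moving the end makes the opposite end `s l !c` leave the side while nothing enters,
  -- against minimality.
  · have h2 := hmin s' ⟨hs'f, by rw [hs'j]; exact hs.2⟩
    have h3 : side s' ⊂ side s := by
      refine Finset.ssubset_iff_of_subset (fun d hd => ?_) |>.2 ⟨s l !c, ?_, ?_⟩
      · obtain ⟨hdC, hd⟩ := Finset.mem_filter.1 hd
        rw [hs'j] at hd
        refine Finset.mem_filter.2 ⟨hdC, ?_⟩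
        rcases hcases s' hd with h | ⟨b₂, -, h⟩
        · exact (hKs.2 h).mono hKsub
        · exfalso
          by_cases hb : b₂ = c
          · rw [hb, hs'l'] at h
            exact h1 (hKs.2 h)
          · obtain rfl : b₂ = !c := by cases c <;> cases b₂ <;> simp_all
            rw [Bool.not_not, hs'l] at h
            exact hc'A ((hKs.2 h).mono hKsub)
      · exact Finset.mem_filter.2 ⟨hf.subset _ _ (hs.1 l _), hl _⟩
      · intro hd
        obtain ⟨-, hd⟩ := Finset.mem_filter.1 hd
        rw [hs'j] at hd
        rcases hcases s' hd with h | ⟨b₂, -, h⟩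
        · exact h1 (hKs.2 h)
        · by_cases hb : b₂ = c
          · rw [hb, hs'l'] at h
            exact h1 (hKs.2 h)
          · obtain rfl : b₂ = !c := by cases c <;> cases b₂ <;> simp_all
            rw [Bool.not_not, hs'l] at h
            exact hc'A ((hKs.2 h).mono hKsub)
    exact absurd (Finset.card_lt_card h3) (by omega)

/-- The pairs outside a maximal closed set `Y`: if one of their members meets `Y` then there is a
choice in which this is the only pair joining `Y` to its complement. -/
theorem exists_only (hf : TreeSystem C f) (hYC : Y ⊆ C)
    (hY : Y.card ≤ (inner f Y).card + 1)
    (hmax : ∀ Z, Z ⊂ C → Z.card ≤ (inner f Z).card + 1 → Z.card ≤ Y.card)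
    {j : L} (hj : j ∉ inner f Y) {b : Bool} {c₀ : ι} (hc₀ : c₀ ∈ f j b) (hc₀Y : c₀ ∈ Y) :
    ∃ s : L → Bool → ι, (∀ l b, s l b ∈ f l b) ∧ s j b ∈ Y ∧
      ∀ l ≠ j, l ∉ inner f Y → ∀ b', s l b' ∉ Y := by
  obtain ⟨s, hs, hsj, hside⟩ := hf.exists_side hc₀
  set Z : Finset ι := C.filter fun c => Conn s {j}ᶜ c (s j b) with hZ
  have hZmem : ∀ {c}, c ∈ Z ↔ c ∈ C ∧ Conn s {j}ᶜ c (s j b) := by simp [hZ]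
  have hjb : s j b ∈ Z := hZmem.2 ⟨hf.subset _ _ (hs j b), Conn.refl _⟩
  have hjb' : s j (!b) ∉ Z := fun h => hf.not_conn hs j b (hZmem.1 h).2.symm
  have hjC : s j (!b) ∈ C := hf.subset _ _ (hs j !b)
  have hin : ∀ l ≠ j, ∀ b', s l b' ∈ Z → l ∈ inner f Z := fun l hl b' h =>
    mem_inner.2 fun b'' c hc => hZmem.2 ⟨hf.subset _ _ hc,
      hside l hl b' (hZmem.1 h).2 b'' c hc⟩
  have hYZ : Y ⊆ Z := by
    intro c hc
    refine hZmem.2 ⟨hYC hc, ?_⟩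
    have := hf.conn_inner hs hY hc (hsj ▸ hc₀Y : s j b ∈ Y)
    exact this.mono fun l hl hlj => hj (hlj ▸ hl)
  have hZC : Z ⊂ C := ⟨Finset.filter_subset _ _, fun h => hjb' (h hjC)⟩
  -- Apart from `j`, the edges not inner to `Z` form a forest on `C \ Z`, so there are fewer than
  -- `|C \ Z|` of them. Hence `Z` is itself closed, and maximality of `Y ⊆ Z` gives equality.
  have hcard : Z.card ≤ (inner f Z).card + 1 := by
    have h1 := card_lt_of_acyc (e := s) ((inner f Z)ᶜ.erase j)
      ((hf.acyc s hs).mono (Set.subset_univ _)) (C \ Z)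
      ⟨_, Finset.mem_sdiff.2 ⟨hjC, hjb'⟩⟩ fun l hl b' => by
        rw [Finset.mem_erase, Finset.mem_compl] at hl
        exact Finset.mem_sdiff.2 ⟨hf.subset _ _ (hs l b'), fun h => hl.2 (hin l hl.1 b' h)⟩
    rw [Finset.card_sdiff_of_subset hZC.1] at h1
    have h2 := Finset.card_add_card_compl (inner f Z)
    have h3 := Finset.pred_card_le_card_erase (s := (inner f Z)ᶜ) (a := j)
    have h4 := hf.card_eq
    have h5 := Finset.card_le_card hZC.1
    omega
  have hYZ' : Y = Z := Finset.eq_of_subset_of_card_le hYZ (hmax Z hZC hcard)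
  refine ⟨s, hs, hYZ' ▸ hjb, fun l hl hlY b' h => hlY ?_⟩
  rw [hYZ'] at h ⊢
  exact hin l hl b' h

/-- The number of sets of the system that meet `X`. -/
noncomputable def meeting (f : L → Bool → Finset ι) (X : Finset ι) : Finset (L × Bool) :=
  Finset.univ.filter fun p => ∃ c ∈ f p.1 p.2, c ∈ X

/-- Let `Y` be a largest proper subset spanned by its `|Y| - 1` inner pairs. Among the sets of the
other `|C \ Y|` pairs exactly one meets `Y`, and it lies inside `Y`. So at most `2(|Y| - 1) + 1`
sets meet `Y`, and at most `2|C \ Y| - 1` meet the complement. -/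
theorem exists_partition (hf : TreeSystem C f) (hC : 2 ≤ C.card) :
    ∃ X Y : Finset ι, X.Nonempty ∧ Y.Nonempty ∧ X ⊆ C ∧ Y ⊆ C ∧ X.card + Y.card = C.card ∧
      (meeting f X).card + 1 ≤ 2 * X.card ∧ (meeting f Y).card + 1 ≤ 2 * Y.card := by
  obtain ⟨c, hc⟩ := Finset.card_pos.1 (show 0 < C.card by omega)
  obtain ⟨Y, hY, hmax⟩ := Finset.exists_max_image
    (C.powerset.filter fun Z => Z ≠ C ∧ Z.card ≤ (inner f Z).card + 1) Finset.card ⟨{c}, by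
      rw [Finset.mem_filter, Finset.mem_powerset]
      refine ⟨by simpa using hc, fun h => ?_, by simp⟩
      rw [← h, Finset.card_singleton] at hC
      omega⟩
  rw [Finset.mem_filter, Finset.mem_powerset] at hY
  obtain ⟨hYC, hYne, hYcl⟩ := hY
  have hmax' : ∀ Z, Z ⊂ C → Z.card ≤ (inner f Z).card + 1 → Z.card ≤ Y.card := fun Z hZ hZ' =>
    hmax Z (Finset.mem_filter.2 ⟨Finset.mem_powerset.2 hZ.1, fun h => by
      rw [h] at hZ
      exact hZ.2 (Finset.Subset.refl _), hZ'⟩)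
  have hYpos : Y.Nonempty := by
    have := hmax' {c} ⟨by simpa using hc, fun h => by
      have := Finset.card_le_card h
      rw [Finset.card_singleton] at this
      omega⟩ (by simp)
    exact Finset.card_pos.1 (by simpa using this)
  have hin := hf.card_inner_lt hYpos
  have hXcard := Finset.card_sdiff_of_subset hYC
  have hYlt : Y.card < C.card := Finset.card_lt_card ⟨hYC, fun h => hYne (hYC.antisymm h)⟩
  have hXpos : (C \ Y).Nonempty := Finset.card_pos.1 (by omega)
  have hLc := hf.card_eq
  have hcompl := Finset.card_add_card_compl (inner f Y)
  -- the outer pairs cannot all avoid `Y`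
  have hout : ∀ s : L → Bool → ι, (∀ l b, s l b ∈ f l b) →
      ∃ l ∉ inner f Y, ∃ b, s l b ∈ Y := by
    intro s hs
    by_contra! hcon
    have := card_lt_of_acyc (e := s) (inner f Y)ᶜ ((hf.acyc s hs).mono (Set.subset_univ _))
      (C \ Y) hXpos fun l hl b => Finset.mem_sdiff.2
        ⟨hf.subset _ _ (hs l b), hcon l (Finset.mem_compl.1 hl) b⟩
    omega
  have hend : ∀ s : L → Bool → ι, (∀ l b, s l b ∈ f l b) → ∀ j ∉ inner f Y, ∀ b,
      s j b ∈ Y → s j (!b) ∉ Y := by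
    intro s hs j hj b h1 h2
    exact hf.not_conn hs j b ((hf.conn_inner hs hYcl h1 h2).mono fun l hl hlj => hj (hlj ▸ hl))
  -- Start from a choice where `j` is the only outer pair touching `Y`. Moving its end out of `Y`
  -- would separate `Y` from the rest; moving the other end into `Y` would close a cycle.
  have hjY : ∀ j ∉ inner f Y, ∀ b, (∃ c ∈ f j b, c ∈ Y) →
      f j b ⊆ Y ∧ (∀ c ∈ f j !b, c ∉ Y) ∧
        ∀ l ≠ j, l ∉ inner f Y → ∀ b', ∃ c ∈ f l b', c ∉ Y := by
    rintro j hj b ⟨c₀, hc₀, hc₀Y⟩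
    obtain ⟨s, hs, hsj, hrest⟩ := hf.exists_only hYC hYcl hmax' hj hc₀ hc₀Y
    refine ⟨fun c' hc' => ?_, fun c' hc' hc'Y => ?_, fun l hl hlY b' =>
      ⟨_, hs l b', hrest l hl hlY b'⟩⟩
    · by_contra hc'Y
      obtain ⟨l, hl, b', h⟩ := hout (setEnd s j b c') (mem_setEnd hs hc')
      by_cases hlj : l = j
      · subst hlj
        by_cases hb : b' = b
        · rw [hb, setEnd_self] at h
          exact hc'Y h
        · obtain rfl : b' = !b := by cases b <;> cases b' <;> simp_all
          rw [setEnd_not] at h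
          exact hend s hs l hl b hsj h
      · rw [setEnd_of_ne hlj] at h
        exact hrest l hlj hl b' h
    · refine hend (setEnd s j (!b) c') (mem_setEnd hs hc') j hj b ?_ ?_
      · have := setEnd_not (z := s) j (!b) c'
        rw [Bool.not_not] at this
        rw [this]
        exact hsj
      · rw [setEnd_self]
        exact hc'Y
  obtain ⟨s, hs⟩ : ∃ s : L → Bool → ι, ∀ l b, s l b ∈ f l b := by
    choose s hs using hf.nonempty
    exact ⟨s, hs⟩
  obtain ⟨j, hj, b, hjb⟩ := hout s hs
  obtain ⟨h1, h2, h3⟩ := hjY j hj b ⟨_, hs j b, hjb⟩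
  have honly : ∀ l ∉ inner f Y, ∀ b', (∃ c ∈ f l b', c ∈ Y) → l = j ∧ b' = b := by
    intro l hl b' hlb'
    have hlj : l = j := by
      by_contra hlj
      obtain ⟨c', hc', hc'Y⟩ := h3 l hlj hl b'
      exact hc'Y ((hjY l hl b' hlb').1 hc')
    subst hlj
    refine ⟨rfl, ?_⟩
    by_contra hb
    obtain rfl : b' = !b := by cases b <;> cases b' <;> simp_all
    obtain ⟨c', hc', hc'Y⟩ := hlb'
    exact h2 c' hc' hc'Y
  refine ⟨C \ Y, Y, hXpos, hYpos, Finset.sdiff_subset, hYC, by omega, ?_, ?_⟩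
  · have hsub : meeting f (C \ Y) ⊆ ((inner f Y)ᶜ ×ˢ Finset.univ).erase (j, b) := by
      rintro ⟨l, b'⟩ hp
      obtain ⟨-, c', hc', hc'X⟩ := Finset.mem_filter.1 hp
      have hc'Y := (Finset.mem_sdiff.1 hc'X).2
      rw [Finset.mem_erase, Finset.mem_product, Finset.mem_compl]
      refine ⟨fun h => ?_, fun hl => hc'Y (mem_inner.1 hl b' hc'), Finset.mem_univ _⟩
      obtain ⟨rfl, rfl⟩ := Prod.mk.inj h
      exact hc'Y (h1 hc')
    have h4 := Finset.card_le_card hsub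
    have h5 := Finset.card_erase_add_one (s := (inner f Y)ᶜ ×ˢ (Finset.univ : Finset Bool))
      (a := (j, b)) (Finset.mem_product.2 ⟨Finset.mem_compl.2 hj, Finset.mem_univ _⟩)
    rw [Finset.card_product, Finset.card_univ, Fintype.card_bool] at h5
    omega
  · have hsub : meeting f Y ⊆ insert (j, b) (inner f Y ×ˢ Finset.univ) := by
      rintro ⟨l, b'⟩ hp
      obtain ⟨-, hp⟩ := Finset.mem_filter.1 hp
      rw [Finset.mem_insert, Finset.mem_product]
      by_cases hl : l ∈ inner f Y
      · exact Or.inr ⟨hl, Finset.mem_univ _⟩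
      · obtain ⟨rfl, rfl⟩ := honly l hl b' hp
        exact Or.inl rfl
    have h4 := Finset.card_le_card hsub
    have h5 := Finset.card_insert_le (j, b) (inner f Y ×ˢ (Finset.univ : Finset Bool))
    rw [Finset.card_product, Finset.card_univ, Fintype.card_bool] at h5
    omega

end TreeSystem

end Hypertree

/-! ### A component with `q` classes, free choice from its blocks, and the contradiction for odd
`q`. -/

section Main

variable {V ι : Type*} {J : Type} [Fintype V] [Fintype ι] [Fintype J]
  {G : SimpleGraph V} {κ : V → ι} {n Δ D q : ℕ} {S C : Finset ι} {z z₀ : J → Bool → V}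

/-- The forest has exactly `D` components on `S`, and `|S| < (q + 1) D`. -/
theorem IsFull.exists_component (hF : IsFull G κ D S z₀)
    (hq : Fintype.card ι < (q + 1) * D) :
    ∃ C ⊆ S, C.Nonempty ∧ C.card ≤ q ∧ ∀ c ∈ C, ∀ d ∈ S,
      Conn (fun i b => κ (z₀ i b)) Set.univ c d → d ∈ C := by
  have h1 := card_image_comp Finset.univ Finset.coe_univ.symm hF.acyc S fun i _ b => hF.mem i b
  rw [Finset.card_univ, ← hF.card_eq] at h1
  have h2 : S.card < (S.image (comp (fun i b => κ (z₀ i b)) Set.univ)).card * (q + 1) := by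
    rw [show (S.image (comp (fun i b => κ (z₀ i b)) Set.univ)).card = D by omega, mul_comm]
    exact (Finset.card_le_univ S).trans_lt hq
  obtain ⟨x, hx, hlt⟩ := Finset.exists_card_fiber_lt_of_card_lt_mul h2
  obtain ⟨c, hc, rfl⟩ := Finset.mem_image.1 hx
  refine ⟨S.filter fun x => comp (fun i b => κ (z₀ i b)) Set.univ x =
    comp (fun i b => κ (z₀ i b)) Set.univ c, Finset.filter_subset _ S, ⟨c, Finset.mem_filter.2 ⟨hc, rfl⟩⟩,
    Nat.le_of_lt_succ hlt, fun a ha d hd had => ?_⟩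
  rw [Finset.mem_filter] at ha ⊢
  exact ⟨hd, (comp_eq_iff.2 had.symm).trans ha.2⟩

/-- The blocks whose labels belong to the component `C`. -/
noncomputable def blockOn (G : SimpleGraph V) (κ : V → ι) (S C : Finset ι) (z₀ : J → Bool → V)
    (l : {j // κ (z₀ j false) ∈ C}) (b : Bool) : Finset V :=
  block G κ S z₀ l b

theorem IsSys.mem_of_mem_block (H : Host G κ n Δ D) (hZ : IsSys G κ D ∅ Set.univ S z₀)
    (hcl : ∀ c ∈ C, ∀ d ∈ S, Conn (fun i b => κ (z₀ i b)) Set.univ c d → d ∈ C) {j : J} {b : Bool}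
    {v : V} (hv : v ∈ block G κ S z₀ j b) : κ v ∈ C ↔ κ (z₀ j false) ∈ C := by
  have h := hZ.conn_of_mem_block H hv false
  exact ⟨fun h' => hcl _ h' _ (hZ.full.mem _ _) h,
    fun h' => hcl _ h' _ (mem_block.1 hv).1 h.symm⟩

/-- A forest on `C` has fewer than `|C|` edges, and their ends dominate `C` by way of the blocks. So
`n|C|` is at most `2Δ` times the number of edges; `hN` excludes first `|C| < q`, then fewer than `q
- 1` edges. -/
theorem IsSys.blockSystem (H : Host G κ n Δ D) (hZ : IsSys G κ D ∅ Set.univ S z₀)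
    (hN : ∀ m, 1 ≤ m → m < q → 2 * Δ * (m - 1) < n * m) (hq : 2 ≤ q) (hCS : C ⊆ S)
    (hCne : C.Nonempty) (hCq : C.card ≤ q)
    (hcl : ∀ c ∈ C, ∀ d ∈ S, Conn (fun i b => κ (z₀ i b)) Set.univ c d → d ∈ C) :
    BlockSystem G κ Δ C (blockOn G κ S C z₀) ∧ C.card = q := by
  have hcover : ∀ v, κ v ∈ C → ∃ (l : {j // κ (z₀ j false) ∈ C}) (b : Bool),
      v ∈ blockOn G κ S C z₀ l b := by
    intro v hv
    obtain ⟨j, b, h⟩ := hZ.exists_block H (hCS hv)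
    exact ⟨⟨j, (hZ.mem_of_mem_block H hcl h).1 hv⟩, b, h⟩
  have hlt : Fintype.card {j // κ (z₀ j false) ∈ C} < C.card := by
    rw [Fintype.card_subtype]
    refine card_lt_of_acyc (e := fun i b => κ (z₀ i b)) _ (hZ.full.acyc.mono (Set.subset_univ _))
      C hCne fun j hj b => ?_
    exact hcl _ (Finset.mem_filter.1 hj).2 _ (hZ.full.mem j b)
      (Conn.edge (e := fun i b => κ (z₀ i b)) (Set.mem_univ j) _ _)
  have hcount : n * C.card ≤ 2 * Δ * Fintype.card {j // κ (z₀ j false) ∈ C} := by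
    have h1 := H.card_le_of_cover (X := verts κ C)
      (ends (fun (l : {j // κ (z₀ j false) ∈ C}) => z₀ l) Finset.univ) ∅ fun v hv => by
        obtain ⟨l, b, h⟩ := hcover v (mem_verts.1 hv)
        refine Or.inr ⟨z₀ l !b, mem_ends.2 ⟨l, Finset.mem_univ _, !b, rfl⟩, ?_⟩
        exact (hZ.block_adj H h (hZ.end_mem_block H Relation.ReflTransGen.refl _ _)).symm
    have h2 := card_ends_le (fun (l : {j // κ (z₀ j false) ∈ C}) => z₀ l) Finset.univ
    rw [Finset.card_univ] at h2
    rw [Finset.card_empty, add_zero] at h1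
    refine (H.le_card_verts C).trans (h1.trans ((Nat.mul_le_mul_left _ h2).trans (le_of_eq ?_)))
    ring
  have hpos := Finset.card_pos.2 hCne
  have hCeq : C.card = q := by
    by_contra hne
    have h1 := hN C.card hpos (by omega)
    have h2 := Nat.lt_of_mul_lt_mul_left (h1.trans_le hcount)
    omega
  refine ⟨⟨hcover, ?_, ?_, ?_, ?_⟩, hCeq⟩
  · exact fun l b v hv => (hZ.mem_of_mem_block H hcl hv).2 l.2
  · exact fun l b x hx y hy => hZ.block_adj H hx hy
  · exact fun l b => hZ.lt_card_block H l b
  · have h1 := hN (q - 1) (by omega) (by omega)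
    have h2 : n * (q - 1) ≤ n * C.card := Nat.mul_le_mul_left _ (by omega)
    have h3 := Nat.lt_of_mul_lt_mul_left ((h1.trans_le h2).trans_le hcount)
    omega

/-- If adjacent vertices always lie in opposite blocks, all choices of one vertex from each block
are realised simultaneously by a reachable matching. -/
theorem IsSys.exists_reach_eq (H : Host G κ n Δ D) (hZ : IsSys G κ D ∅ Set.univ S z₀)
    (hCS : C ⊆ S) (hB : BlockSystem G κ Δ C (blockOn G κ S C z₀))
    (hopp : ∀ l l' c c' u v, u ∈ blockOn G κ S C z₀ l c → v ∈ blockOn G κ S C z₀ l' c' →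
      G.Adj u v → l = l' ∧ c' = !c)
    {s : {j // κ (z₀ j false) ∈ C} → Bool → V} (hs : ∀ l b, s l b ∈ blockOn G κ S C z₀ l b)
    (P : Finset ({j // κ (z₀ j false) ∈ C} × Bool)) :
    ∃ z, Reach G κ S Set.univ z₀ z ∧ ∀ p ∈ P, z p.1 p.2 = s p.1 p.2 := by
  induction P using Finset.induction_on with
  | empty => exact ⟨z₀, Relation.ReflTransGen.refl, by simp⟩
  | insert p P hp ih =>
    obtain ⟨z, hz, hzP⟩ := ih
    obtain ⟨l, b⟩ := p
    set w := s l b with hw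
    have hwB := hs l b
    rw [← hw] at hwB
    let dm : (J → Bool → V) → Finset (J × Bool) := fun y =>
      Finset.univ.filter fun t => t.1 ≠ l.1 ∧ G.Adj (y t.1 t.2) w
    have hdm : ∀ y j b, (j, b) ∈ dm y ↔ j ≠ l.1 ∧ G.Adj (y j b) w := fun y j b => by simp [dm]
    let good : Set (J → Bool → V) := {y | Reach G κ S Set.univ z₀ y ∧
      ∀ p ∈ P, y p.1 p.2 = s p.1 p.2}
    obtain ⟨y, hy, hmin⟩ : ∃ y ∈ good, ∀ y' ∈ good, (dm y).card ≤ (dm y').card := by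
      have hne : ∃ m, ∃ y ∈ good, (dm y).card = m := ⟨_, z, ⟨hz, hzP⟩, rfl⟩
      obtain ⟨y, hy, hm⟩ := Nat.find_spec hne
      exact ⟨y, hy, fun y' hy' => hm ▸ Nat.find_min' hne ⟨y', hy', rfl⟩⟩
    have hY := hZ.reach H hy.1
    have hloose : w ∈ loose G κ S y l := by
      refine mem_loose.2 ⟨hCS (hB.mem l b w hwB), fun j hj c hadj => ?_⟩
      have hend := hZ.end_mem_block H hy.1 j c
      have hjC : κ (z₀ j false) ∉ C := by
        intro hjC
        have := hopp ⟨j, hjC⟩ l c b _ _ hend hwB hadj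
        exact hj (congrArg Subtype.val this.1)
      -- A dominator of `w` outside the edge `l` can be swapped away: its swap set and the block
      -- opposite `w` are disjoint and both above `2Δ/3`, so they cannot both lie in `nb G w`. By
      -- `hopp` its label lies outside `C`, so the values already fixed on `P` survive.
      obtain ⟨x, hx, hxw⟩ : ∃ x ∈ swap G κ S y j c, ¬ G.Adj x w := by
        by_contra! hcon
        obtain ⟨t, ht, ht'⟩ := exists_mem_inter (X := swap G κ S y j c)
          (Y := blockOn G κ S C z₀ l !b) (N := nb G w)
          (fun x hx => mem_nb.2 (hcon x hx).symm) (hB.subset_nb hwB) (by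
            have h1 := hY.lt_card_swap H (Set.mem_univ j) c
            have h2 := hB.large l !b
            have h3 := H.deg w
            omega)
        exact hj (hZ.block_disjoint H (hZ.swap_subset_block H hy.1 j c ht) ht').1
      have hsub : dm (setEnd y j c x) ⊆ (dm y).erase (j, c) := by
        rintro ⟨i, b'⟩ hi
        rw [hdm] at hi
        rw [Finset.mem_erase, hdm]
        by_cases hib : i = j ∧ b' = c
        · obtain ⟨rfl, rfl⟩ := hib
          rw [setEnd_self] at hi
          exact (hxw hi.2).elim
        · refine ⟨fun h => hib (by simpa using h), ?_⟩
          simpa [setEnd, hib] using hi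
      have h1 := Finset.card_le_card hsub
      have h2 := Finset.card_erase_add_one ((hdm y j c).2 ⟨hj, hadj⟩)
      have h3 := hmin (setEnd y j c x) ⟨hy.1.tail ⟨j, trivial, c, x, hx, rfl⟩, fun p hp => by
        rw [setEnd_of_ne (fun h : p.1.1 = j => hjC (h ▸ p.1.2))]
        exact hy.2 p hp⟩
      omega
    obtain ⟨b', hb'⟩ := hY.mem_swap_of_loose H (Set.mem_univ l.1) hloose
    obtain rfl : b' = b :=
      (hZ.block_disjoint H (hZ.swap_subset_block H hy.1 l b' hb') hwB).2
    refine ⟨setEnd y l b' w, hy.1.tail ⟨l, trivial, b', w, hb', rfl⟩, fun p' hp' => ?_⟩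
    rcases Finset.mem_insert.1 hp' with rfl | hp'
    · exact setEnd_self _ _ _
    · have hne : ¬ (p'.1.1 = l.1 ∧ p'.2 = b') := fun h =>
        hp ((Prod.ext (Subtype.ext h.1) h.2 : p' = (l, b')) ▸ hp')
      rw [← hy.2 p' hp']
      simp [setEnd, hne]

/-- A choice of classes lifts to a choice of vertices in the blocks, realised by a reachable
matching, whose edges form a forest. -/
theorem IsSys.treeSystem (H : Host G κ n Δ D) (hZ : IsSys G κ D ∅ Set.univ S z₀)
    (hCS : C ⊆ S) (hB : BlockSystem G κ Δ C (blockOn G κ S C z₀))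
    (hopp : ∀ l l' c c' u v, u ∈ blockOn G κ S C z₀ l c → v ∈ blockOn G κ S C z₀ l' c' →
      G.Adj u v → l = l' ∧ c' = !c) :
    TreeSystem C fun l b => (blockOn G κ S C z₀ l b).image κ where
  nonempty l b := (hB.nonempty l b).image κ
  subset l b := by
    intro c hc
    obtain ⟨v, hv, rfl⟩ := Finset.mem_image.1 hc
    exact hB.mem l b v hv
  acyc t ht := by
    have : ∀ l b, ∃ v ∈ blockOn G κ S C z₀ l b, κ v = t l b := fun l b =>
      Finset.mem_image.1 (ht l b)
    choose s hs hst using this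
    obtain ⟨z, hz, hzs⟩ := hZ.exists_reach_eq H hCS hB hopp hs Finset.univ
    have h1 := Acyc.comp_label (e := fun i b => κ (z i b)) (A' := Set.univ)
      (f := (Subtype.val : {j // κ (z₀ j false) ∈ C} → J)) Subtype.val_injective
      ((hZ.reach H hz).full.acyc.mono (Set.subset_univ _))
    refine h1.congr fun l _ b => ?_
    rw [hzs (l, b) (Finset.mem_univ _), hst]
  card_eq := hB.card_eq

theorem Host.false_of_odd (H : Host G κ n Δ D) (hq : 3 ≤ q) (hodd : Odd q)
    (hr : Fintype.card ι < (q + 1) * D)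
    (hN : ∀ m, 1 ≤ m → m < q → 2 * Δ * (m - 1) < n * m)
    (hcrit : ∀ f : Bool → V, G.Adj (f false) (f true) → ∃ T : Finset V,
      (∀ u ∈ T, ∀ v ∈ T, G.Adj u v → (u = f false ∧ v = f true) ∨ (u = f true ∧ v = f false)) ∧
      (∀ u ∈ T, ∀ v ∈ T, κ u = κ v → u = v) ∧ Fintype.card ι < T.card + D) : False := by
  obtain ⟨S, J, hJ, z₀, hZ⟩ := H.exists_isSys
  obtain ⟨C, hCS, hCne, hCq, hcl⟩ := hZ.full.exists_component hr
  obtain ⟨hB, hC⟩ := hZ.blockSystem H hN (by omega) hCS hCne hCq hcl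
  have hopp : ∀ l l' c c' u v, u ∈ blockOn G κ S C z₀ l c → v ∈ blockOn G κ S C z₀ l' c' →
      G.Adj u v → l = l' ∧ c' = !c := by
    intro l l' c c' u v hu hv hadj
    obtain ⟨T, h1, h2, h3⟩ := hcrit (fun b => bif b then v else u) hadj
    obtain ⟨S', J', hJ', y, j₀, hf, hY⟩ := H.exists_isSys_edge
      (f := fun b => bif b then v else u) hadj h1 h2 h3
    exact hB.opposite_of_adj H (by rwa [hC]) hf hY hu hv
  have hT := hZ.treeSystem H hCS hB hopp
  obtain ⟨X, Y, hX, hY, hXC, hYC, hcard, hmX, hmY⟩ := hT.exists_partition (by omega)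
  -- For each block meeting `X`, the matching end in the opposite slot dominates it. This gives
  -- `n|X| ≤ Δ(2|X| - 1)`, which `hN` forbids at `m = 2|X|`.
  have key : ∀ X : Finset ι, X.Nonempty → X ⊆ C → 2 * X.card < q →
      (TreeSystem.meeting (fun l b => (blockOn G κ S C z₀ l b).image κ) X).card + 1
        ≤ 2 * X.card → False := by
    intro X hX hXC hlt hm
    have h1 := H.card_le_of_cover (X := verts κ X)
      ((TreeSystem.meeting (fun l b => (blockOn G κ S C z₀ l b).image κ) X).image
        fun p => z₀ p.1 !p.2) ∅ fun v hv => by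
        rw [mem_verts] at hv
        obtain ⟨l, b, h⟩ := hB.cover v (hXC hv)
        refine Or.inr ⟨z₀ l !b, Finset.mem_image.2 ⟨(l, b), Finset.mem_filter.2
          ⟨Finset.mem_univ _, κ v, Finset.mem_image_of_mem _ h, hv⟩, rfl⟩, ?_⟩
        exact (hZ.block_adj H h (hZ.end_mem_block H Relation.ReflTransGen.refl _ _)).symm
    have h2 := H.le_card_verts X
    have h3 := hN (2 * X.card) (by have := Finset.card_pos.2 hX; omega) hlt
    rw [Finset.card_empty, add_zero] at h1
    have h4 : Δ * ((TreeSystem.meeting (fun l b => (blockOn G κ S C z₀ l b).image κ) X).image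
        fun p => z₀ p.1 !p.2).card ≤ Δ * (2 * X.card - 1) :=
      Nat.mul_le_mul_left _ (Finset.card_image_le.trans (by omega))
    have h5 : n * (2 * X.card) = 2 * (n * X.card) := by ring
    have h6 : 2 * Δ * (2 * X.card - 1) = 2 * (Δ * (2 * X.card - 1)) := by ring
    omega
  obtain ⟨t, ht⟩ := hodd
  -- As `|X| + |Y| = q` is odd, twice the smaller size is strictly below `q`.
  by_cases hXY : X.card ≤ Y.card
  · exact key X hX hXC (by omega) hmX
  · exact key Y hY hYC (by omega) hmY

end Main

/-! ### From the extremal number to an edge-minimal deficient graph, and attainment of the supremum.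
-/

theorem bound_of_existsGraphWithoutIT {r d q k Δ n : ℕ} (hr : r = q * (d + 1) + k) (hk : k ≤ d)
    (hq : 3 ≤ q) (hodd : Odd q) (h : ExistsGraphWithoutIT r (d + 1) Δ n) :
    (n : ℝ) ≤ max (2 * (Δ : ℝ) * (1 - (6 * (d : ℝ) + 7) / (6 * (r : ℝ))))
      (2 * (Δ : ℝ) * (1 - 1 / ((q : ℝ) - 1))) := by
  by_contra! hlt
  obtain ⟨hlt1, hlt2⟩ := max_lt_iff.1 hlt
  obtain ⟨V, hV, G₀, hG₀, c, hn, hΔ, hIT⟩ := h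
  have hr3 : 3 * (d + 1) ≤ r := by
    rw [hr]
    exact (Nat.mul_le_mul_right _ hq).trans (Nat.le_add_right _ _)
  have hmiss₀ : ∀ T, IsTrans G₀ c T → T.card + (d + 1) ≤ Fintype.card (Fin r) := by
    intro T hT
    by_contra! hcard
    rw [Fintype.card_fin] at hcard
    obtain ⟨T', hT', hcard'⟩ := Finset.exists_subset_card_eq (show r + 1 - (d + 1) ≤ T.card by omega)
    exact hIT ⟨T', fun u hu v hv _ => hT.indep u (hT' hu) v (hT' hv),
      fun u hu v hv huv => hT.inj u (hT' hu) v (hT' hv) huv, hcard'⟩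
  let good : Set (SimpleGraph V) := {G | G ≤ G₀ ∧
    ∀ T, IsTrans G c T → T.card + (d + 1) ≤ Fintype.card (Fin r)}
  obtain ⟨G, ⟨hGG₀, hmiss⟩, hmin⟩ := (Set.toFinite good).exists_minimal ⟨G₀, le_rfl, hmiss₀⟩
  have H : Host G (c : V → Fin r) n Δ (d + 1) := by
    refine ⟨fun v => ?_, fun i => ?_, hmiss, by omega, fun y hy hy' => ?_⟩
    · refine le_trans (Finset.card_le_card fun u hu => ?_) (hΔ ▸ G₀.degree_le_maxDegree v)
      rw [SimpleGraph.mem_neighborFinset]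
      exact hGG₀ (mem_nb.1 hu)
    · refine (hn i).trans (le_of_eq ?_)
      rw [← Set.ncard_coe_finset]
      congr 1
      ext v
      rw [Finset.coe_filter]
      exact (and_iff_right (Finset.mem_univ v)).symm
    · rw [Fintype.card_fin] at hy'
      have hr0 : (0 : ℝ) < r := by
        have : 0 < r := by omega
        exact_mod_cast this
      have hy0 : (0 : ℝ) < y := by exact_mod_cast hy
      have hyr : (y : ℝ) ≤ r := by exact_mod_cast hy'
      -- The first bound is exactly `tight` at `y = r`; a smaller `y` follows because the subtracted
      -- term only shrinks by the factor `y / r ≤ 1`.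
      have h1 := mul_lt_mul_of_pos_right hlt1 hy0
      have h2 : (y : ℝ) / r ≤ 1 := (div_le_one hr0).2 hyr
      have h3 : 2 * (Δ : ℝ) * (1 - (6 * (d : ℝ) + 7) / (6 * (r : ℝ))) * y =
          2 * Δ * y - Δ * (6 * d + 7) / 3 * (y / r) := by
        field_simp
        ring
      have h4 : (Δ : ℝ) * (6 * d + 7) / 3 * (y / r) ≤ Δ * (6 * d + 7) / 3 :=
        mul_le_of_le_one_right (by positivity) h2
      have h5 : (6 * Δ * y : ℝ) < 3 * n * y + 6 * Δ * (d + 1) + Δ := by nlinarith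
      exact_mod_cast h5
  refine H.false_of_odd hq hodd ?_ (fun m hm hmq => ?_) fun f hf => ?_
  · rw [Fintype.card_fin, hr, add_mul]
    omega
  · obtain ⟨m, rfl⟩ : ∃ m', m = m' + 1 := ⟨m - 1, by omega⟩
    have hq1 : (0 : ℝ) < (q : ℝ) - 1 := by
      have : (3 : ℝ) ≤ q := by exact_mod_cast hq
      linarith
    have hmq' : ((m : ℝ) + 1) / ((q : ℝ) - 1) ≤ 1 := by
      rw [div_le_one hq1]
      have : ((m + 1 : ℕ) : ℝ) + 1 ≤ q := by exact_mod_cast hmq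
      push_cast at this
      linarith
    have h1 := mul_lt_mul_of_pos_right hlt2 (show (0 : ℝ) < (m : ℝ) + 1 by positivity)
    have h2 : 2 * (Δ : ℝ) * (1 - 1 / ((q : ℝ) - 1)) * (m + 1) =
        2 * Δ * (m + 1) - 2 * Δ * ((m + 1) / (q - 1)) := by ring
    have h3 : 2 * (Δ : ℝ) * ((m + 1) / (q - 1)) ≤ 2 * Δ :=
      mul_le_of_le_one_right (by positivity) hmq'
    have h4 : (2 * Δ * m : ℝ) < n * (m + 1) := by nlinarith
    rw [Nat.add_sub_cancel]
    exact_mod_cast h4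
  -- Minimality of `G`: deleting one edge creates a transversal missing fewer than `d + 1` classes,
  -- and in `G` that edge is its only possible adjacency.
  · have hnot : G.deleteEdges {s(f false, f true)} ∉ good := fun hgood => by
      have := hmin hgood (SimpleGraph.deleteEdges_le _) hf
      simp at this
    have hex : ∃ T, IsTrans (G.deleteEdges {s(f false, f true)}) c T ∧
        Fintype.card (Fin r) < T.card + (d + 1) := by
      by_contra! hcon
      exact hnot ⟨(SimpleGraph.deleteEdges_le _).trans hGG₀, hcon⟩
    obtain ⟨T, hT, hcard⟩ := hex
    refine ⟨T, fun u hu v hv hadj => ?_, hT.inj, hcard⟩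
    by_contra hne
    refine hT.indep u hu v hv (SimpleGraph.deleteEdges_adj.2 ⟨hadj, fun h => hne ?_⟩)
    simpa using h

/-- The complete bipartite graph with sides of size `Δ` has maximum degree exactly `Δ` and occupies
only two classes, whereas the forbidden transversal needs `r - d ≥ 3`. -/
theorem existsGraphWithoutIT_zero {r d Δ : ℕ} (hr : 3 * (d + 1) ≤ r) :
    ExistsGraphWithoutIT r (d + 1) Δ 0 := by
  let col : Fin Δ ⊕ Fin Δ → Fin r := Sum.elim (fun _ => ⟨0, by omega⟩) fun _ => ⟨1, by omega⟩
  refine ⟨Fin Δ ⊕ Fin Δ, inferInstance, completeBipartiteGraph (Fin Δ) (Fin Δ), inferInstance,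
    SimpleGraph.Coloring.mk col ?_, fun _ => Nat.zero_le _, ?_, ?_⟩
  · rintro (u | u) (v | v) h
    · simp at h
    · simp [col]
    · simp [col]
    · simp at h
  · have hdeg : ∀ v, (completeBipartiteGraph (Fin Δ) (Fin Δ)).degree v = Δ := by
      rintro (v | v)
      · have : (completeBipartiteGraph (Fin Δ) (Fin Δ)).neighborFinset (Sum.inl v) =
            Finset.univ.map Function.Embedding.inr := by
          ext (u | u) <;> simp
        rw [← SimpleGraph.card_neighborFinset_eq_degree, this, Finset.card_map, Finset.card_univ,
          Fintype.card_fin]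
      · have : (completeBipartiteGraph (Fin Δ) (Fin Δ)).neighborFinset (Sum.inr v) =
            Finset.univ.map Function.Embedding.inl := by
          ext (u | u) <;> simp
        rw [← SimpleGraph.card_neighborFinset_eq_degree, this, Finset.card_map, Finset.card_univ,
          Fintype.card_fin]
    refine le_antisymm (SimpleGraph.maxDegree_le_of_forall_degree_le _ _ fun v => (hdeg v).le) ?_
    rcases Nat.eq_zero_or_pos Δ with h | h
    · omega
    · exact (hdeg (Sum.inl ⟨0, h⟩)).ge.trans (SimpleGraph.degree_le_maxDegree _ _)
  · rintro ⟨T, -, hinj, hcard⟩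
    have h1 : T.card ≤ ({⟨0, by omega⟩, ⟨1, by omega⟩} : Finset (Fin r)).card := by
      refine Finset.card_le_card_of_injOn col (fun v _ => ?_) hinj
      rcases v with v | v <;> simp [col]
    have h2 := Finset.card_le_two (a := (⟨0, by omega⟩ : Fin r)) (b := ⟨1, by omega⟩)
    omega

end IndepTransversal

theorem theorem1p4 (r d q k Δ : ℕ) (hr : r = q * (d + 1) + k) (hk : k ≤ d)
    (hq : 3 ≤ q) (hodd : Odd q) :
    IsGreatest {n : ℕ | ExistsGraphWithoutIT r (d + 1) Δ n} (nExtremal r (d + 1) Δ) ∧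
    (nExtremal r (d + 1) Δ : ℝ) ≤
      max (2 * (Δ : ℝ) * (1 - (6 * (d : ℝ) + 7) / (6 * (r : ℝ))))
        (2 * (Δ : ℝ) * (1 - 1 / ((q : ℝ) - 1))) := by
  have hbound : ∀ n ∈ {n : ℕ | ExistsGraphWithoutIT r (d + 1) Δ n}, (n : ℝ) ≤
      max (2 * (Δ : ℝ) * (1 - (6 * (d : ℝ) + 7) / (6 * (r : ℝ))))
        (2 * (Δ : ℝ) * (1 - 1 / ((q : ℝ) - 1))) := fun n hn =>
    IndepTransversal.bound_of_existsGraphWithoutIT hr hk hq hodd hn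
  -- In `ℕ` the value of `sSup` is attained only for a nonempty bounded set or by default, so both
  -- properties are needed for the maximum.
  have hbdd : BddAbove {n : ℕ | ExistsGraphWithoutIT r (d + 1) Δ n} :=
    ⟨_, fun n hn => Nat.le_floor (hbound n hn)⟩
  have hne : {n : ℕ | ExistsGraphWithoutIT r (d + 1) Δ n}.Nonempty :=
    ⟨0, IndepTransversal.existsGraphWithoutIT_zero (by
      rw [hr]
      exact (Nat.mul_le_mul_right _ hq).trans (Nat.le_add_right _ _))⟩
  have hmem := Nat.sSup_mem hne hbdd
  exact ⟨⟨hmem, fun n hn => le_csSup hbdd hn⟩, hbound _ hmem⟩
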